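/- Let $\Phi_h$ be an $s$-stage Runge–Kutta method (explicit or implicit) with real coefficients $a_{ij},b_i$: for a vector field $g$, $\Phi_{h,g}(y)=y+h\sum_i b_ik_i$, where $k_i=g\bigl(y+h\sum_j a_{ij}k_j\bigr)$ and, if there are several solutions, the one with $\max_i\|k_i-g(y)\|$ minimal is taken. Suppose the method has order $p\ge 1$, that is, $\Phi_{h,g}(y)=\phi_{h,g}(y)+O(h^{p+1})$ as $h\to0^+$ for every smooth vector field $g$ on any $\mathbb R^N$ and every $y$, where $\phi_{t,g}$ denotes the exact flow of $\dot y=g(y)$. Let $S\ge 1$ and $\mathrm{ODESolve}(\cdot,g,T)=(\Phi_{T/S,g})^S$ ($S$-fold composition). Use the $\ell_\infty$-norm on $\mathbb C^N$, and let $\mathcal B(x,r)\subset\mathbb C^N$ be the open ball of radius $r$ centred at $x$. Let $m\in\mathbb R$ and $r_1,r_2>0$. Then there are positive constants $T_0,q,\gamma,c_1,c_2,C$ and a function $T\mapsto K(T)\in\mathbb N$, depending only on $m,r_1,r_2$ and the ODE solver (that is, on the method, $p$ and $S$), such that the following holds for every $N$, every $x\in\mathbb R^N$ and all vector fields $f$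 (target) and $f_{net}$ (learned) that are real analytic on $\mathcal B(x,r_1+r_2)$ (complex analytic there, and real at the real points of this ball) and satisfy $$\|f(y)\|\le m,\qquad \|f_{net}(y)\|\le m\qquad (y\in\mathcal B(x,r_1+r_2)).$$ (i) The coefficients $f_0,f_1,\dots$ of the inverse modified differential equation (IMDE) of $\Phi_{h,f}$, defined recursively by $$f_k(y)=\lim_{h\to0^+}\frac{\phi_{h,f}(y)-\Phi_{h,f_h^{k-1}}(y)}{h^{k+1}},\qquad f_h^{K}=\sum_{k=0}^{K}h^kf_k,\quad f_h^{-1}=0,$$ are analytic on $\mathcal B(x,r_1+r_2)$, and for every $K\ge0$ and every $y$ in this ball $\Phi_{h,f_h^K}(y)=\phi_{h,f}(y)+O(h^{K+2})$ as $h\to0^+$. (ii) For $0<T<T_0$ and every $y\in\mathcal B(x,r_1)$, each of the $S$ steps defining $\mathrm{ODESolve}(y,f_{net},T)$ has a unique result, $\phi_{T,f}(y)$ exists and is unique, and the supremum $$\mathcal L=\frac1T\sup_{y\in\mathcal B(x,r_1)}\bigl\|\mathrm{ODESolve}(y,f_{net},T)-\phi_{T,f}(y)\bigr\|$$ is finite.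 (iii) For $0<T<T_0$, with $h=T/S$ and $K=K(T)$, $$\|f_{net}(x)-f_h^{K}(x)\|\le c_1e^{-\gamma/T^{1/q}}+C\mathcal L,\qquad \|f_{net}(x)-f(x)\|\le c_2h^p+C\mathcal L .$$ -/

import Mathlib

open Filter Topology Asymptotics
open scoped ContDiff

noncomputable section

/-- The tableau `(a, b)` of an `s`-stage Runge-Kutta method (explicit or implicit). -/
structure RungeKutta (s : ℕ) where
  /-- the coefficients `a i j` of the stages -/
  a : Fin s → Fin s → ℝ
  /-- the weights `b i` -/
  b : Fin s → ℝ

section Flow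

variable {E : Type*} [NormedAddCommGroup E] [NormedSpace ℝ E]

/-- `w` is the value at time `t` of a solution on `[0, t]` of `y' = f y`, `y 0 = x`. -/
def IsFlowValue (f : E → E) (t : ℝ) (x w : E) : Prop :=
  ∃ γ : ℝ → E, γ 0 = x ∧ IsIntegralCurveOn γ (fun _ => f) (Set.Icc 0 t) ∧ γ t = w

/-- The exact flow `φ_{t,f}(x)`; meaningful where `∃! w, IsFlowValue f t x w`. -/
def flow (f : E → E) (t : ℝ) (x : E) : E :=
  Classical.epsilon (IsFlowValue f t x)

end Flow

namespace RungeKutta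

variable {E : Type*} [NormedAddCommGroup E] [NormedSpace ℝ E] {s : ℕ}

/-- The slopes `k` solve the stage equations of the method with step `h` at the point `y`. -/
def IsSlopes (M : RungeKutta s) (h : ℝ) (f : E → E) (y : E) (k : Fin s → E) : Prop :=
  ∀ i, k i = f (y + h • ∑ j, M.a i j • k j)

/-- Among all solutions of the stage equations, the slopes `k` are closest to `f y`. For an
explicit method the stage equations have only one solution; for an implicit one and small `h`
this is the local solution given by the implicit function theorem. -/
def IsLocalSlopes (M : RungeKutta s) (h : ℝ) (f : E → E) (y : E) (k : Fin s → E) : Prop :=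
  M.IsSlopes h f y k ∧
    ∀ l : Fin s → E, M.IsSlopes h f y l → ‖k - fun _ => f y‖ ≤ ‖l - fun _ => f y‖

/-- `w` is a result of one step of size `h` of the method, started at `y`. -/
def IsStepValue (M : RungeKutta s) (h : ℝ) (f : E → E) (y w : E) : Prop :=
  ∃ k : Fin s → E, M.IsLocalSlopes h f y k ∧ w = y + h • ∑ i, M.b i • k i

/-- The numerical one-step map `Φ_{h,f}`; meaningful where `∃! w, M.IsStepValue h f y w`. -/
def step (M : RungeKutta s) (h : ℝ) (f : E → E) (y : E) : E :=
  Classical.epsilon (M.IsStepValue h f y)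

/-- The method has order (at least) `p`: for every smooth vector field on every `ℝ^N` and every
initial value, the local error is `O(h^(p+1))` as `h → 0`. -/
def HasOrder (M : RungeKutta s) (p : ℕ) : Prop :=
  ∀ (N : ℕ) (f : (Fin N → ℝ) → (Fin N → ℝ)), ContDiff ℝ ∞ f → ∀ y : Fin N → ℝ,
    (fun h : ℝ => M.step h f y - flow f h y) =O[𝓝[>] 0] fun h : ℝ => h ^ (p + 1)

/-- `ODESolve(y, f, T)`: the `S`-fold composition of the one-step map with step `T / S`. -/
def odeSolve (M : RungeKutta s) (S : ℕ) (f : E → E) (T : ℝ) (y : E) : E :=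
  (M.step (T / S) f)^[S] y

/-- Every one of the `S` steps of `odeSolve` started at `y` has a uniquely determined result. -/
def SolverDefined (M : RungeKutta s) (S : ℕ) (f : E → E) (T : ℝ) (y : E) : Prop :=
  ∀ j < S, ∃! w, M.IsStepValue (T / S) f ((M.step (T / S) f)^[j] y) w

/-- The coefficient of `h^(k+1)` in `φ_{h,f}(y) - Φ_{h,g h}(y)`, all lower ones being zero:
`lim_{h → 0+} h^{-(k+1)} (φ_{h,f}(y) - Φ_{h,g h}(y))`. -/
def defectCoeff (M : RungeKutta s) (f : E → E) (g : ℝ → E → E) (k : ℕ) (y : E) : E :=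
  limUnder (𝓝[>] (0 : ℝ)) fun h : ℝ => (h ^ (k + 1))⁻¹ • (flow f h y - M.step h (g h) y)

/-- The partial sum `f_0 + h f_1 + ⋯ + h^(n-1) f_(n-1)` of the inverse modified differential
equation: each new `f_k` is found by comparing the coefficients of `h^(k+1)`. -/
def imdePartial (M : RungeKutta s) (f : E → E) : ℕ → ℝ → E → E
  | 0 => fun _ _ => 0
  | k + 1 => fun h y =>
      imdePartial M f k h y + h ^ k • M.defectCoeff f (imdePartial M f k) k y

/-- The `h`-independent coefficient `f_k` of the inverse modified differential equation (IMDE)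
of `Φ_{h,f}`: `f_k = lim_{h → 0+} (φ_{h,f} - Φ_{h,f_h^{k-1}}) / h^(k+1)`. -/
def imdeCoeff (M : RungeKutta s) (f : E → E) (k : ℕ) (y : E) : E :=
  M.defectCoeff f (M.imdePartial f k) k y

/-- The truncated field `f_h^K(y) = ∑_{k=0}^K h^k f_k(y)` of the IMDE of `Φ_{h,f}`. -/
def imdeTrunc (M : RungeKutta s) (f : E → E) (K : ℕ) (h : ℝ) (y : E) : E :=
  ∑ k ∈ Finset.range (K + 1), h ^ k • M.imdeCoeff f k y

theorem imdePartial_eq_sum (M : RungeKutta s) (f : E → E) (n : ℕ) (h : ℝ) (y : E) :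
    M.imdePartial f n h y = ∑ k ∈ Finset.range n, h ^ k • M.imdeCoeff f k y := by
  induction n with
  | zero => simp [imdePartial]
  | succ n ih => rw [Finset.sum_range_succ, ← ih]; rfl

theorem imdePartial_succ_eq_imdeTrunc (M : RungeKutta s) (f : E → E) (K : ℕ) :
    M.imdePartial f (K + 1) = M.imdeTrunc f K := by
  funext h y
  exact M.imdePartial_eq_sum f (K + 1) h y

/-- The functions `F k` are the coefficients on `U` of the IMDE of `Φ_{h,f}`: they are analytic
and, for every `K`, the field `f_h^K = ∑_{k ≤ K} h^k F_k` satisfies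
`Φ_{h,f_h^K}(y) = φ_{h,f}(y) + O(h^(K+2))` for all `y ∈ U`. -/
def IsIMDE {N : ℕ} (M : RungeKutta s) (f : (Fin N → ℂ) → (Fin N → ℂ)) (U : Set (Fin N → ℂ))
    (F : ℕ → (Fin N → ℂ) → (Fin N → ℂ)) : Prop :=
  (∀ k, AnalyticOnNhd ℂ (F k) U) ∧
    ∀ (K : ℕ), ∀ y ∈ U,
      (fun h : ℝ => M.step h (fun z => ∑ k ∈ Finset.range (K + 1), h ^ k • F k z) y - flow f h y)
        =O[𝓝[>] 0] fun h : ℝ => h ^ (K + 2)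

end RungeKutta

/-- The point of `ℂ^N` given by a point of `ℝ^N`. -/
def toComplex {N : ℕ} (x : Fin N → ℝ) : Fin N → ℂ := fun i => (x i : ℂ)

/-- A real analytic field, seen on the complex set `U`: `f` is (complex) analytic on `U` and takes
real values at the real points of `U`. -/
def RealAnalyticOn {N : ℕ} (f : (Fin N → ℂ) → (Fin N → ℂ)) (U : Set (Fin N → ℂ)) : Prop :=
  AnalyticOnNhd ℂ f U ∧
    ∀ x : Fin N → ℝ, toComplex x ∈ U → ∃ v : Fin N → ℝ, f (toComplex x) = toComplex v

/-- The error `‖ODESolve(y, g, T) - φ_{T,f}(y)‖` of the solver applied to the field `g` at `y`. -/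
def solverError {N s : ℕ} (M : RungeKutta s) (S : ℕ) (f g : (Fin N → ℂ) → (Fin N → ℂ)) (T : ℝ)
    (y : Fin N → ℂ) : ℝ :=
  ‖M.odeSolve S g T y - flow f T y‖

/-- The loss `sup_{y ∈ B} ‖ODESolve(y, g, T) - φ_{T,f}(y)‖ / T`. -/
def loss {N s : ℕ} (M : RungeKutta s) (S : ℕ) (f g : (Fin N → ℂ) → (Fin N → ℂ)) (T : ℝ)
    (B : Set (Fin N → ℂ)) : ℝ :=
  sSup (solverError M S f g T '' B) / T

end

/-! Every estimate rests on one tool, Schwarz' lemma in one complex variable: a holomorphic map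
bounded by `ε` on a ball of radius `ρ` varies from the centre with Lipschitz constant `2 * ε / ρ`.
The constants depend neither on the dimension nor on the field, and shrinking the ball replaces
control of derivatives.

Write the flow as `y + h ψ_h(y)` and one step of the method as `y + h I_h(g)(y)`. Since consistency
gives `∑ b_i = 1`, `I_h(g) - I_h(g')` equals `g - g'` up to a relative error of size `κ² m |h| / δ`
if `g - g'` is controlled on a ball of radius `δ` (`norm_increment_sub_sub_le`). So inverting `g ↦
I_h(g)` is a perturbation of the identity that loses `δ` of the radius. This comparison is used in
two ways.

It constructs the modified field. The iteration `g_{n+1} = g_n + (ψ_h - I_h(g_n))` has residual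
`O(h^n)` with explicit geometric constants (`imdeIter_spec`), so the Taylor coefficients in `h`
stabilise and are the IMDE coefficients (`imdeCoeff_eq_imdeTaylor`). With `K` iterations and `δ` of
order `r₂ / K`, the step may be as large as a multiple of `1 / K`; hence `K` of order `1 / T` is
allowed, and both the residual and the Taylor tail are `O(2^{-K})`, exponentially small in `1 / T`.
This is the case `q = 1`.

It recovers the learned field. `S` steps form one step of a larger method, so the comparison also
holds for the solver. If `g'` solves its equation up to a residual `ε`, then with `δ` proportional
to `T` the bound `η` on `‖g - g'‖` near a point improves to `L + 2^S ε + η / 2` at that point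
(`norm_sub_le_of_norm_odeSolve_sub_flow_le`). About `r₁ / (2 * δ)` repetitions leave an
exponentially small term (`norm_sub_le_add_exp`). Taking for `g'` the iterate `g_K` gives the first
estimate in (iii). Taking `g' = f`, whose residual is `O(h^p)` uniformly, gives the second.

Analyticity of the coefficients in several variables is the only place where more than holomorphy
along curves is needed; there Lie derivatives treat the flow and the implicit function theorem the
method. -/

open Metric Set
open scoped Interval

set_option linter.unusedSectionVars false

/-! ### Holomorphy along curves: closure properties and Schwarz' lemma -/

section CurveHolomorphic

variable {X Y F : Type*} [NormedAddCommGroup X] [NormedSpace ℂ X] [NormedAddCommGroup Y]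
  [NormedSpace ℂ Y] [NormedAddCommGroup F] [NormedSpace ℂ F]

/-- `u` is holomorphic along every holomorphic curve in `U`. -/
def CurveHolomorphic (U : Set X) (u : X → F) : Prop :=
  ∀ ⦃V : Set ℂ⦄ ⦃c : ℂ → X⦄, IsOpen V → DifferentiableOn ℂ c V → MapsTo c V U →
    DifferentiableOn ℂ (fun z => u (c z)) V

namespace CurveHolomorphic

variable {U : Set X} {W : Set Y} {u v : X → F}

theorem of_differentiableOn (hu : DifferentiableOn ℂ u U) : CurveHolomorphic U u :=
  fun _ _ _ hc hm => hu.comp hc hm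

theorem mono {U' : Set X} (hu : CurveHolomorphic U u) (h : U' ⊆ U) : CurveHolomorphic U' u :=
  fun _ _ hV hc hm => hu hV hc (hm.mono_right h)

theorem congr (hu : CurveHolomorphic U u) (h : ∀ x ∈ U, v x = u x) : CurveHolomorphic U v :=
  fun _ _ hV hc hm => (hu hV hc hm).congr fun _ hz => h _ (hm hz)

theorem const (a : F) : CurveHolomorphic U fun _ => a :=
  fun _ _ _ _ _ => differentiableOn_const _

theorem add (hu : CurveHolomorphic U u) (hv : CurveHolomorphic U v) :
    CurveHolomorphic U fun x => u x + v x :=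
  fun _ _ hV hc hm => (hu hV hc hm).add (hv hV hc hm)

theorem sub (hu : CurveHolomorphic U u) (hv : CurveHolomorphic U v) :
    CurveHolomorphic U fun x => u x - v x :=
  fun _ _ hV hc hm => (hu hV hc hm).sub (hv hV hc hm)

theorem smul {r : X → ℂ} (hr : CurveHolomorphic U r) (hu : CurveHolomorphic U u) :
    CurveHolomorphic U fun x => r x • u x :=
  fun _ _ hV hc hm => (hr hV hc hm).smul (hu hV hc hm)

theorem sum {ι : Type*} {s : Finset ι} {w : ι → X → F} (hw : ∀ i ∈ s, CurveHolomorphic U (w i)) :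
    CurveHolomorphic U fun x => ∑ i ∈ s, w i x :=
  fun _ _ hV hc hm => DifferentiableOn.fun_sum fun i hi => hw i hi hV hc hm

theorem real_smul [NormedSpace ℝ F] [IsScalarTower ℝ ℂ F] (r : ℝ) (hu : CurveHolomorphic U u) :
    CurveHolomorphic U fun x => r • u x :=
  ((const (r : ℂ)).smul hu).congr fun x _ => (algebraMap_smul ℂ r (u x)).symm

theorem prodMk {w : X → Y} (hw : CurveHolomorphic U w) (hu : CurveHolomorphic U u) :
    CurveHolomorphic U fun x => (w x, u x) :=
  fun _ _ hV hc hm => (hw hV hc hm).prodMk (hu hV hc hm)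

theorem comp {c : Y → X} (hu : CurveHolomorphic U u) (hc : CurveHolomorphic W c)
    (hm : MapsTo c W U) : CurveHolomorphic W fun y => u (c y) :=
  fun _ _ hV hd hmd => hu hV (hc hV hd hmd) (hm.comp hmd)

theorem of_uniform_limit [CompleteSpace F] {w : ℕ → X → F} {ε : ℕ → ℝ}
    (hw : ∀ n, CurveHolomorphic U (w n))
    (hε : Tendsto ε atTop (𝓝 0)) (hwu : ∀ n, ∀ x ∈ U, ‖w n x - u x‖ ≤ ε n) :
    CurveHolomorphic U u := by
  intro V c hV hc hm
  have : TendstoUniformlyOn (fun n z => w n (c z)) (fun z => u (c z)) atTop V := by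
    rw [Metric.tendstoUniformlyOn_iff]
    intro δ hδ
    filter_upwards [hε.eventually (gt_mem_nhds hδ)] with n hn z hz
    rw [dist_comm, dist_eq_norm]
    exact (hwu n _ (hm hz)).trans_lt hn
  exact this.tendstoLocallyUniformlyOn.differentiableOn
    (Eventually.of_forall fun n => hw n hV hc hm) hV

/-- Schwarz' lemma: a bounded function is Lipschitz away from the boundary. -/
theorem norm_sub_le {D : X → F} {a b : X} {ρ ε : ℝ} (hD : CurveHolomorphic (ball a ρ) D)
    (hε : ∀ x ∈ ball a ρ, ‖D x‖ ≤ ε) (hb : b ∈ ball a ρ) :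
    ‖D b - D a‖ ≤ 2 * ε / ρ * ‖b - a‖ := by
  rcases eq_or_ne b a with rfl | hne
  · simp
  have hρ : 0 < ρ := (dist_nonneg).trans_lt (mem_ball.1 hb)
  have ht : 0 < ‖b - a‖ := norm_pos_iff.2 (sub_ne_zero.2 hne)
  have hb' : ‖b - a‖ < ρ := by simpa [dist_eq_norm] using hb
  have hline : MapsTo (fun z : ℂ => a + z • (b - a)) (ball 0 (ρ / ‖b - a‖)) (ball a ρ) := by
    intro z hz
    rw [mem_ball_zero_iff, lt_div_iff₀ ht] at hz
    simpa [dist_eq_norm, norm_smul] using hz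
  have hd := hD isOpen_ball (c := fun z : ℂ => a + z • (b - a)) (by fun_prop) hline
  have key := Complex.dist_le_div_mul_dist_of_mapsTo_ball (z := 1) (R₂ := 2 * ε) hd ?_ ?_
  · have e : 2 * ε / (ρ / ‖b - a‖) * dist (1 : ℂ) 0 = 2 * ε / ρ * ‖b - a‖ := by
      simp; field_simp
    rw [e] at key
    simpa [dist_eq_norm] using key
  · intro z hz
    rw [mem_closedBall, dist_eq_norm]
    have h0 : (0 : ℂ) ∈ ball (0 : ℂ) (ρ / ‖b - a‖) := mem_ball_self (by positivity)
    linarith [_root_.norm_sub_le (D (a + z • (b - a))) (D (a + (0 : ℂ) • (b - a))), hε _ (hline hz),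
      hε _ (hline h0)]
  · rw [mem_ball_zero_iff, norm_one, one_lt_div ht]
    exact hb'

theorem continuousOn_path [CompleteSpace F] (hu : CurveHolomorphic U u) {c : ℂ → X} {V : Set ℂ}
    (hV : IsOpen V)
    (hc : DifferentiableOn ℂ c V) (hm : MapsTo c V U) {I : Set ℝ} (hI : ∀ s ∈ I, (s : ℂ) ∈ V) :
    ContinuousOn (fun s : ℝ => u (c s)) I :=
  (hu hV hc hm).continuousOn.comp Complex.continuous_ofReal.continuousOn hI

/-- Differentiation under the integral sign; the dominating bound for the derivative comes from the
uniform bound `m` on discs of radius `r / 2`. This makes the Picard operator of the flow preserve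
holomorphy. -/
theorem intervalIntegral [NormedSpace ℝ F] [IsScalarTower ℝ ℂ F] [CompleteSpace F]
    {w : ℝ → X → F} {m : ℝ}
    (hw : ∀ s ∈ Icc (0 : ℝ) 1, CurveHolomorphic U (w s))
    (hm : ∀ s ∈ Icc (0 : ℝ) 1, ∀ x ∈ U, ‖w s x‖ ≤ m)
    (hc : ∀ x ∈ U, ContinuousOn (fun s => w s x) (Icc 0 1)) :
    CurveHolomorphic U fun x => ∫ s in (0 : ℝ)..1, w s x := by
  intro V c hV hcd hcm z₀ hz₀
  obtain ⟨r, hr, hball⟩ := Metric.isOpen_iff.1 hV z₀ hz₀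
  have hd : ∀ s ∈ Icc (0 : ℝ) 1, DifferentiableOn ℂ (fun z => w s (c z)) V :=
    fun s hs => hw s hs hV hcd hcm
  have hsub : Ι (0 : ℝ) 1 ⊆ Icc 0 1 := by
    rw [uIoc_of_le zero_le_one]; exact Ioc_subset_Icc_self
  have hmeas : ∀ z ∈ V, MeasureTheory.AEStronglyMeasurable (fun s => w s (c z))
      (MeasureTheory.volume.restrict (Ι (0 : ℝ) 1)) := fun z hz =>
    ((hc _ (hcm hz)).mono hsub).aestronglyMeasurable measurableSet_uIoc
  have hderiv : ∀ s ∈ Icc (0 : ℝ) 1, ∀ z ∈ V,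
      HasDerivAt (fun z => w s (c z)) (deriv (fun z => w s (c z)) z) z := fun s hs z hz =>
    ((hd s hs).differentiableAt (hV.mem_nhds hz)).hasDerivAt
  have key := intervalIntegral.hasDerivAt_integral_of_dominated_loc_of_deriv_le
    (μ := MeasureTheory.volume) (a := 0) (b := 1)
    (F := fun z s => w s (c z)) (F' := fun z s => deriv (fun z => w s (c z)) z) (x₀ := z₀)
    (s := ball z₀ (r / 2)) (bound := fun _ => 2 * m / (r / 2)) (ball_mem_nhds _ (by positivity))
    ?_ ?_ ?_ ?_ ?_ ?_
  · exact key.2.differentiableAt.differentiableWithinAt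
  · filter_upwards [hV.mem_nhds hz₀] with z hz using hmeas z hz
  · refine ContinuousOn.intervalIntegrable ?_
    rw [uIcc_of_le zero_le_one]
    exact hc _ (hcm hz₀)
  -- Measurability of the derivative in `s`: it is the pointwise limit of difference quotients along
  -- this sequence, which stays inside the disc of radius `r`.
  · let q : ℕ → ℂ := fun n => (r / (n + 2) : ℝ)
    have hq0 : Tendsto q atTop (𝓝 0) := by
      have : Tendsto (fun n : ℕ => r / ((n : ℝ) + 2)) atTop (𝓝 0) :=
        tendsto_const_nhds.div_atTop
          (tendsto_atTop_add_const_right _ _ tendsto_natCast_atTop_atTop)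
      have h0 := (Complex.continuous_ofReal.tendsto 0).comp this
      rwa [Complex.ofReal_zero] at h0
    have hqn : ∀ n, q n ≠ 0 := fun n => by
      simp only [q, ne_eq, Complex.ofReal_eq_zero]; positivity
    have hqV : ∀ n, z₀ + q n ∈ V := fun n => hball <| by
      simp only [q, mem_ball, dist_self_add_left, Complex.norm_real, Real.norm_eq_abs]
      rw [abs_of_pos (by positivity), div_lt_iff₀ (by positivity)]
      nlinarith [(Nat.cast_nonneg n : (0 : ℝ) ≤ n)]
    refine aestronglyMeasurable_of_tendsto_ae (u := atTop)
      (f := fun n s => (q n)⁻¹ • (w s (c (z₀ + q n)) - w s (c z₀)))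
      (fun n => ((hmeas _ (hqV n)).sub (hmeas _ hz₀)).const_smul _) ?_
    rw [MeasureTheory.ae_restrict_iff' measurableSet_uIoc]
    refine Eventually.of_forall fun s hs => ?_
    have := (hderiv s (hsub hs) z₀ hz₀).tendsto_slope_zero
    exact this.comp (tendsto_nhdsWithin_iff.2 ⟨hq0, Eventually.of_forall hqn⟩)
  · refine Eventually.of_forall fun s hs z hz => ?_
    have hzb : ball z (r / 2) ⊆ V := (ball_subset_ball' (by
      have := mem_ball.1 hz; linarith)).trans hball
    refine Complex.norm_deriv_le_div_of_mapsTo_ball ((hd s (hsub hs)).mono hzb) ?_ (by positivity)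
    intro z' hz'
    rw [mem_closedBall, dist_eq_norm]
    have h0 : z ∈ ball z (r / 2) := mem_ball_self (by positivity)
    linarith [_root_.norm_sub_le (w s (c z')) (w s (c z)), hm s (hsub hs) _ (hcm (hzb hz')),
      hm s (hsub hs) _ (hcm (hzb h0))]
  · exact intervalIntegrable_const
  · refine Eventually.of_forall fun s hs z hz => hderiv s (hsub hs) z (hball ?_)
    exact ball_subset_ball (by linarith) hz

end CurveHolomorphic

end CurveHolomorphic

/-! ### Stage equations: the local solution as a fixed point -/

namespace RungeKutta

variable {s : ℕ}

/-- A constant that dominates all row sums of the tableau. -/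
def kappa (M : RungeKutta s) : ℝ := 1 + ∑ i, ∑ j, |M.a i j| + ∑ i, |M.b i|

theorem sum_abs_a_le (M : RungeKutta s) (i : Fin s) : ∑ j, |M.a i j| ≤ M.kappa := by
  have h1 : ∑ j, |M.a i j| ≤ ∑ i, ∑ j, |M.a i j| :=
    Finset.single_le_sum (f := fun i => ∑ j, |M.a i j|)
      (fun i _ => Finset.sum_nonneg fun j _ => abs_nonneg _) (Finset.mem_univ i)
  have h2 : 0 ≤ ∑ i, |M.b i| := Finset.sum_nonneg fun j _ => abs_nonneg _
  unfold kappa; linarith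

theorem sum_abs_b_le (M : RungeKutta s) : ∑ i, |M.b i| ≤ M.kappa := by
  have h1 : 0 ≤ ∑ i, ∑ j, |M.a i j| :=
    Finset.sum_nonneg fun i _ => Finset.sum_nonneg fun j _ => abs_nonneg _
  unfold kappa; linarith

theorem one_le_kappa (M : RungeKutta s) : 1 ≤ M.kappa := by
  have h1 : 0 ≤ ∑ i, ∑ j, |M.a i j| :=
    Finset.sum_nonneg fun i _ => Finset.sum_nonneg fun j _ => abs_nonneg _
  have h2 : 0 ≤ ∑ i, |M.b i| := Finset.sum_nonneg fun j _ => abs_nonneg _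
  unfold kappa; linarith

theorem kappa_pos (M : RungeKutta s) : 0 < M.kappa := zero_lt_one.trans_le M.one_le_kappa

variable {E : Type*} [NormedAddCommGroup E] [NormedSpace ℝ E]

theorem norm_sum_smul_le {ι : Type*} [Fintype ι] {c : ι → ℝ} {κ : ℝ} (hc : ∑ i, |c i| ≤ κ)
    {k : ι → E} {m : ℝ} (hm : 0 ≤ m) (hk : ∀ i, ‖k i‖ ≤ m) : ‖∑ i, c i • k i‖ ≤ κ * m := by
  calc ‖∑ i, c i • k i‖ ≤ ∑ i, |c i| * m := by
        refine norm_sum_le_of_le _ fun i _ => ?_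
        rw [norm_smul, Real.norm_eq_abs]
        exact mul_le_mul_of_nonneg_left (hk i) (abs_nonneg _)
    _ = (∑ i, |c i|) * m := (Finset.sum_mul ..).symm
    _ ≤ κ * m := mul_le_mul_of_nonneg_right hc hm

variable {𝕜 : Type*} [RCLike 𝕜] [NormedSpace 𝕜 E]

/-- The right hand side of the stage equations, with a real or complex step. -/
def stageMap (M : RungeKutta s) (h : 𝕜) (g : E → E) (y : E) (k : Fin s → E) : Fin s → E :=
  fun i => g (y + h • ∑ j, M.a i j • k j)

/-- The local solution of the stage equations, as the limit of the fixed point iteration. -/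
noncomputable def slopes (M : RungeKutta s) (h : 𝕜) (g : E → E) (y : E) : Fin s → E :=
  limUnder atTop fun n => (M.stageMap h g y)^[n] 0

/-- The increment function `(Φ_h(y) - y) / h` of the method. -/
noncomputable def increment (M : RungeKutta s) (h : 𝕜) (g : E → E) (y : E) : E :=
  ∑ i, M.b i • M.slopes h g y i

theorem isSlopes_iff (M : RungeKutta s) (h : ℝ) (g : E → E) (y : E) (k : Fin s → E) :
    M.IsSlopes h g y k ↔ M.stageMap h g y k = k :=
  ⟨fun H => funext fun i => (H i).symm, fun H i => (congrFun H i).symm⟩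

/-- Near `y` the field is bounded by `m` and `L`-Lipschitz, and `h` is so small that the stage map
is a contraction. -/
structure ContractsNear (M : RungeKutta s) (h : 𝕜) (g : E → E) (y : E) (δ m L : ℝ) : Prop where
  nonneg : 0 ≤ m
  bound : ∀ z ∈ ball y δ, ‖g z‖ ≤ m
  lip : ∀ z ∈ ball y δ, ∀ w ∈ ball y δ, ‖g z - g w‖ ≤ L * ‖z - w‖
  lip_nonneg : 0 ≤ L
  contr : M.kappa * L * ‖h‖ ≤ 1 / 2
  small : 3 * (M.kappa * m * ‖h‖) < δ

namespace ContractsNear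

variable {M : RungeKutta s} {h : 𝕜} {g : E → E} {y : E} {δ m L : ℝ}

theorem pos (H : M.ContractsNear h g y δ m L) : 0 < δ := by
  have h1 := H.small
  have h2 : 0 ≤ M.kappa * m * ‖h‖ :=
    mul_nonneg (mul_nonneg M.kappa_pos.le H.nonneg) (norm_nonneg _)
  linarith

theorem stage_arg_mem (H : M.ContractsNear h g y δ m L) {k : Fin s → E} (hk : ∀ i, ‖k i‖ ≤ m)
    (i : Fin s) : y + h • ∑ j, M.a i j • k j ∈ ball y δ := by
  rw [mem_ball, dist_self_add_left, norm_smul]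
  have h1 := norm_sum_smul_le (M.sum_abs_a_le i) H.nonneg hk
  have h2 : 0 ≤ M.kappa * m * ‖h‖ :=
    mul_nonneg (mul_nonneg M.kappa_pos.le H.nonneg) (norm_nonneg _)
  have h3 := H.small
  nlinarith [norm_nonneg h]

theorem norm_stageMap_le (H : M.ContractsNear h g y δ m L) {k : Fin s → E} (hk : ∀ i, ‖k i‖ ≤ m)
    (i : Fin s) : ‖M.stageMap h g y k i‖ ≤ m := H.bound _ (H.stage_arg_mem hk i)

theorem norm_stageMap_sub_le (H : M.ContractsNear h g y δ m L) {k l : Fin s → E}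
    (hk : ∀ i, ‖k i‖ ≤ m) (hl : ∀ i, ‖l i‖ ≤ m) :
    ‖M.stageMap h g y k - M.stageMap h g y l‖ ≤ 1 / 2 * ‖k - l‖ := by
  refine (pi_norm_le_iff_of_nonneg (by positivity)).2 fun i => ?_
  refine (H.lip _ (H.stage_arg_mem hk i) _ (H.stage_arg_mem hl i)).trans ?_
  have e : y + h • ∑ j, M.a i j • k j - (y + h • ∑ j, M.a i j • l j)
      = h • ∑ j, M.a i j • (k - l) j := by
    simp only [Pi.sub_apply, smul_sub, Finset.sum_sub_distrib]; abel
  rw [e, norm_smul]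
  have h1 := norm_sum_smul_le (M.sum_abs_a_le i) (norm_nonneg (k - l)) (norm_le_pi_norm (k - l))
  calc L * (‖h‖ * ‖∑ j, M.a i j • (k - l) j‖) ≤ L * (‖h‖ * (M.kappa * ‖k - l‖)) := by
        have := H.lip_nonneg
        gcongr
    _ = M.kappa * L * ‖h‖ * ‖k - l‖ := by ring
    _ ≤ 1 / 2 * ‖k - l‖ := mul_le_mul_of_nonneg_right H.contr (norm_nonneg _)

theorem norm_iterate_le (H : M.ContractsNear h g y δ m L) (n : ℕ) (i : Fin s) :
    ‖(M.stageMap h g y)^[n] 0 i‖ ≤ m := by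
  induction n generalizing i with
  | zero => simpa using H.nonneg
  | succ n ih =>
    rw [Function.iterate_succ_apply']
    exact H.norm_stageMap_le ih i

theorem norm_iterate_succ_sub_le (H : M.ContractsNear h g y δ m L) (n : ℕ) :
    dist ((M.stageMap h g y)^[n] 0) ((M.stageMap h g y)^[n + 1] 0) ≤ m * (1 / 2) ^ n := by
  induction n with
  | zero =>
    rw [dist_comm, dist_eq_norm]
    simpa using (pi_norm_le_iff_of_nonneg H.nonneg).2 (H.norm_iterate_le 1)
  | succ n ih =>
    rw [dist_eq_norm] at ih ⊢
    rw [Function.iterate_succ_apply' _ (n + 1), Function.iterate_succ_apply' _ n]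
    refine (H.norm_stageMap_sub_le (H.norm_iterate_le n) ?_).trans ?_
    · intro i; simpa only [Function.iterate_succ_apply'] using H.norm_iterate_le (n + 1) i
    · rw [Function.iterate_succ_apply' _ n] at ih
      rw [pow_succ]; linarith

variable [CompleteSpace E]

theorem tendsto_slopes (H : M.ContractsNear h g y δ m L) :
    Tendsto (fun n => (M.stageMap h g y)^[n] 0) atTop (𝓝 (M.slopes h g y)) :=
  (cauchySeq_of_le_geometric (1 / 2) m (by norm_num) H.norm_iterate_succ_sub_le).tendsto_limUnder

theorem norm_iterate_sub_slopes_le (H : M.ContractsNear h g y δ m L) (n : ℕ) :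
    ‖(M.stageMap h g y)^[n] 0 - M.slopes h g y‖ ≤ m * (1 / 2) ^ n / (1 - 1 / 2) := by
  rw [← dist_eq_norm]
  exact dist_le_of_le_geometric_of_tendsto (1 / 2) m (by norm_num) H.norm_iterate_succ_sub_le
    H.tendsto_slopes n

theorem norm_slopes_le (H : M.ContractsNear h g y δ m L) (i : Fin s) :
    ‖M.slopes h g y i‖ ≤ m :=
  le_of_tendsto ((tendsto_pi_nhds.1 H.tendsto_slopes i).norm)
    (Eventually.of_forall fun n => H.norm_iterate_le n i)

theorem stageMap_slopes (H : M.ContractsNear h g y δ m L) :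
    M.stageMap h g y (M.slopes h g y) = M.slopes h g y := by
  refine tendsto_nhds_unique (f := fun n => (M.stageMap h g y)^[n + 1] 0) (l := atTop) ?_
    (H.tendsto_slopes.comp (tendsto_add_atTop_nat 1))
  rw [tendsto_iff_norm_sub_tendsto_zero]
  have h0 := (tendsto_iff_norm_sub_tendsto_zero.1 H.tendsto_slopes).const_mul (1 / 2)
  rw [mul_zero] at h0
  refine squeeze_zero (fun _ => norm_nonneg _) (fun n => ?_) h0
  rw [Function.iterate_succ_apply']
  exact H.norm_stageMap_sub_le (H.norm_iterate_le n) H.norm_slopes_le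

/-- A solution whose stage arguments stay in the ball is automatically bounded by `m`, so it lies
where the stage map is a contraction. -/
theorem eq_slopes (H : M.ContractsNear h g y δ m L) {k : Fin s → E}
    (hk : M.stageMap h g y k = k) (hmem : ∀ i, y + h • ∑ j, M.a i j • k j ∈ ball y δ) :
    k = M.slopes h g y := by
  have hkm : ∀ i, ‖k i‖ ≤ m := fun i => by
    rw [← congrFun hk i]; exact H.bound _ (hmem i)
  have h1 := H.norm_stageMap_sub_le hkm H.norm_slopes_le
  rw [hk, H.stageMap_slopes] at h1
  have h2 : ‖k - M.slopes h g y‖ ≤ 0 := by linarith [norm_nonneg (k - M.slopes h g y)]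
  exact sub_eq_zero.1 (norm_le_zero_iff.1 h2)

theorem norm_increment_le (H : M.ContractsNear h g y δ m L) :
    ‖M.increment h g y‖ ≤ M.kappa * m :=
  norm_sum_smul_le M.sum_abs_b_le H.nonneg H.norm_slopes_le

end ContractsNear

namespace ContractsNear

variable [CompleteSpace E] {M : RungeKutta s} {h : ℝ} {g : E → E} {y : E} {δ m L : ℝ}

/-- The fixed point has distance at most `2 * m` from `g y`. Any other solution has a stage argument
outside the ball, and the factor 3 in `small` then forces its norm above `3 * m`, hence its distance
from `g y` above `2 * m`. Thus the minimality rule selects exactly the fixed point. -/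
theorem isLocalSlopes_iff (H : M.ContractsNear h g y δ m L) (k : Fin s → E) :
    M.IsLocalSlopes h g y k ↔ k = M.slopes h g y := by
  have hslopes : M.IsSlopes h g y (M.slopes h g y) := (M.isSlopes_iff ..).2 H.stageMap_slopes
  have hfar : ∀ l : Fin s → E, M.IsSlopes h g y l → l ≠ M.slopes h g y →
      ‖M.slopes h g y - fun _ => g y‖ < ‖l - fun _ => g y‖ := by
    intro l hl hne
    have : ∃ i, y + h • ∑ j, M.a i j • l j ∉ ball y δ := by
      by_contra! hall
      exact hne (H.eq_slopes ((M.isSlopes_iff ..).1 hl) hall)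
    obtain ⟨i, hi⟩ := this
    rw [mem_ball, dist_self_add_left, norm_smul, not_lt] at hi
    have h1 := norm_sum_smul_le (M.sum_abs_a_le i) (norm_nonneg l) (norm_le_pi_norm l)
    have hgy : ‖g y‖ ≤ m := H.bound _ (mem_ball_self H.pos)
    have h2 : ‖l‖ ≤ ‖l - fun _ => g y‖ + m := by
      have h3 : ‖(fun _ => g y : Fin s → E)‖ ≤ m :=
        (pi_norm_le_iff_of_nonneg H.nonneg).2 fun _ => hgy
      linarith [norm_le_norm_sub_add l (fun _ => g y)]
    have h4 : ‖M.slopes h g y - fun _ => g y‖ ≤ 2 * m := by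
      refine (pi_norm_le_iff_of_nonneg (by linarith [H.nonneg])).2 fun i => ?_
      have := norm_sub_le (M.slopes h g y i) (g y)
      have := H.norm_slopes_le i
      simp only [Pi.sub_apply]; linarith
    have h5 : 3 * (M.kappa * m * ‖h‖) < ‖h‖ * (M.kappa * ‖l‖) :=
      H.small.trans_le (hi.trans (by gcongr))
    have h6 : 3 * m < ‖l‖ := by
      by_contra! h7
      have : ‖h‖ * (M.kappa * ‖l‖) ≤ ‖h‖ * (M.kappa * (3 * m)) := by
        have := M.kappa_pos.le
        gcongr
      linarith
    linarith
  constructor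
  · rintro ⟨hk, hmin⟩
    by_contra hne
    exact absurd (hmin _ hslopes) (not_le.2 (hfar k hk hne))
  · rintro rfl
    refine ⟨hslopes, fun l hl => ?_⟩
    by_cases hne : l = M.slopes h g y
    · rw [hne]
    · exact (hfar l hl hne).le

theorem isStepValue_iff (H : M.ContractsNear h g y δ m L) (w : E) :
    M.IsStepValue h g y w ↔ w = y + h • M.increment h g y := by
  simp only [IsStepValue, H.isLocalSlopes_iff, exists_eq_left, increment]

theorem existsUnique_isStepValue (H : M.ContractsNear h g y δ m L) :
    ∃! w, M.IsStepValue h g y w := by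
  simp only [H.isStepValue_iff]
  exact existsUnique_eq

theorem step_eq (H : M.ContractsNear h g y δ m L) :
    M.step h g y = y + h • M.increment h g y := by
  rw [← H.isStepValue_iff]
  exact Classical.epsilon_spec H.existsUnique_isStepValue.exists

end ContractsNear

end RungeKutta

/-! ### Uniqueness of the flow for a locally bounded Lipschitz field -/

section FlowUniqueness

variable {E : Type*} [NormedAddCommGroup E] [NormedSpace ℝ E]

/-- An integral curve of a field of size at most `m` moves with speed at most `m`, even if the field
is bounded only near the initial value. -/
theorem norm_integralCurve_sub_lt {f : E → E} {y : E} {δ m T : ℝ} (hm : 0 ≤ m)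
    (hδ : m * T < δ) (hT : 0 ≤ T) (hf : ∀ z ∈ ball y δ, ‖f z‖ ≤ m) {γ : ℝ → E}
    (h0 : γ 0 = y) (hγ : IsIntegralCurveOn γ (fun _ => f) (Icc 0 T)) {t : ℝ} (ht : t ∈ Icc 0 T) :
    γ t ∈ ball y δ := by
  -- The barrier argument needs a strictly larger slope wherever the curve touches the barrier, so
  -- the speed `m` is increased slightly.
  obtain ⟨η, hη, hlt⟩ : ∃ η > 0, (m + η) * T < δ := by
    have hη : 0 < (δ - m * T) / (2 * (T + 1)) := by
      have : 0 < δ - m * T := by linarith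
      positivity
    refine ⟨_, hη, ?_⟩
    have h1 : (δ - m * T) / (2 * (T + 1)) * (2 * (T + 1)) = δ - m * T := by field_simp
    nlinarith
  have key := image_norm_le_of_norm_deriv_right_lt_deriv_boundary' (a := 0) (b := T)
    (f := fun t => γ t - y) (f' := fun t => f (γ t)) (B := fun t => (m + η) * t)
    (B' := fun _ => m + η) ?_ ?_ ?_ ?_ ?_ ?_ ht
  · rw [mem_ball, dist_eq_norm]
    refine lt_of_le_of_lt key (lt_of_le_of_lt ?_ hlt)
    exact mul_le_mul_of_nonneg_left ht.2 (by linarith)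
  · exact ContinuousOn.sub (fun t ht => (hγ t ht).continuousWithinAt) continuousOn_const
  · intro t ht
    exact ((hγ t ⟨ht.1, ht.2.le⟩).mono_of_mem_nhdsWithin
      (Icc_mem_nhdsGE_of_mem ht)).sub_const _
  · simp [h0]
  · fun_prop
  · intro t _
    simpa using ((hasDerivAt_id t).const_mul (m + η)).hasDerivWithinAt
  · intro t ht he
    refine lt_of_le_of_lt (hf _ ?_) (by linarith)
    rw [mem_ball, dist_eq_norm, he]
    refine lt_of_le_of_lt ?_ hlt
    exact mul_le_mul_of_nonneg_left ht.2.le (by linarith)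

variable {f : E → E} {y : E} {δ m L T : ℝ}

/-- A competing solution cannot leave the ball before time `T`, so a Lipschitz bound on the ball
alone suffices for uniqueness among all solutions. -/
theorem isFlowValue_iff (hm : 0 ≤ m) (hδ : m * T < δ) (hT : 0 ≤ T)
    (hf : ∀ z ∈ ball y δ, ‖f z‖ ≤ m)
    (hL : ∀ z ∈ ball y δ, ∀ w ∈ ball y δ, ‖f z - f w‖ ≤ L * ‖z - w‖) {γ : ℝ → E}
    (h0 : γ 0 = y) (hγ : IsIntegralCurveOn γ (fun _ => f) (Icc 0 T)) (w : E) :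
    IsFlowValue f T y w ↔ w = γ T := by
  constructor
  · rintro ⟨γ', h0', hγ', rfl⟩
    have hlip : LipschitzOnWith L.toNNReal f (ball y δ) := by
      refine LipschitzOnWith.of_dist_le_mul fun z hz w hw => ?_
      rw [dist_eq_norm, dist_eq_norm]
      refine (hL z hz w hw).trans ?_
      gcongr
      exact Real.le_coe_toNNReal L
    refine ODE_solution_unique_of_mem_Icc_right (v := fun _ => f) (s := fun _ => ball y δ)
      (K := L.toNNReal) (fun t _ => hlip) (a := 0) (b := T)
      (fun t ht => (hγ' t ht).continuousWithinAt) (fun t ht => ?_) (fun t ht => ?_)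
      (fun t ht => (hγ t ht).continuousWithinAt) (fun t ht => ?_) (fun t ht => ?_)
      (h0'.trans h0.symm) ⟨hT, le_rfl⟩
    · exact (hγ' t ⟨ht.1, ht.2.le⟩).mono_of_mem_nhdsWithin (Icc_mem_nhdsGE_of_mem ht)
    · exact norm_integralCurve_sub_lt hm hδ hT hf h0' hγ' ⟨ht.1, ht.2.le⟩
    · exact (hγ t ⟨ht.1, ht.2.le⟩).mono_of_mem_nhdsWithin (Icc_mem_nhdsGE_of_mem ht)
    · exact norm_integralCurve_sub_lt hm hδ hT hf h0 hγ ⟨ht.1, ht.2.le⟩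
  · rintro rfl
    exact ⟨γ, h0, hγ, rfl⟩

theorem flow_eq (hm : 0 ≤ m) (hδ : m * T < δ) (hT : 0 ≤ T)
    (hf : ∀ z ∈ ball y δ, ‖f z‖ ≤ m)
    (hL : ∀ z ∈ ball y δ, ∀ w ∈ ball y δ, ‖f z - f w‖ ≤ L * ‖z - w‖) {γ : ℝ → E}
    (h0 : γ 0 = y) (hγ : IsIntegralCurveOn γ (fun _ => f) (Icc 0 T)) :
    flow f T y = γ T := by
  rw [← isFlowValue_iff hm hδ hT hf hL h0 hγ]
  exact Classical.epsilon_spec ⟨_, γ, h0, hγ, rfl⟩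

end FlowUniqueness

/-! ### Comparing the method, and its compositions, for two fields -/

section Comparison

variable {E : Type*} [NormedAddCommGroup E] [NormedSpace ℂ E] [NormedSpace ℝ E]
  [IsScalarTower ℝ ℂ E]

/-- Schwarz' lemma around `w` handles nearby points; for points at distance at least `δ / 2` the
trivial bound `2 * m` is already of the required form. -/
theorem CurveHolomorphic.lipschitz_half {g : E → E} {y : E} {δ m : ℝ} (hδ : 0 < δ)
    (hg : CurveHolomorphic (ball y δ) g)
    (hm : ∀ z ∈ ball y δ, ‖g z‖ ≤ m) :
    ∀ z ∈ ball y (δ / 2), ∀ w ∈ ball y (δ / 2), ‖g z - g w‖ ≤ 4 * m / δ * ‖z - w‖ := by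
  intro z hz w hw
  have hz' : z ∈ ball y δ := ball_subset_ball (by linarith) hz
  have hw' : w ∈ ball y δ := ball_subset_ball (by linarith) hw
  have hsub : ball w (δ / 2) ⊆ ball y δ := ball_subset_ball' (by
    have := mem_ball.1 hw; linarith)
  by_cases h : z ∈ ball w (δ / 2)
  · refine ((hg.mono hsub).norm_sub_le (fun x hx => hm x (hsub hx)) h).trans_eq ?_
    field_simp; ring
  · rw [mem_ball, not_lt, dist_eq_norm] at h
    have h1 := _root_.norm_sub_le (g z) (g w)
    have h2 := hm z hz'
    have h3 := hm w hw'
    have h4 : 0 ≤ m := (norm_nonneg _).trans h2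
    calc ‖g z - g w‖ ≤ 2 * m := by linarith
      _ = 4 * m / δ * (δ / 2) := by field_simp; ring
      _ ≤ 4 * m / δ * ‖z - w‖ := by gcongr

theorem CurveHolomorphic.contractsNear {s : ℕ} (M : RungeKutta s) {𝕜 : Type*} [RCLike 𝕜]
    [NormedSpace 𝕜 E] {h : 𝕜} {g : E → E} {y : E}
    {δ m : ℝ} (hδ : 0 < δ) (hg : CurveHolomorphic (ball y δ) g) (hm : ∀ z ∈ ball y δ, ‖g z‖ ≤ m)
    (hh : 8 * M.kappa * m * ‖h‖ ≤ δ) : M.ContractsNear h g y (δ / 2) m (4 * m / δ) := by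
  have hm0 : 0 ≤ m := (norm_nonneg _).trans (hm y (mem_ball_self hδ))
  refine ⟨hm0, fun z hz => hm z (ball_subset_ball (by linarith) hz), hg.lipschitz_half hδ hm,
    by positivity, ?_, by linarith⟩
  have : M.kappa * (4 * m / δ) * ‖h‖ = (8 * M.kappa * m * ‖h‖) / δ / 2 := by ring
  rw [this]
  have : 8 * M.kappa * m * ‖h‖ / δ ≤ 1 := (div_le_one hδ).2 hh
  linarith

namespace RungeKutta

/-- The difference of the increments of a method for two fields is the difference of the fields, up
to a factor proportional to the step size. -/
theorem norm_sum_sub_sub_le {ι : Type*} [Fintype ι] {α : ι → ι → ℝ} {β : ι → ℝ} {κ : ℝ}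
    (hα : ∀ i, ∑ j, |α i j| ≤ κ) (hβ : ∑ i, |β i| ≤ κ) (hβ1 : ∑ i, β i = 1)
    {g g' : E → E} {y : E} {δ m ε : ℝ} {h : ℂ} (hδ : 0 < δ)
    (hg : CurveHolomorphic (ball y δ) g) (hg' : CurveHolomorphic (ball y δ) g')
    (hm : ∀ z ∈ ball y δ, ‖g z‖ ≤ m)
    (hε : ∀ z ∈ ball y δ, ‖g z - g' z‖ ≤ ε) (hh : 16 * κ * m * ‖h‖ ≤ δ)
    {k k' : ι → E} (hk : ∀ i, k i = g (y + h • ∑ j, α i j • k j))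
    (hk' : ∀ i, k' i = g' (y + h • ∑ j, α i j • k' j))
    (hkm : ∀ i, ‖k i‖ ≤ m) (hkm' : ∀ i, ‖k' i‖ ≤ m) :
    ‖∑ i, β i • k i - ∑ i, β i • k' i - (g y - g' y)‖ ≤ 12 * κ ^ 2 * m * ‖h‖ * ε / δ := by
  have hy : y ∈ ball y δ := mem_ball_self hδ
  have hm0 : 0 ≤ m := (norm_nonneg _).trans (hm y hy)
  have hε0 : 0 ≤ ε := (norm_nonneg _).trans (hε y hy)
  have hκ : 0 ≤ κ := (Finset.sum_nonneg fun i _ => abs_nonneg _).trans hβ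
  have harg : ∀ l : ι → E, (∀ i, ‖l i‖ ≤ m) → ∀ i,
      ‖h • ∑ j, α i j • l j‖ ≤ ‖h‖ * (κ * m) := fun l hl i => by
    rw [norm_smul]
    exact mul_le_mul_of_nonneg_left (norm_sum_smul_le (hα i) hm0 hl) (norm_nonneg _)
  have hmem : ∀ l : ι → E, (∀ i, ‖l i‖ ≤ m) → ∀ i,
      y + h • ∑ j, α i j • l j ∈ ball y (δ / 2) := fun l hl i => by
    rw [mem_ball, dist_self_add_left]
    have := harg l hl i
    linarith
  have hmem' : ∀ l : ι → E, (∀ i, ‖l i‖ ≤ m) → ∀ i,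
      y + h • ∑ j, α i j • l j ∈ ball y δ := fun l hl i =>
    ball_subset_ball (by linarith) (hmem l hl i)
  have hlip : ∀ i, ‖g (y + h • ∑ j, α i j • k j) - g (y + h • ∑ j, α i j • k' j)‖
      ≤ 4 * m / δ * (‖h‖ * (κ * ‖k - k'‖)) := fun i => by
    refine (hg.lipschitz_half hδ hm _ (hmem k hkm i) _ (hmem k' hkm' i)).trans ?_
    have e : y + h • ∑ j, α i j • k j - (y + h • ∑ j, α i j • k' j)
        = h • ∑ j, α i j • (k - k') j := by
      simp only [Pi.sub_apply, smul_sub, Finset.sum_sub_distrib]; abel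
    rw [e, norm_smul]
    gcongr
    exact norm_sum_smul_le (hα i) (norm_nonneg (k - k')) (norm_le_pi_norm (k - k'))
  -- The smallness of `h` makes the stage coupling at most `1 / 4 * ‖k - k'‖`, which is absorbed on
  -- the left.
  have hkk : ‖k - k'‖ ≤ 2 * ε := by
    have h1 : ‖k - k'‖ ≤ 4 * m / δ * (‖h‖ * (κ * ‖k - k'‖)) + ε := by
      refine (pi_norm_le_iff_of_nonneg (by positivity)).2 fun i => ?_
      rw [Pi.sub_apply, hk i, hk' i, ← sub_add_sub_cancel _ (g (y + h • ∑ j, α i j • k' j))]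
      exact norm_add_le_of_le (hlip i) (hε _ (hmem' k' hkm' i))
    have h2 : 4 * m / δ * (‖h‖ * (κ * ‖k - k'‖)) ≤ 1 / 4 * ‖k - k'‖ := by
      have : 4 * m / δ * (‖h‖ * (κ * ‖k - k'‖)) = 16 * κ * m * ‖h‖ / δ / 4 * ‖k - k'‖ := by ring
      rw [this]
      have : 16 * κ * m * ‖h‖ / δ ≤ 1 := (div_le_one hδ).2 hh
      gcongr
    linarith
  have hstage : ∀ i, ‖k i - k' i - (g y - g' y)‖ ≤ 12 * κ * m * ‖h‖ * ε / δ := fun i => by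
    -- Schwarz' lemma for the difference `g - g'` is the source of the gain: its variation over a
    -- stage displacement carries both factors `ε / δ` and `‖h‖`.
    have hD := (hg.sub hg').norm_sub_le hε (hmem' k' hkm' i)
    rw [add_sub_cancel_left] at hD
    have e : k i - k' i - (g y - g' y)
        = (g (y + h • ∑ j, α i j • k j) - g (y + h • ∑ j, α i j • k' j))
          + ((g (y + h • ∑ j, α i j • k' j) - g' (y + h • ∑ j, α i j • k' j)) - (g y - g' y)) := by
      rw [← hk i, ← hk' i]; abel
    rw [e]
    refine (norm_add_le_of_le (hlip i) hD).trans ?_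
    calc 4 * m / δ * (‖h‖ * (κ * ‖k - k'‖)) + 2 * ε / δ * ‖h • ∑ j, α i j • k' j‖
        ≤ 4 * m / δ * (‖h‖ * (κ * (2 * ε))) + 2 * ε / δ * (‖h‖ * (κ * m)) := by
          gcongr
          exact harg k' hkm' i
      _ = 10 * κ * m * ‖h‖ * ε / δ := by ring
      _ ≤ 12 * κ * m * ‖h‖ * ε / δ := by gcongr; norm_num
  have e : ∑ i, β i • k i - ∑ i, β i • k' i - (g y - g' y)
      = ∑ i, β i • (k i - k' i - (g y - g' y)) := by
    simp only [smul_sub _ (k _ - k' _), smul_sub _ (k _), Finset.sum_sub_distrib,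
      ← Finset.sum_smul, hβ1, one_smul]
  rw [e]
  refine (norm_sum_smul_le hβ (by positivity) hstage).trans_eq ?_
  ring

variable {s : ℕ} [CompleteSpace E]

/-- The case of one step of a Runge-Kutta method. -/
theorem norm_increment_sub_sub_le (M : RungeKutta s) (hb : ∑ i, M.b i = 1)
    {g g' : E → E} {y : E} {δ m ε : ℝ} {h : ℂ} (hδ : 0 < δ)
    (hg : CurveHolomorphic (ball y δ) g) (hg' : CurveHolomorphic (ball y δ) g')
    (hm : ∀ z ∈ ball y δ, ‖g z‖ ≤ m) (hm' : ∀ z ∈ ball y δ, ‖g' z‖ ≤ m)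
    (hε : ∀ z ∈ ball y δ, ‖g z - g' z‖ ≤ ε) (hh : 16 * M.kappa * m * ‖h‖ ≤ δ) :
    ‖M.increment h g y - M.increment h g' y - (g y - g' y)‖
      ≤ 12 * M.kappa ^ 2 * m * ‖h‖ * ε / δ := by
  have hm0 : 0 ≤ m := (norm_nonneg _).trans (hm y (mem_ball_self hδ))
  have h8 : 8 * M.kappa * m * ‖h‖ ≤ δ := by
    have : 0 ≤ M.kappa * m * ‖h‖ :=
      mul_nonneg (mul_nonneg M.kappa_pos.le hm0) (norm_nonneg _)
    linarith
  have H := hg.contractsNear M hδ hm h8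
  have H' := hg'.contractsNear M hδ hm' h8
  exact norm_sum_sub_sub_le M.sum_abs_a_le M.sum_abs_b_le hb hδ hg hg' hm hε hh
    (fun i => (congrFun H.stageMap_slopes i).symm) (fun i => (congrFun H'.stageMap_slopes i).symm)
    H.norm_slopes_le H'.norm_slopes_le

/-- `Y` is a sequence of approximations produced by the method, with slopes `k`, all of size at most
`m`. -/
structure IsTrajectory (M : RungeKutta s) (S : ℕ) (h : ℂ) (g : E → E) (m : ℝ) (Y : ℕ → E)
    (k : ℕ → Fin s → E) : Prop where
  stage : ∀ j < S, ∀ i, k j i = g (Y j + h • ∑ l, M.a i l • k j l)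
  step : ∀ j < S, Y (j + 1) = Y j + h • ∑ i, M.b i • k j i
  bound : ∀ j < S, ∀ i, ‖k j i‖ ≤ m

theorem IsTrajectory.eq_add_sum {M : RungeKutta s} {S : ℕ} {h : ℂ} {g : E → E} {m : ℝ}
    {Y : ℕ → E} {k : ℕ → Fin s → E} (H : M.IsTrajectory S h g m Y k) {j : ℕ} (hj : j ≤ S) :
    Y j = Y 0 + h • ∑ l ∈ Finset.range j, ∑ i, M.b i • k l i := by
  induction j with
  | zero => simp
  | succ j ih =>
    rw [H.step j (by omega), ih (by omega), Finset.sum_range_succ, smul_add, add_assoc]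

/-- The tableau of the `S`-fold composition of a method with itself, scaled to a total step. -/
noncomputable def compositeTableau (M : RungeKutta s) (S : ℕ) (p q : Fin S × Fin s) : ℝ :=
  if q.1 < p.1 then M.b q.2 / S else if q.1 = p.1 then M.a p.2 q.2 / S else 0

theorem sum_abs_compositeTableau_le (M : RungeKutta s) {S : ℕ} (hS : 1 ≤ S) (p : Fin S × Fin s) :
    ∑ q, |M.compositeTableau S p q| ≤ M.kappa := by
  have hS' : (0 : ℝ) < S := by exact_mod_cast hS
  rw [Fintype.sum_prod_type]
  have : ∀ j : Fin S, ∑ i, |M.compositeTableau S p (j, i)| ≤ M.kappa / S := by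
    intro j
    unfold compositeTableau
    rcases lt_trichotomy j p.1 with h | h | h
    · simp only [h, if_true, abs_div, Nat.abs_cast, ← Finset.sum_div]
      gcongr
      exact M.sum_abs_b_le
    · simp only [h, lt_irrefl, if_true, if_false, abs_div, Nat.abs_cast, ← Finset.sum_div]
      gcongr
      exact M.sum_abs_a_le _
    · simp only [h.not_gt, h.ne', if_false, abs_zero, Finset.sum_const_zero]
      have := M.kappa_pos
      positivity
  refine (Finset.sum_le_sum fun j _ => this j).trans_eq ?_
  simp only [Finset.sum_const, Finset.card_univ, Fintype.card_fin, nsmul_eq_mul]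
  field_simp

/-- Stages of earlier steps enter a later stage with the weights `b`, those of the same step with
`a`. Hence `S` steps are one step of size `T` of a method with `S * s` stages, and the one-step
comparison applies with the same `kappa`. -/
theorem IsTrajectory.composite_stage {M : RungeKutta s} {S : ℕ} (hS : 1 ≤ S) {T : ℂ} {g : E → E}
    {m : ℝ} {Y : ℕ → E} {k : ℕ → Fin s → E} (H : M.IsTrajectory S (T / S) g m Y k)
    (p : Fin S × Fin s) :
    k p.1 p.2 = g (Y 0 + T • ∑ q : Fin S × Fin s, M.compositeTableau S p q • k q.1 q.2) := by
  have hS' : (S : ℝ) ≠ 0 := by positivity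
  obtain ⟨j, i⟩ := p
  rw [H.stage j j.2 i, H.eq_add_sum j.2.le, add_assoc, ← smul_add]
  congr 2
  have hsum : ∑ q : Fin S × Fin s, M.compositeTableau S (j, i) q • k q.1 q.2
      = (S : ℝ)⁻¹ • (∑ l ∈ Finset.range j, ∑ i, M.b i • k l i + ∑ l, M.a i l • k j l) := by
    rw [Fintype.sum_prod_type]
    have h1 : ∀ l : Fin S, ∑ i', M.compositeTableau S (j, i) (l, i') • k l i'
        = (fun l : ℕ => (S : ℝ)⁻¹ • ((if l < j then ∑ i, M.b i • k l i else 0)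
          + if l = j then ∑ i', M.a i i' • k l i' else 0)) l := by
      intro l
      unfold compositeTableau
      rcases lt_trichotomy l j with h | h | h
      · have h' : (l : ℕ) < j := h
        simp only [h, h', h'.ne, if_true, if_false, add_zero, Finset.smul_sum, smul_smul]
        exact Finset.sum_congr rfl fun _ _ => by rw [div_eq_inv_mul]
      · subst h
        simp only [lt_irrefl, if_true, if_false, zero_add, Finset.smul_sum, smul_smul]
        exact Finset.sum_congr rfl fun _ _ => by rw [div_eq_inv_mul]
      · have h' : (j : ℕ) < l := h
        simp [h.not_gt, h.ne', h'.not_gt, h'.ne']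
    rw [Finset.sum_congr rfl fun l _ => h1 l, Fin.sum_univ_eq_sum_range
      (fun l : ℕ => (S : ℝ)⁻¹ • ((if l < j then ∑ i, M.b i • k l i else 0)
          + if l = j then ∑ i', M.a i i' • k l i' else 0)) S, ← Finset.smul_sum,
      Finset.sum_add_distrib, ← Finset.sum_filter, Finset.sum_ite_eq', if_pos (by simp)]
    congr 3
    ext l
    have := j.2
    simp only [Finset.mem_filter, Finset.mem_range]
    omega
  rw [hsum, ← algebraMap_smul ℂ (S : ℝ)⁻¹, smul_smul]
  congr 1
  simp [div_eq_mul_inv]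

theorem IsTrajectory.sub_eq {M : RungeKutta s} {S : ℕ} {T : ℂ} {g : E → E}
    {m : ℝ} {Y : ℕ → E} {k : ℕ → Fin s → E} (H : M.IsTrajectory S (T / S) g m Y k) :
    Y S = Y 0 + T • ∑ q : Fin S × Fin s, (M.b q.2 / S) • k q.1 q.2 := by
  rw [H.eq_add_sum le_rfl, Fintype.sum_prod_type,
    ← Fin.sum_univ_eq_sum_range (fun l => ∑ i, M.b i • k l i) S]
  congr 1
  rw [div_eq_mul_inv, mul_smul]
  congr 1
  have : ((S : ℂ)⁻¹) = algebraMap ℝ ℂ (S : ℝ)⁻¹ := by simp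
  rw [this, algebraMap_smul]
  simp only [Finset.smul_sum, smul_smul, div_eq_inv_mul]

/-- The case of several steps. -/
theorem IsTrajectory.norm_sub_sub_le {M : RungeKutta s} (hb : ∑ i, M.b i = 1) {S : ℕ} (hS : 1 ≤ S)
    {g g' : E → E} {y : E} {δ m ε : ℝ} {T : ℂ} (hδ : 0 < δ)
    (hg : CurveHolomorphic (ball y δ) g) (hg' : CurveHolomorphic (ball y δ) g')
    (hm : ∀ z ∈ ball y δ, ‖g z‖ ≤ m)
    (hε : ∀ z ∈ ball y δ, ‖g z - g' z‖ ≤ ε) (hT : 16 * M.kappa * m * ‖T‖ ≤ δ)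
    {Y Y' : ℕ → E} {k k' : ℕ → Fin s → E} (H : M.IsTrajectory S (T / S) g m Y k)
    (H' : M.IsTrajectory S (T / S) g' m Y' k') (h0 : Y 0 = y) (h0' : Y' 0 = y) :
    ‖Y S - Y' S - T • (g y - g' y)‖ ≤ ‖T‖ * (12 * M.kappa ^ 2 * m * ‖T‖ * ε / δ) := by
  have hS' : (0 : ℝ) < S := by exact_mod_cast hS
  rw [H.sub_eq, H'.sub_eq, h0, h0', add_sub_add_left_eq_sub, ← smul_sub, ← smul_sub, norm_smul]
  refine mul_le_mul_of_nonneg_left ?_ (norm_nonneg _)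
  refine norm_sum_sub_sub_le (ι := Fin S × Fin s) (α := M.compositeTableau S)
    (β := fun q => M.b q.2 / S)
    (k := fun q => k q.1 q.2) (k' := fun q => k' q.1 q.2)
    (M.sum_abs_compositeTableau_le hS) ?_ ?_ hδ hg hg' hm hε hT
    (fun p => by rw [H.composite_stage hS p, h0]) (fun p => by rw [H'.composite_stage hS p, h0'])
    (fun p => H.bound _ p.1.2 _) (fun p => H'.bound _ p.1.2 _)
  · rw [Fintype.sum_prod_type]
    simp only [abs_div, Nat.abs_cast, ← Finset.sum_div, Finset.sum_const, Finset.card_univ,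
      Fintype.card_fin, nsmul_eq_mul]
    rw [mul_div_cancel_left₀ _ hS'.ne']
    exact M.sum_abs_b_le
  · rw [Fintype.sum_prod_type]
    simp only [← Finset.sum_div, Finset.sum_const, Finset.card_univ,
      Fintype.card_fin, nsmul_eq_mul, hb]
    exact mul_div_cancel_left₀ _ hS'.ne'

end RungeKutta

end Comparison

/-! ### The flow in complex time through Picard iteration -/

section FlowIncrement

variable {E : Type*} [NormedAddCommGroup E] [NormedSpace ℂ E] [NormedSpace ℝ E]
  [IsScalarTower ℝ ℂ E]

/-- The integrand of the Picard operator for the increment function of the flow. -/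
def flowIntegrand (f : E → E) (u : ℂ × E → E) (p : ℂ × E) : E := f (p.2 + p.1 • u p)

/-- The Picard operator for the increment function of the flow. -/
noncomputable def flowPicard (f : E → E) (u : ℂ × E → E) (p : ℂ × E) : E :=
  ∫ r in (0 : ℝ)..1, flowIntegrand f u ((r : ℂ) * p.1, p.2)

/-- The increment function `(φ_h(y) - y) / h` of the flow, for complex times. -/
noncomputable def flowIncrement (f : E → E) (h : ℂ) (y : E) : E :=
  limUnder atTop fun n => (flowPicard f)^[n] 0 (h, y)

theorem isOpen_ball_prod_ball (H : ℝ) (x : E) (R : ℝ) :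
    IsOpen (ball (0 : ℂ) H ×ˢ ball x R) := isOpen_ball.prod isOpen_ball

theorem scaled_mem {H : ℝ} {x : E} {R : ℝ} {p : ℂ × E} (hp : p ∈ ball (0 : ℂ) H ×ˢ ball x R)
    {r : ℝ} (hr : r ∈ Icc (0 : ℝ) 1) :
    ((r : ℂ) * p.1, p.2) ∈ ball (0 : ℂ) H ×ˢ ball x R := by
  refine ⟨?_, hp.2⟩
  have := mem_ball_zero_iff.1 hp.1
  rw [mem_ball_zero_iff, norm_mul, Complex.norm_real, Real.norm_eq_abs, abs_of_nonneg hr.1]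
  nlinarith [hr.2, norm_nonneg p.1]

section

variable {f : E → E} {x : E} {R δ m H : ℝ}

theorem norm_smul_lt_eighth (hδ : 0 < δ) (hm : 0 ≤ m) (hH : 8 * m * H ≤ δ) {h : ℂ} (hh : ‖h‖ < H)
    {v : E} (hv : ‖v‖ ≤ m) : ‖h • v‖ < δ / 2 := by
  rw [norm_smul]
  nlinarith [norm_nonneg h, norm_nonneg v]

theorem flow_arg_mem (hδ : 0 < δ) (hm : 0 ≤ m) (hH : 8 * m * H ≤ δ) {p : ℂ × E}
    (hp : p ∈ ball (0 : ℂ) H ×ˢ ball x R) {v : E} (hv : ‖v‖ ≤ m) :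
    p.2 + p.1 • v ∈ ball x (R + δ) := by
  have h1 := norm_smul_lt_eighth hδ hm hH (mem_ball_zero_iff.1 hp.1) hv
  have h2 := mem_ball.1 hp.2
  rw [mem_ball]
  have := dist_triangle (p.2 + p.1 • v) p.2 x
  rw [dist_self_add_left] at this
  linarith

theorem curveHolomorphic_flowIntegrand (hf : CurveHolomorphic (ball x (R + δ)) f)
    (hδ : 0 < δ) (hm : 0 ≤ m) (hH : 8 * m * H ≤ δ)
    {u : ℂ × E → E} (hu : CurveHolomorphic (ball (0 : ℂ) H ×ˢ ball x R) u)
    (hum : ∀ p ∈ ball (0 : ℂ) H ×ˢ ball x R, ‖u p‖ ≤ m) :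
    CurveHolomorphic (ball (0 : ℂ) H ×ˢ ball x R) (flowIntegrand f u) :=
  hf.comp ((CurveHolomorphic.of_differentiableOn differentiableOn_snd).add
    ((CurveHolomorphic.of_differentiableOn differentiableOn_fst).smul hu))
    fun _ hp => flow_arg_mem hδ hm hH hp (hum _ hp)

theorem norm_flowIntegrand_le (hb : ∀ z ∈ ball x (R + δ), ‖f z‖ ≤ m) (hδ : 0 < δ) (hm : 0 ≤ m)
    (hH : 8 * m * H ≤ δ) {u : ℂ × E → E}
    (hum : ∀ p ∈ ball (0 : ℂ) H ×ˢ ball x R, ‖u p‖ ≤ m) {p : ℂ × E}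
    (hp : p ∈ ball (0 : ℂ) H ×ˢ ball x R) : ‖flowIntegrand f u p‖ ≤ m :=
  hb _ (flow_arg_mem hδ hm hH hp (hum p hp))

theorem continuousOn_flowIntegrand [CompleteSpace E] (hf : CurveHolomorphic (ball x (R + δ)) f)
    (hδ : 0 < δ) (hm : 0 ≤ m) (hH : 8 * m * H ≤ δ)
    {u : ℂ × E → E} (hu : CurveHolomorphic (ball (0 : ℂ) H ×ˢ ball x R) u)
    (hum : ∀ p ∈ ball (0 : ℂ) H ×ˢ ball x R, ‖u p‖ ≤ m) {p : ℂ × E}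
    (hp : p ∈ ball (0 : ℂ) H ×ˢ ball x R) :
    ContinuousOn (fun r : ℝ => flowIntegrand f u ((r : ℂ) * p.1, p.2)) (Icc 0 1) := by
  have hc : Continuous fun z : ℂ => (z * p.1, p.2) := by fun_prop
  exact (curveHolomorphic_flowIntegrand hf hδ hm hH hu hum).continuousOn_path
    (c := fun z : ℂ => (z * p.1, p.2))
    ((isOpen_ball_prod_ball H x R).preimage hc)
    (by fun_prop) (fun z hz => hz) fun r hr => scaled_mem hp hr

theorem norm_flowPicard_le (hb : ∀ z ∈ ball x (R + δ), ‖f z‖ ≤ m) (hδ : 0 < δ) (hm : 0 ≤ m)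
    (hH : 8 * m * H ≤ δ) {u : ℂ × E → E}
    (hum : ∀ p ∈ ball (0 : ℂ) H ×ˢ ball x R, ‖u p‖ ≤ m) {p : ℂ × E}
    (hp : p ∈ ball (0 : ℂ) H ×ˢ ball x R) : ‖flowPicard f u p‖ ≤ m := by
  refine (intervalIntegral.norm_integral_le_of_norm_le_const (C := m) fun r hr => ?_).trans_eq
    (by simp)
  rw [uIoc_of_le zero_le_one] at hr
  exact norm_flowIntegrand_le hb hδ hm hH hum (scaled_mem hp ⟨hr.1.le, hr.2⟩)

theorem curveHolomorphic_flowPicard [CompleteSpace E] (hf : CurveHolomorphic (ball x (R + δ)) f)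
    (hb : ∀ z ∈ ball x (R + δ), ‖f z‖ ≤ m)
    (hδ : 0 < δ) (hm : 0 ≤ m) (hH : 8 * m * H ≤ δ)
    {u : ℂ × E → E} (hu : CurveHolomorphic (ball (0 : ℂ) H ×ˢ ball x R) u)
    (hum : ∀ p ∈ ball (0 : ℂ) H ×ˢ ball x R, ‖u p‖ ≤ m) :
    CurveHolomorphic (ball (0 : ℂ) H ×ˢ ball x R) (flowPicard f u) := by
  refine CurveHolomorphic.intervalIntegral (m := m)
    (w := fun r p => flowIntegrand f u ((r : ℂ) * p.1, p.2)) (fun r hr => ?_) (fun r hr p hp => ?_)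
    (fun p hp => continuousOn_flowIntegrand hf hδ hm hH hu hum hp)
  · exact (curveHolomorphic_flowIntegrand hf hδ hm hH hu hum).comp
      (CurveHolomorphic.of_differentiableOn (by fun_prop)) fun p hp => scaled_mem hp hr
  · exact norm_flowIntegrand_le hb hδ hm hH hum (scaled_mem hp hr)

/-- The margin `δ` gives `f` the Lipschitz constant `4 * m / δ` at the arguments that occur, and
multiplication by a time shorter than `H` turns it into `1 / 2`. -/
theorem norm_flowPicard_sub_le [CompleteSpace E] (hf : CurveHolomorphic (ball x (R + δ)) f)
    (hb : ∀ z ∈ ball x (R + δ), ‖f z‖ ≤ m)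
    (hδ : 0 < δ) (hm : 0 ≤ m) (hH : 8 * m * H ≤ δ)
    {u v : ℂ × E → E} (hu : CurveHolomorphic (ball (0 : ℂ) H ×ˢ ball x R) u)
    (hum : ∀ p ∈ ball (0 : ℂ) H ×ˢ ball x R, ‖u p‖ ≤ m)
    (hv : CurveHolomorphic (ball (0 : ℂ) H ×ˢ ball x R) v)
    (hvm : ∀ p ∈ ball (0 : ℂ) H ×ˢ ball x R, ‖v p‖ ≤ m) {ε : ℝ}
    (hε : ∀ p ∈ ball (0 : ℂ) H ×ˢ ball x R, ‖u p - v p‖ ≤ ε)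
    {p : ℂ × E} (hp : p ∈ ball (0 : ℂ) H ×ˢ ball x R) :
    ‖flowPicard f u p - flowPicard f v p‖ ≤ ε * (1 / 2) := by
  have hε0 : 0 ≤ ε := (norm_nonneg _).trans (hε p hp)
  unfold flowPicard
  rw [← intervalIntegral.integral_sub
    (ContinuousOn.intervalIntegrable (by
      rw [uIcc_of_le zero_le_one]; exact continuousOn_flowIntegrand hf hδ hm hH hu hum hp))
    (ContinuousOn.intervalIntegrable (by
      rw [uIcc_of_le zero_le_one]; exact continuousOn_flowIntegrand hf hδ hm hH hv hvm hp))]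
  refine (intervalIntegral.norm_integral_le_of_norm_le_const (C := ε * (1 / 2))
    fun r hr => ?_).trans_eq (by simp)
  rw [uIoc_of_le zero_le_one] at hr
  have hq := scaled_mem hp ⟨hr.1.le, hr.2⟩
  set q : ℂ × E := ((r : ℂ) * p.1, p.2)
  have hsub : ball q.2 δ ⊆ ball x (R + δ) := ball_subset_ball' (by
    have := mem_ball.1 hq.2; linarith)
  have hqH := mem_ball_zero_iff.1 hq.1
  have hmem : ∀ w : E, ‖w‖ ≤ m → q.2 + q.1 • w ∈ ball q.2 (δ / 2) := fun w hw => by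
    rw [mem_ball, dist_self_add_left]
    exact norm_smul_lt_eighth hδ hm hH hqH hw
  refine ((hf.mono hsub).lipschitz_half hδ (fun z hz => hb z (hsub hz)) _ (hmem _ (hum q hq)) _
    (hmem _ (hvm q hq))).trans ?_
  rw [add_sub_add_left_eq_sub, ← smul_sub, norm_smul]
  calc 4 * m / δ * (‖q.1‖ * ‖u q - v q‖) ≤ 4 * m / δ * (H * ε) := by
        have := mul_le_mul hqH.le (hε q hq) (norm_nonneg _) ((norm_nonneg _).trans hqH.le)
        gcongr
    _ = (8 * m * H) / δ * (ε * (1 / 2)) := by ring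
    _ ≤ 1 * (ε * (1 / 2)) := by
        gcongr
        exact (div_le_one hδ).2 hH
    _ = ε * (1 / 2) := one_mul _

variable [CompleteSpace E]

theorem flowPicard_iterate_spec (hf : CurveHolomorphic (ball x (R + δ)) f)
    (hb : ∀ z ∈ ball x (R + δ), ‖f z‖ ≤ m)
    (hδ : 0 < δ) (hm : 0 ≤ m) (hH : 8 * m * H ≤ δ) (n : ℕ) :
    CurveHolomorphic (ball (0 : ℂ) H ×ˢ ball x R) ((flowPicard f)^[n] 0) ∧
    ∀ p ∈ ball (0 : ℂ) H ×ˢ ball x R, ‖(flowPicard f)^[n] 0 p‖ ≤ m := by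
  induction n with
  | zero => exact ⟨CurveHolomorphic.const 0, fun p _ => by simpa using hm⟩
  | succ n ih =>
    rw [Function.iterate_succ_apply']
    exact ⟨curveHolomorphic_flowPicard hf hb hδ hm hH ih.1 ih.2,
      fun p hp => norm_flowPicard_le hb hδ hm hH ih.2 hp⟩

theorem dist_flowPicard_iterate_le (hf : CurveHolomorphic (ball x (R + δ)) f)
    (hb : ∀ z ∈ ball x (R + δ), ‖f z‖ ≤ m)
    (hδ : 0 < δ) (hm : 0 ≤ m) (hH : 8 * m * H ≤ δ) (n : ℕ) {p : ℂ × E}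
    (hp : p ∈ ball (0 : ℂ) H ×ˢ ball x R) :
    dist ((flowPicard f)^[n] 0 p) ((flowPicard f)^[n + 1] 0 p) ≤ m * (1 / 2) ^ n := by
  induction n generalizing p with
  | zero =>
    rw [dist_comm, dist_eq_norm]
    simpa using (flowPicard_iterate_spec hf hb hδ hm hH 1).2 p hp
  | succ n ih =>
    have h1 := flowPicard_iterate_spec hf hb hδ hm hH n
    have h2 := flowPicard_iterate_spec hf hb hδ hm hH (n + 1)
    have key := norm_flowPicard_sub_le hf hb hδ hm hH h2.1 h2.2 h1.1 h1.2 (fun q hq => by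
      rw [← dist_eq_norm, dist_comm]; exact ih hq) hp
    rw [← Function.iterate_succ_apply' (flowPicard f) (n + 1) 0,
      ← Function.iterate_succ_apply' (flowPicard f) n 0] at key
    rw [dist_comm, dist_eq_norm, pow_succ, ← mul_assoc]
    exact key

theorem norm_flowPicard_iterate_sub_le (hf : CurveHolomorphic (ball x (R + δ)) f)
    (hb : ∀ z ∈ ball x (R + δ), ‖f z‖ ≤ m)
    (hδ : 0 < δ) (hm : 0 ≤ m) (hH : 8 * m * H ≤ δ) (n : ℕ) {p : ℂ × E}
    (hp : p ∈ ball (0 : ℂ) H ×ˢ ball x R) :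
    ‖(flowPicard f)^[n] 0 p - flowIncrement f p.1 p.2‖ ≤ m * (1 / 2) ^ n / (1 - 1 / 2) := by
  rw [← dist_eq_norm]
  have h := fun n => dist_flowPicard_iterate_le hf hb hδ hm hH n hp
  exact dist_le_of_le_geometric_of_tendsto (1 / 2) m (by norm_num) h
    (cauchySeq_of_le_geometric (1 / 2) m (by norm_num) h).tendsto_limUnder n

theorem tendsto_geometric_bound (m : ℝ) :
    Tendsto (fun n : ℕ => m * (1 / 2) ^ n / (1 - 1 / 2)) atTop (𝓝 0) := by
  have := ((tendsto_pow_atTop_nhds_zero_of_lt_one (r := (1 / 2 : ℝ)) (by norm_num)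
    (by norm_num)).const_mul m).div_const (1 - 1 / 2)
  simpa using this

theorem curveHolomorphic_flowIncrement (hf : CurveHolomorphic (ball x (R + δ)) f)
    (hb : ∀ z ∈ ball x (R + δ), ‖f z‖ ≤ m)
    (hδ : 0 < δ) (hm : 0 ≤ m) (hH : 8 * m * H ≤ δ) :
    CurveHolomorphic (ball (0 : ℂ) H ×ˢ ball x R) fun p => flowIncrement f p.1 p.2 :=
  CurveHolomorphic.of_uniform_limit (fun n => (flowPicard_iterate_spec hf hb hδ hm hH n).1)
    (tendsto_geometric_bound m) fun n _ hp => norm_flowPicard_iterate_sub_le hf hb hδ hm hH n hp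

theorem norm_flowIncrement_le (hf : CurveHolomorphic (ball x (R + δ)) f)
    (hb : ∀ z ∈ ball x (R + δ), ‖f z‖ ≤ m)
    (hδ : 0 < δ) (hm : 0 ≤ m) (hH : 8 * m * H ≤ δ) {p : ℂ × E}
    (hp : p ∈ ball (0 : ℂ) H ×ˢ ball x R) : ‖flowIncrement f p.1 p.2‖ ≤ m := by
  have : Tendsto (fun n => (flowPicard f)^[n] 0 p) atTop (𝓝 (flowIncrement f p.1 p.2)) :=
    tendsto_iff_norm_sub_tendsto_zero.2 (squeeze_zero (fun _ => norm_nonneg _)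
      (fun n => norm_flowPicard_iterate_sub_le hf hb hδ hm hH n hp) (tendsto_geometric_bound m))
  exact le_of_tendsto this.norm
    (Eventually.of_forall fun n => (flowPicard_iterate_spec hf hb hδ hm hH n).2 p hp)

theorem flowIncrement_eq_flowPicard (hf : CurveHolomorphic (ball x (R + δ)) f)
    (hb : ∀ z ∈ ball x (R + δ), ‖f z‖ ≤ m)
    (hδ : 0 < δ) (hm : 0 ≤ m) (hH : 8 * m * H ≤ δ) {p : ℂ × E}
    (hp : p ∈ ball (0 : ℂ) H ×ˢ ball x R) :
    flowIncrement f p.1 p.2 = flowPicard f (fun q => flowIncrement f q.1 q.2) p := by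
  have h1 : Tendsto (fun n => (flowPicard f)^[n] 0 p) atTop (𝓝 (flowIncrement f p.1 p.2)) :=
    tendsto_iff_norm_sub_tendsto_zero.2 (squeeze_zero (fun _ => norm_nonneg _)
      (fun n => norm_flowPicard_iterate_sub_le hf hb hδ hm hH n hp) (tendsto_geometric_bound m))
  refine tendsto_nhds_unique (h1.comp (tendsto_add_atTop_nat 1)) ?_
  rw [tendsto_iff_norm_sub_tendsto_zero]
  have h0 := (tendsto_geometric_bound m).mul_const (1 / 2)
  rw [zero_mul] at h0
  refine squeeze_zero (fun _ => norm_nonneg _) (fun n => ?_) h0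
  simp only [Function.comp_apply]
  rw [Function.iterate_succ_apply']
  have h2 := flowPicard_iterate_spec hf hb hδ hm hH n
  exact norm_flowPicard_sub_le hf hb hδ hm hH h2.1 h2.2
    (curveHolomorphic_flowIncrement hf hb hδ hm hH)
    (fun q hq => norm_flowIncrement_le hf hb hδ hm hH hq)
    (fun q hq => norm_flowPicard_iterate_sub_le hf hb hδ hm hH n hq) hp

/-- Rescaling turns `t` times the Picard integral over the unit interval into an integral over `[0,
t]`; the fundamental theorem of calculus then yields the differential equation. -/
theorem hasDerivAt_flowIncrement (hf : CurveHolomorphic (ball x (R + δ)) f)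
    (hb : ∀ z ∈ ball x (R + δ), ‖f z‖ ≤ m)
    (hδ : 0 < δ) (hm : 0 ≤ m) (hH : 8 * m * H ≤ δ) {y : E} (hy : y ∈ ball x R) {t : ℝ}
    (ht : |t| < H) :
    HasDerivAt (fun t : ℝ => y + t • flowIncrement f (t : ℂ) y)
      (f (y + t • flowIncrement f (t : ℂ) y)) t := by
  set u : ℂ × E → E := fun q => flowIncrement f q.1 q.2
  have hu := curveHolomorphic_flowIncrement hf hb hδ hm hH
  have hum := fun q hq => norm_flowIncrement_le hf hb hδ hm hH (p := q) hq
  let F : ℝ → E := fun t => flowIntegrand f u (t, y)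
  have hF : ∀ t : ℝ, F t = f (y + t • flowIncrement f (t : ℂ) y) := fun t => by
    simp only [F, flowIntegrand, u]
    rw [← algebraMap_smul ℂ t (flowIncrement f (t : ℂ) y), Complex.coe_algebraMap]
  have hmem : ∀ t : ℝ, |t| < H → ((t : ℂ), y) ∈ ball (0 : ℂ) H ×ˢ ball x R := fun t ht =>
    ⟨by simpa using ht, hy⟩
  have hFc : ContinuousOn F (Ioo (-H) H) := by
    have hc : Continuous fun z : ℂ => (z, y) := by fun_prop
    exact (curveHolomorphic_flowIntegrand hf hδ hm hH hu hum).continuousOn_path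
      (c := fun z : ℂ => (z, y)) ((isOpen_ball_prod_ball H x R).preimage hc) (by fun_prop)
      (fun z hz => hz) fun r hr => hmem r (abs_lt.2 hr)
  have heq : ∀ t : ℝ, |t| < H → y + t • flowIncrement f (t : ℂ) y = y + ∫ r in (0 : ℝ)..t, F r := by
    intro t ht
    have h1 := flowIncrement_eq_flowPicard hf hb hδ hm hH (hmem t ht)
    simp only at h1
    rw [h1]
    have h2 := intervalIntegral.smul_integral_comp_mul_right (a := 0) (b := 1) F t
    simp only [zero_mul, one_mul] at h2
    rw [← h2]
    simp only [flowPicard, F, Complex.ofReal_mul, u]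
  have hnhds : Ioo (-H) H ∈ 𝓝 t := isOpen_Ioo.mem_nhds (abs_lt.1 ht)
  have h0 : (0 : ℝ) ∈ Ioo (-H) H := by
    have := (abs_nonneg t).trans_lt ht
    exact ⟨by linarith, this⟩
  rw [← hF t]
  have hd := intervalIntegral.integral_hasDerivAt_right (a := 0) (b := t) (f := F)
    ((hFc.mono (OrdConnected.uIcc_subset inferInstance h0 (abs_lt.1 ht))).intervalIntegrable)
    (hFc.stronglyMeasurableAtFilter isOpen_Ioo t (abs_lt.1 ht))
    (hFc.continuousAt hnhds)
  refine (hd.const_add y).congr_of_eventuallyEq ?_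
  filter_upwards [hnhds] with r hr using heq r (abs_lt.2 hr)

theorem isIntegralCurveOn_flowIncrement (hf : CurveHolomorphic (ball x (R + δ)) f)
    (hb : ∀ z ∈ ball x (R + δ), ‖f z‖ ≤ m)
    (hδ : 0 < δ) (hm : 0 ≤ m) (hH : 8 * m * H ≤ δ) {y : E} (hy : y ∈ ball x R) {T : ℝ}
    (hT : T < H) :
    IsIntegralCurveOn (fun t : ℝ => y + t • flowIncrement f (t : ℂ) y) (fun _ => f) (Icc 0 T) :=
  fun t ht => (hasDerivAt_flowIncrement hf hb hδ hm hH hy (by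
    rw [abs_of_nonneg ht.1]; exact ht.2.trans_lt hT)).hasDerivWithinAt

theorem isFlowValue_iff_flowIncrement (hf : CurveHolomorphic (ball x (R + δ)) f)
    (hb : ∀ z ∈ ball x (R + δ), ‖f z‖ ≤ m)
    (hδ : 0 < δ) (hm : 0 ≤ m) (hH : 8 * m * H ≤ δ) {y : E} (hy : y ∈ ball x R) {T : ℝ}
    (hT0 : 0 ≤ T) (hT : T < H) (w : E) :
    IsFlowValue f T y w ↔ w = y + T • flowIncrement f (T : ℂ) y := by
  have hsub : ball y δ ⊆ ball x (R + δ) := ball_subset_ball' (by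
    have := mem_ball.1 hy; linarith)
  have hsub' : ball y (δ / 2) ⊆ ball y δ := ball_subset_ball (by linarith)
  exact isFlowValue_iff hm (by nlinarith) hT0 (fun z hz => hb z (hsub (hsub' hz)))
    ((hf.mono hsub).lipschitz_half hδ fun z hz => hb z (hsub hz))
    (γ := fun t : ℝ => y + t • flowIncrement f (t : ℂ) y) (by simp)
    (isIntegralCurveOn_flowIncrement hf hb hδ hm hH hy hT) w

theorem flow_eq_flowIncrement (hf : CurveHolomorphic (ball x (R + δ)) f)
    (hb : ∀ z ∈ ball x (R + δ), ‖f z‖ ≤ m)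
    (hδ : 0 < δ) (hm : 0 ≤ m) (hH : 8 * m * H ≤ δ) {y : E} (hy : y ∈ ball x R) {T : ℝ}
    (hT0 : 0 ≤ T) (hT : T < H) :
    flow f T y = y + T • flowIncrement f (T : ℂ) y := by
  rw [← isFlowValue_iff_flowIncrement hf hb hδ hm hH hy hT0 hT]
  exact Classical.epsilon_spec
    ⟨_, (isFlowValue_iff_flowIncrement hf hb hδ hm hH hy hT0 hT _).2 rfl⟩

end

end FlowIncrement

/-! ### Taylor expansion with explicit remainders -/

section Taylor

variable {E : Type*} [NormedAddCommGroup E] [NormedSpace ℂ E]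

/-- The remainders of the Taylor expansion of `v` at `0`, divided by the power of the variable. -/
noncomputable def taylorQuotient (v : ℂ → E) (n : ℕ) : ℂ → E := (fun w => dslope w 0)^[n] v

/-- The Taylor coefficients of `v` at `0`. -/
noncomputable def taylorCoeff (v : ℂ → E) (n : ℕ) : E := taylorQuotient v n 0

theorem taylorQuotient_succ (v : ℂ → E) (n : ℕ) :
    taylorQuotient v (n + 1) = dslope (taylorQuotient v n) 0 :=
  Function.iterate_succ_apply' ..

theorem eq_sum_add_taylorQuotient (v : ℂ → E) (n : ℕ) (h : ℂ) :
    v h = ∑ k ∈ Finset.range n, h ^ k • taylorCoeff v k + h ^ n • taylorQuotient v n h := by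
  induction n with
  | zero => simp [taylorQuotient]
  | succ n ih =>
    have := sub_smul_dslope (taylorQuotient v n) 0 h
    rw [sub_zero] at this
    rw [ih, Finset.sum_range_succ, taylorQuotient_succ, pow_succ, mul_smul, this, smul_sub,
      taylorCoeff]
    abel

variable [CompleteSpace E]

/-- Schwarz' lemma bounds each divided difference on the whole disc at the cost of a factor `2 / H`.
No shrinking of the disc is needed, so the remainder is geometric in `2 * ‖h‖ / H`. -/
theorem taylorQuotient_spec {v : ℂ → E} {H C : ℝ} (hH : 0 < H)
    (hv : DifferentiableOn ℂ v (ball 0 H)) (hC : ∀ z ∈ ball (0 : ℂ) H, ‖v z‖ ≤ C) (n : ℕ) :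
    DifferentiableOn ℂ (taylorQuotient v n) (ball 0 H) ∧
      ∀ z ∈ ball (0 : ℂ) H, ‖taylorQuotient v n z‖ ≤ C * (2 / H) ^ n := by
  induction n with
  | zero => exact ⟨hv, by simpa [taylorQuotient] using hC⟩
  | succ n ih =>
    rw [taylorQuotient_succ]
    refine ⟨(Complex.differentiableOn_dslope (ball_mem_nhds _ hH)).2 ih.1, fun z hz => ?_⟩
    refine (Complex.norm_dslope_le_div_of_mapsTo_ball (R₂ := 2 * (C * (2 / H) ^ n)) ih.1
      (fun w hw => ?_) hz).trans_eq (by ring)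
    rw [mem_closedBall, dist_eq_norm]
    have := norm_sub_le (taylorQuotient v n w) (taylorQuotient v n 0)
    have := ih.2 w hw
    have := ih.2 0 (mem_ball_self hH)
    linarith

theorem norm_sub_sum_taylorCoeff_le {v : ℂ → E} {H C : ℝ} (hH : 0 < H)
    (hv : DifferentiableOn ℂ v (ball 0 H)) (hC : ∀ z ∈ ball (0 : ℂ) H, ‖v z‖ ≤ C) (n : ℕ) {h : ℂ}
    (hh : h ∈ ball (0 : ℂ) H) :
    ‖v h - ∑ k ∈ Finset.range n, h ^ k • taylorCoeff v k‖ ≤ C * (2 * ‖h‖ / H) ^ n := by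
  nth_rw 1 [eq_sum_add_taylorQuotient v n h]
  rw [add_sub_cancel_left, norm_smul, norm_pow]
  calc ‖h‖ ^ n * ‖taylorQuotient v n h‖ ≤ ‖h‖ ^ n * (C * (2 / H) ^ n) := by
        gcongr; exact (taylorQuotient_spec hH hv hC n).2 h hh
    _ = C * (2 * ‖h‖ / H) ^ n := by
        rw [show 2 * ‖h‖ / H = ‖h‖ * (2 / H) by ring, mul_pow]; ring

/-- The coefficients of an asymptotic expansion are unique. -/
theorem eq_zero_of_sum_pow_smul_isBigO {E : Type*} [NormedAddCommGroup E] [NormedSpace ℝ E]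
    {n : ℕ} {a : ℕ → E}
    (h : (fun t : ℝ => ∑ k ∈ Finset.range n, t ^ k • a k) =O[𝓝[>] 0] fun t : ℝ => t ^ n) :
    ∀ k < n, a k = 0 := by
  induction n generalizing a with
  | zero => intro k hk; omega
  | succ n ih =>
    have h0 : a 0 = 0 := by
      have h1 : Tendsto (fun t : ℝ => ∑ k ∈ Finset.range (n + 1), t ^ k • a k) (𝓝[>] 0)
          (𝓝 (∑ k ∈ Finset.range (n + 1), (0 : ℝ) ^ k • a k)) :=
        (Continuous.tendsto (by fun_prop) 0).mono_left nhdsWithin_le_nhds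
      have h2 : Tendsto (fun t : ℝ => t ^ (n + 1)) (𝓝[>] 0) (𝓝 0) := by
        have := (continuous_pow (M := ℝ) (n + 1)).tendsto 0
        rw [zero_pow (by omega)] at this
        exact this.mono_left nhdsWithin_le_nhds
      have h3 := tendsto_nhds_unique h1 (h.trans_tendsto h2)
      rw [Finset.sum_range_succ'] at h3
      simpa using h3
    have h1 : (fun t : ℝ => ∑ k ∈ Finset.range n, t ^ k • a (k + 1)) =O[𝓝[>] 0]
        fun t : ℝ => t ^ n := by
      obtain ⟨C, hC⟩ := h.bound
      refine IsBigO.of_bound C ?_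
      filter_upwards [hC, self_mem_nhdsWithin] with t ht ht0
      have ht0' : 0 < t := ht0
      rw [Finset.sum_range_succ', h0, smul_zero, add_zero] at ht
      have e : ∑ k ∈ Finset.range n, t ^ (k + 1) • a (k + 1)
          = t • ∑ k ∈ Finset.range n, t ^ k • a (k + 1) := by
        rw [Finset.smul_sum]
        exact Finset.sum_congr rfl fun k _ => by rw [smul_smul, pow_succ']
      rw [e, norm_smul, pow_succ', norm_mul, mul_left_comm] at ht
      exact le_of_mul_le_mul_left ht (norm_pos_iff.2 ht0'.ne')
    intro k hk
    cases k with
    | zero => exact h0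
    | succ k => exact ih h1 k (by omega)

end Taylor

/-! ### Approximate inversion of the method -/

namespace RungeKutta

variable {E : Type*} [NormedAddCommGroup E] [NormedSpace ℂ E] [NormedSpace ℝ E]
  [IsScalarTower ℝ ℂ E] [CompleteSpace E] {s : ℕ}

theorem mem_ball_of_mem {x y z : E} {R δ : ℝ} (hy : y ∈ ball x R) (hz : z ∈ ball y δ) :
    z ∈ ball x (R + δ) := by
  have := dist_triangle z y x
  rw [mem_ball] at *
  linarith

theorem curveHolomorphic_section {G : ℂ → E → E} {H R : ℝ} {x : E}
    (hG : CurveHolomorphic (ball (0 : ℂ) H ×ˢ ball x R) fun p => G p.1 p.2) {h : ℂ}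
    (hh : h ∈ ball (0 : ℂ) H) : CurveHolomorphic (ball x R) (G h) :=
  hG.comp (c := fun y => (h, y)) (CurveHolomorphic.of_differentiableOn (by fun_prop))
    fun _ hy => ⟨hh, hy⟩

theorem differentiableOn_section {G : ℂ → E → E} {H R : ℝ} {x : E}
    (hG : CurveHolomorphic (ball (0 : ℂ) H ×ˢ ball x R) fun p => G p.1 p.2) {y : E}
    (hy : y ∈ ball x R) : DifferentiableOn ℂ (fun h => G h y) (ball 0 H) :=
  hG isOpen_ball (c := fun h => (h, y)) (by fun_prop) fun _ hh => ⟨hh, hy⟩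

theorem contractsNear_section (M : RungeKutta s) {G : ℂ → E → E} {H R δ m : ℝ} {x : E}
    (hm : 0 ≤ m) (hδ : 0 < δ)
    (hG : CurveHolomorphic (ball (0 : ℂ) H ×ˢ ball x (R + δ)) fun p => G p.1 p.2)
    (hb : ∀ p ∈ ball (0 : ℂ) H ×ˢ ball x (R + δ), ‖G p.1 p.2‖ ≤ m)
    (hH : 8 * M.kappa * m * H ≤ δ) {p : ℂ × E} (hp : p ∈ ball (0 : ℂ) H ×ˢ ball x R) :
    M.ContractsNear p.1 (G p.1) p.2 (δ / 2) m (4 * m / δ) := by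
  have hsub : ball p.2 δ ⊆ ball x (R + δ) := fun z hz => mem_ball_of_mem hp.2 hz
  refine ((curveHolomorphic_section hG hp.1).mono hsub).contractsNear M hδ
    (fun z hz => hb (p.1, z) ⟨hp.1, hsub hz⟩) (le_trans ?_ hH)
  have h1 := M.kappa_pos
  have h2 := (mem_ball_zero_iff.1 hp.1).le
  gcongr

/-- The fixed point iterates are compositions of `G`, and they converge uniformly. The field may
itself depend on the step, as it does for the modified field. -/
theorem curveHolomorphic_increment (M : RungeKutta s) {G : ℂ → E → E} {H R δ m : ℝ} {x : E}
    (hm : 0 ≤ m) (hδ : 0 < δ)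
    (hG : CurveHolomorphic (ball (0 : ℂ) H ×ˢ ball x (R + δ)) fun p => G p.1 p.2)
    (hb : ∀ p ∈ ball (0 : ℂ) H ×ˢ ball x (R + δ), ‖G p.1 p.2‖ ≤ m)
    (hH : 8 * M.kappa * m * H ≤ δ) :
    CurveHolomorphic (ball (0 : ℂ) H ×ˢ ball x R) fun p => M.increment p.1 (G p.1) p.2 := by
  have hc := fun (p : ℂ × E) (hp : p ∈ ball (0 : ℂ) H ×ˢ ball x R) =>
    M.contractsNear_section hm hδ hG hb hH hp
  have hiter : ∀ n i, CurveHolomorphic (ball (0 : ℂ) H ×ˢ ball x R)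
      fun p => (M.stageMap p.1 (G p.1) p.2)^[n] 0 i := by
    intro n
    induction n with
    | zero => exact fun i => CurveHolomorphic.const 0
    | succ n ih =>
      intro i
      simp only [Function.iterate_succ_apply']
      refine hG.comp (c := fun p : ℂ × E => (p.1, p.2 + p.1 • ∑ j, M.a i j •
        (M.stageMap p.1 (G p.1) p.2)^[n] 0 j)) ?_ fun p hp => ⟨hp.1, ?_⟩
      · exact (CurveHolomorphic.of_differentiableOn differentiableOn_fst).prodMk
          ((CurveHolomorphic.of_differentiableOn differentiableOn_snd).add
          ((CurveHolomorphic.of_differentiableOn differentiableOn_fst).smul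
          (CurveHolomorphic.sum fun j _ => (ih j).real_smul _)))
      · exact mem_ball_of_mem hp.2 (ball_subset_ball (by linarith)
          ((hc p hp).stage_arg_mem ((hc p hp).norm_iterate_le n) i))
  refine CurveHolomorphic.sum fun i _ => CurveHolomorphic.real_smul _ ?_
  refine CurveHolomorphic.of_uniform_limit (fun n => hiter n i) (tendsto_geometric_bound m)
    fun n p hp => ?_
  exact (norm_le_pi_norm _ i).trans ((hc p hp).norm_iterate_sub_slopes_le n)

theorem increment_zero (M : RungeKutta s) (h : ℂ) (y : E) : M.increment h 0 y = 0 := by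
  have H : M.ContractsNear h (0 : E → E) y 1 0 0 :=
    ⟨le_rfl, by simp, by simp, le_rfl, by simp, by simp⟩
  simpa using H.norm_increment_le

/-- Iterates that solve the equation `Φ_{h,g} = φ_{h,f}` for the field `g` approximately. -/
noncomputable def imdeIter (M : RungeKutta s) (f : E → E) : ℕ → ℂ → E → E
  | 0 => fun _ => 0
  | n + 1 => fun h y =>
      imdeIter M f n h y + (flowIncrement f h y - M.increment h (imdeIter M f n h) y)

/-- By definition `g_{n+1} - g_n` is the residual of `g_n`, so the new residual is exactly the error
in the comparison lemma for these two fields. With the bound `2 * m` for the fields, each iteration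
multiplies the residual by `24 κ² m |h| / δ`, at most `1 / 2`, and consumes `δ` of the radius.
Summing the residuals keeps all iterates below `2 * m`. -/
theorem imdeIter_spec (M : RungeKutta s) (hM : ∑ i, M.b i = 1) {f : E → E} {x : E}
    {R₀ δ m H : ℝ} (hf : CurveHolomorphic (ball x R₀) f) (hb : ∀ z ∈ ball x R₀, ‖f z‖ ≤ m)
    (hm : 0 ≤ m) (hδ : 0 < δ) (hH : 48 * M.kappa ^ 2 * m * H ≤ δ) (n : ℕ) :
    (∀ R, R + n * δ ≤ R₀ →
      CurveHolomorphic (ball (0 : ℂ) H ×ˢ ball x R) (fun p => M.imdeIter f n p.1 p.2) ∧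
      ∀ p ∈ ball (0 : ℂ) H ×ˢ ball x R,
        ‖M.imdeIter f n p.1 p.2‖ ≤ m * (2 - 2 * (1 / 2) ^ n)) ∧
    (∀ R, R + (n + 1) * δ ≤ R₀ → ∀ p ∈ ball (0 : ℂ) H ×ˢ ball x R,
      ‖flowIncrement f p.1 p.2 - M.increment p.1 (M.imdeIter f n p.1) p.2‖
        ≤ m * (24 * M.kappa ^ 2 * m * ‖p.1‖ / δ) ^ n) := by
  have hκ := M.one_le_kappa
  have hsmall : ∀ p : ℂ × E, p.1 ∈ ball (0 : ℂ) H →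
      8 * m * H ≤ δ ∧ 8 * M.kappa * (2 * m) * H ≤ δ ∧ 16 * M.kappa * (2 * m) * ‖p.1‖ ≤ δ ∧
      24 * M.kappa ^ 2 * m * ‖p.1‖ / δ ≤ 1 / 2 := by
    intro p hp
    have hp' := (mem_ball_zero_iff.1 hp)
    have hH0 : 0 ≤ m * H := mul_nonneg hm ((norm_nonneg _).trans hp'.le)
    have h1 : m * ‖p.1‖ ≤ m * H := by gcongr
    have h2 : m * H ≤ M.kappa * (m * H) := le_mul_of_one_le_left hH0 hκ
    have h3 : M.kappa * (m * H) ≤ M.kappa * (M.kappa * (m * H)) :=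
      le_mul_of_one_le_left (by positivity) hκ
    have h4 : M.kappa * (m * ‖p.1‖) ≤ M.kappa * (m * H) := by gcongr
    have h5 : M.kappa * (M.kappa * (m * ‖p.1‖)) ≤ M.kappa * (M.kappa * (m * H)) := by gcongr
    refine ⟨by nlinarith, by nlinarith, by nlinarith, ?_⟩
    rw [div_le_iff₀ hδ]
    nlinarith
  have hflow : ∀ R, R + δ ≤ R₀ →
      CurveHolomorphic (ball x (R + δ)) f ∧ ∀ z ∈ ball x (R + δ), ‖f z‖ ≤ m := fun R hR =>
    ⟨hf.mono (ball_subset_ball hR), fun z hz => hb z (ball_subset_ball hR hz)⟩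
  have hle : ∀ n : ℕ, m * (2 - 2 * (1 / 2) ^ n) ≤ 2 * m := fun n => by
    have : (0 : ℝ) ≤ (1 / 2) ^ n := by positivity
    nlinarith
  induction n with
  | zero =>
    refine ⟨fun R _ => ⟨CurveHolomorphic.const 0, fun p _ => by simp [imdeIter]⟩,
      fun R hR p hp => ?_⟩
    obtain ⟨hf', hb'⟩ := hflow R (by simpa using hR)
    have := norm_flowIncrement_le hf' hb' hδ hm (hsmall p hp.1).1 hp
    have e : M.imdeIter f 0 p.1 = 0 := rfl
    simpa [e, increment_zero] using this
  | succ n ih =>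
    obtain ⟨ihA, ihB⟩ := ih
    push_cast
    have hA : ∀ R, R + (n + 1) * δ ≤ R₀ →
      CurveHolomorphic (ball (0 : ℂ) H ×ˢ ball x R) (fun p => M.imdeIter f (n + 1) p.1 p.2) ∧
      ∀ p ∈ ball (0 : ℂ) H ×ˢ ball x R,
        ‖M.imdeIter f (n + 1) p.1 p.2‖ ≤ m * (2 - 2 * (1 / 2) ^ (n + 1)) := by
      intro R hR
      obtain ⟨hc0, hb0⟩ := ihA R (by linarith)
      obtain ⟨hc1, hb1⟩ := ihA (R + δ) (by linarith)
      have hnδ : 0 ≤ n * δ := by positivity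
      obtain ⟨hf', hb'⟩ := hflow R (by linarith)
      constructor
      · intro V c hV hc hmap
        -- The smallness conditions are derived from a point with `‖p.1‖ < H`; a nonempty `V`
        -- supplies one.
        rcases V.eq_empty_or_nonempty with rfl | ⟨z, hz⟩
        · exact differentiableOn_empty
        have hs := hsmall (c z) (hmap hz).1
        exact (hc0.add ((curveHolomorphic_flowIncrement hf' hb' hδ hm hs.1).sub
          (M.curveHolomorphic_increment (by linarith) hδ hc1
            (fun p hp => (hb1 p hp).trans (hle n)) hs.2.1))) hV hc hmap
      · intro p hp
        refine (norm_add_le_of_le (hb0 p hp) (ihB R hR p hp)).trans ?_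
        have h1 := (hsmall p hp.1).2.2.2
        have h2 : (24 * M.kappa ^ 2 * m * ‖p.1‖ / δ) ^ n ≤ (1 / 2) ^ n := by gcongr
        have h3 := mul_le_mul_of_nonneg_left h2 hm
        rw [pow_succ (1 / 2 : ℝ)]
        nlinarith
    refine ⟨hA, fun R hR p hp => ?_⟩
    obtain ⟨hc0, hb0⟩ := ihA (R + δ) (by linarith)
    obtain ⟨hc1, hb1⟩ := hA (R + δ) (by linarith)
    have hsub : ball p.2 δ ⊆ ball x (R + δ) := fun z hz => mem_ball_of_mem hp.2 hz
    have hs := hsmall p hp.1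
    have key := M.norm_increment_sub_sub_le hM (m := 2 * m) (h := p.1)
      (ε := m * (24 * M.kappa ^ 2 * m * ‖p.1‖ / δ) ^ n) hδ
      ((curveHolomorphic_section hc1 hp.1).mono hsub) ((curveHolomorphic_section hc0 hp.1).mono hsub)
      (fun z hz => (hb1 (p.1, z) ⟨hp.1, hsub hz⟩).trans (hle _))
      (fun z hz => (hb0 (p.1, z) ⟨hp.1, hsub hz⟩).trans (hle _)) (fun z hz => ?_) hs.2.2.1
    · rw [← norm_neg] at key
      have e : flowIncrement f p.1 p.2 - M.increment p.1 (M.imdeIter f (n + 1) p.1) p.2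
          = -(M.increment p.1 (M.imdeIter f (n + 1) p.1) p.2
            - M.increment p.1 (M.imdeIter f n p.1) p.2
            - (M.imdeIter f (n + 1) p.1 p.2 - M.imdeIter f n p.1 p.2)) := by
        rw [show M.imdeIter f (n + 1) p.1 p.2 = M.imdeIter f n p.1 p.2 + (flowIncrement f p.1 p.2
          - M.increment p.1 (M.imdeIter f n p.1) p.2) from rfl]
        abel
      rw [e]
      refine key.trans_eq ?_
      rw [pow_succ]; ring
    · have := ihB (R + δ) (by linarith) (p.1, z) ⟨hp.1, hsub hz⟩
      simpa [imdeIter] using this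

end RungeKutta

/-! ### Consequences of the order condition -/

theorem pow_isBigO_pow {a b : ℕ} (hab : b ≤ a) :
    (fun t : ℝ => t ^ a) =O[𝓝[>] 0] fun t : ℝ => t ^ b := by
  refine IsBigO.of_bound 1 ?_
  filter_upwards [Ioo_mem_nhdsGT (zero_lt_one' ℝ)] with t ht
  rw [one_mul, norm_pow, norm_pow, Real.norm_eq_abs, abs_of_pos ht.1]
  exact pow_le_pow_of_le_one ht.1.le ht.2.le hab

namespace RungeKutta

variable {s : ℕ}

/-- Tested on the constant field `1` in dimension one, the local error is exactly `h * (∑ b_i - 1)`,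
which can be `O(h^2)` only if it vanishes. -/
theorem HasOrder.sum_b_eq_one {M : RungeKutta s} {p : ℕ} (hp : 1 ≤ p) (hM : M.HasOrder p) :
    ∑ i, M.b i = 1 := by
  let f : (Fin 1 → ℝ) → (Fin 1 → ℝ) := fun _ _ => 1
  have hnorm : ∀ z : Fin 1 → ℝ, ‖f z‖ ≤ 1 := fun z =>
    (pi_norm_le_iff_of_nonneg zero_le_one).2 fun _ => by simp [f]
  have h1 := hM 1 f contDiff_const 0
  have h2 : ∀ h : ℝ, 0 ≤ h → (M.step h f 0 - flow f h 0) 0 = h * (∑ i, M.b i - 1) := by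
    intro h hh
    have H : M.ContractsNear h f 0 (3 * (M.kappa * 1 * ‖h‖) + 1) 1 0 :=
      ⟨zero_le_one, fun z _ => hnorm z, by simp [f], le_rfl, by simp, by linarith⟩
    have hflow : flow f h 0 = fun _ => h := by
      refine flow_eq (L := 0) (γ := fun t _ => t) (m := 1) (δ := h + 1) zero_le_one (by linarith) hh
        (fun z _ => hnorm z) (by simp [f]) rfl fun t _ => ?_
      exact hasDerivWithinAt_pi.2 fun _ => hasDerivWithinAt_id t _
    have hs : ∀ i, M.slopes h f 0 i = fun _ => 1 := fun i => (congrFun H.stageMap_slopes i).symm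
    rw [H.step_eq, hflow]
    simp only [increment, hs, Pi.sub_apply, Pi.add_apply, Pi.smul_apply, Finset.sum_apply,
      smul_eq_mul, mul_one, Pi.zero_apply]
    ring
  have h3 : (fun t : ℝ => ∑ k ∈ Finset.range 2, t ^ k •
      (fun k : ℕ => if k = 0 then 0 else ∑ i, M.b i - 1) k) =O[𝓝[>] 0] fun t : ℝ => t ^ 2 := by
    refine IsBigO.trans ?_ (h1.trans (pow_isBigO_pow (by omega)))
    refine IsBigO.of_bound 1 ?_
    filter_upwards [self_mem_nhdsWithin] with t ht
    rw [one_mul]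
    refine le_trans (le_of_eq ?_) (norm_le_pi_norm _ 0)
    rw [h2 t (le_of_lt ht)]
    simp [Finset.sum_range_succ]
  have h4 := eq_zero_of_sum_pow_smul_isBigO h3 1 (by norm_num)
  simp only [one_ne_zero, if_false] at h4
  linarith

section Transport

variable {V W : Type*} [NormedAddCommGroup V] [NormedSpace ℝ V] [NormedAddCommGroup W]
  [NormedSpace ℝ W] [CompleteSpace V] [CompleteSpace W]

theorem eventually_contractsNear (M : RungeKutta s) {𝕜 : Type*} [RCLike 𝕜] [NormedSpace 𝕜 V]
    {g : V → V} {y : V} {δ m L : ℝ} (hδ : 0 < δ)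
    (hb : ∀ z ∈ ball y δ, ‖g z‖ ≤ m) (hL : 0 ≤ L)
    (hlip : ∀ z ∈ ball y δ, ∀ w ∈ ball y δ, ‖g z - g w‖ ≤ L * ‖z - w‖) :
    ∀ᶠ h : 𝕜 in 𝓝 0, M.ContractsNear h g y δ m L := by
  have h1 : Tendsto (fun h : 𝕜 => M.kappa * L * ‖h‖) (𝓝 0) (𝓝 (M.kappa * L * ‖(0 : 𝕜)‖)) :=
    Continuous.tendsto (by fun_prop) 0
  have h2 : Tendsto (fun h : 𝕜 => 3 * (M.kappa * m * ‖h‖)) (𝓝 0)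
      (𝓝 (3 * (M.kappa * m * ‖(0 : 𝕜)‖))) := Continuous.tendsto (by fun_prop) 0
  rw [norm_zero, mul_zero] at h1
  rw [norm_zero, mul_zero, mul_zero] at h2
  filter_upwards [h1.eventually (gt_mem_nhds (by norm_num : (0 : ℝ) < 1 / 2)),
    h2.eventually (gt_mem_nhds hδ)] with h h3 h4
  exact ⟨(norm_nonneg _).trans (hb y (mem_ball_self hδ)), hb, hlip, hL, h3.le, h4⟩

/-- Fields that are conjugate near a point by a linear map have conjugate numerical one-step maps
and flows there, for small step sizes. -/
theorem eventually_conj (M : RungeKutta s) (e : V ≃L[ℝ] W) {f : V → V} {g : W → W} {y : V}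
    {δ m L δ' m' L' : ℝ} (hδ : 0 < δ)
    (hb : ∀ z ∈ ball y δ, ‖f z‖ ≤ m) (hL : 0 ≤ L)
    (hlip : ∀ z ∈ ball y δ, ∀ w ∈ ball y δ, ‖f z - f w‖ ≤ L * ‖z - w‖) (hδ' : 0 < δ')
    (hb' : ∀ z ∈ ball (e y) δ', ‖g z‖ ≤ m') (hL' : 0 ≤ L')
    (hlip' : ∀ z ∈ ball (e y) δ', ∀ w ∈ ball (e y) δ', ‖g z - g w‖ ≤ L' * ‖z - w‖)
    (hfg : ∀ z ∈ ball y δ, g (e z) = e (f z)) {γ : ℝ → V} {T₀ : ℝ} (hT₀ : 0 < T₀) (hγ0 : γ 0 = y)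
    (hγ : ∀ T < T₀, IsIntegralCurveOn γ (fun _ => f) (Icc 0 T)) :
    ∀ᶠ h : ℝ in 𝓝[>] 0, e (M.step h f y - flow f h y) = M.step h g (e y) - flow g h (e y) := by
  have hm : 0 ≤ m := (norm_nonneg _).trans (hb y (mem_ball_self hδ))
  have hm' : 0 ≤ m' := (norm_nonneg _).trans (hb' _ (mem_ball_self hδ'))
  have lim : ∀ c d : ℝ, 0 < d → ∀ᶠ h : ℝ in 𝓝[>] 0, c * h < d := fun c d hd => by
    have h1 : Tendsto (fun h : ℝ => c * h) (𝓝 0) (𝓝 (c * 0)) := Continuous.tendsto (by fun_prop) 0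
    rw [mul_zero] at h1
    exact (h1.mono_left nhdsWithin_le_nhds).eventually (gt_mem_nhds hd)
  filter_upwards [nhdsWithin_le_nhds (M.eventually_contractsNear (𝕜 := ℝ) hδ hb hL hlip),
    nhdsWithin_le_nhds (M.eventually_contractsNear (𝕜 := ℝ) hδ' hb' hL' hlip'),
    self_mem_nhdsWithin, lim m δ hδ, lim m' δ' hδ', lim 1 T₀ hT₀,
    lim (‖(e : V →L[ℝ] W)‖ * (M.kappa * m)) δ' hδ'] with h H H' hh hmh hmh' hT he
  have hh0 : 0 < h := hh
  rw [one_mul] at hT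
  have harg : ∀ i, e (y + h • ∑ j, M.a i j • M.slopes h f y j)
      = e y + h • ∑ j, M.a i j • e (M.slopes h f y j) := fun i => by
    simp only [map_add, map_smul, map_sum]
  have hslopes : (fun i => e (M.slopes h f y i)) = M.slopes h g (e y) := by
    refine H'.eq_slopes (funext fun i => ?_) fun i => ?_
    · have h1 := hfg _ (H.stage_arg_mem H.norm_slopes_le i)
      rw [harg] at h1
      have h2 := congrFun H.stageMap_slopes i
      simp only [stageMap] at h2 ⊢
      rw [h1, h2]
    · rw [← harg, mem_ball, dist_eq_norm, ← map_sub, add_sub_cancel_left]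
      refine lt_of_le_of_lt ((e : V →L[ℝ] W).le_opNorm _) (lt_of_le_of_lt ?_ he)
      rw [norm_smul, Real.norm_eq_abs, abs_of_pos hh0]
      have := norm_sum_smul_le (M.sum_abs_a_le i) hm H.norm_slopes_le
      calc ‖(e : V →L[ℝ] W)‖ * (h * ‖∑ j, M.a i j • M.slopes h f y j‖)
          ≤ ‖(e : V →L[ℝ] W)‖ * (h * (M.kappa * m)) := by gcongr
        _ = ‖(e : V →L[ℝ] W)‖ * (M.kappa * m) * h := by ring
  have hinc : e (M.increment h f y) = M.increment h g (e y) := by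
    simp only [increment, map_sum, map_smul, ← hslopes]
  have hcurve := hγ h hT
  rw [H.step_eq, H'.step_eq, flow_eq hm hmh hh0.le hb hlip hγ0 hcurve,
    flow_eq (γ := fun t => e (γ t)) hm' hmh' hh0.le hb' hlip' (by rw [hγ0]) ?_, map_sub, map_add,
    map_smul, hinc]
  intro t ht
  have hmem := norm_integralCurve_sub_lt hm hmh hh0.le hb hγ0 hcurve ht
  simp only [hfg _ hmem]
  exact (e : V →L[ℝ] W).hasFDerivAt.comp_hasDerivWithinAt t (hcurve t ht)

end Transport

/-- The order condition holds for complex analytic fields that are defined only locally. -/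
theorem HasOrder.isBigO_of_analyticOnNhd {M : RungeKutta s} {p : ℕ} (hM : M.HasOrder p) {N : ℕ}
    {f : (Fin N → ℂ) → (Fin N → ℂ)} {y : Fin N → ℂ} {δ m : ℝ} (hδ : 0 < δ)
    (hf : AnalyticOnNhd ℂ f (ball y δ)) (hb : ∀ z ∈ ball y δ, ‖f z‖ ≤ m) :
    (fun h : ℝ => M.step h f y - flow f h y) =O[𝓝[>] 0] fun h : ℝ => h ^ (p + 1) := by
  have hm : 0 ≤ m := (norm_nonneg _).trans (hb y (mem_ball_self hδ))
  have hfc : CurveHolomorphic (ball y δ) f := .of_differentiableOn hf.differentiableOn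
  let e : (Fin N → ℂ) ≃L[ℝ] (Fin (Module.finrank ℝ (Fin N → ℂ)) → ℝ) :=
    ContinuousLinearEquiv.ofFinrankEq (by simp)
  let χ : ContDiffBump y := ⟨δ / 4, δ / 2, by linarith, by linarith⟩
  have hloc : ContDiff ℝ ∞ fun z => χ z • f z := by
    rw [contDiff_iff_contDiffAt]
    intro z
    by_cases hz : z ∈ ball y δ
    · exact χ.contDiff.contDiffAt.smul (((hf z hz).contDiffAt (n := ∞)).restrict_scalars ℝ)
    · have hzs : z ∉ tsupport χ := by
        rw [χ.tsupport_eq]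
        intro h
        exact hz (lt_of_le_of_lt (mem_closedBall.1 h) (by change δ / 2 < δ; linarith))
      refine (contDiffAt_const (c := (0 : Fin N → ℂ))).congr_of_eventuallyEq ?_
      filter_upwards [notMem_tsupport_iff_eventuallyEq.1 hzs] with w hw
      rw [hw, Pi.zero_apply, zero_smul]
  let g : (Fin (Module.finrank ℝ (Fin N → ℂ)) → ℝ) → (Fin (Module.finrank ℝ (Fin N → ℂ)) → ℝ) :=
    fun w => e (χ (e.symm w) • f (e.symm w))
  have hg : ContDiff ℝ ∞ g := e.contDiff.comp (hloc.comp e.symm.contDiff)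
  obtain ⟨K, t, ht, hK⟩ := (hg.contDiffAt (x := e y)).of_le (m := 1)
    (by exact_mod_cast le_top) |>.exists_lipschitzOnWith
  obtain ⟨δ', hδ', hball⟩ := Metric.mem_nhds_iff.1 ht
  have hsub : ball y (δ / 4) ⊆ ball y (δ / 2) := ball_subset_ball (by linarith)
  have hsub' : ball y (δ / 2) ⊆ ball y δ := ball_subset_ball (by linarith)
  have hlip := hfc.lipschitz_half hδ hb
  have hfx : CurveHolomorphic (ball y (δ / 2 + δ / 2)) f := by rwa [add_halves]
  have hbx : ∀ z ∈ ball y (δ / 2 + δ / 2), ‖f z‖ ≤ m := by rwa [add_halves]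
  have hT₀ : 0 < δ / 2 / (8 * (m + 1)) := by positivity
  have h8 : 8 * m * (δ / 2 / (8 * (m + 1))) ≤ δ / 2 := by
    rw [mul_div_assoc', div_le_iff₀ (by positivity)]
    nlinarith
  have key := M.eventually_conj e (f := f) (g := g) (y := y) (δ := δ / 4) (m := m)
    (L := 4 * m / δ) (δ' := δ') (m' := ‖g (e y)‖ + K * δ') (L' := K)
    (γ := fun t : ℝ => y + t • flowIncrement f (t : ℂ) y) (T₀ := δ / 2 / (8 * (m + 1)))
    (by positivity) (fun z hz => hb z (hsub' (hsub hz))) (by positivity)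
    (fun z hz w hw => hlip z (hsub hz) w (hsub hw)) hδ' ?_ K.2 ?_ ?_ hT₀ (by simp)
    (fun T hT => isIntegralCurveOn_flowIncrement hfx hbx (by positivity) hm h8
      (mem_ball_self (by positivity)) hT)
  · have h1 := hM _ g hg (e y)
    have h2 := ((e.symm : _ →L[ℝ] (Fin N → ℂ)).isBigO_comp
      (fun h : ℝ => M.step h g (e y) - flow g h (e y)) (𝓝[>] 0)).trans h1
    refine h2.congr' ?_ EventuallyEq.rfl
    filter_upwards [key] with h hh
    rw [← hh]
    simp
  · intro z hz
    have h1 := hK.dist_le_mul z (hball hz) (e y) (hball (mem_ball_self hδ'))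
    rw [dist_eq_norm] at h1
    have h2 : (K : ℝ) * dist z (e y) ≤ K * δ' :=
      mul_le_mul_of_nonneg_left (mem_ball.1 hz).le K.2
    have := norm_le_norm_sub_add (g z) (g (e y))
    linarith
  · intro z hz w hw
    rw [← dist_eq_norm, ← dist_eq_norm]
    exact hK.dist_le_mul z (hball hz) w (hball hw)
  · intro z hz
    have : χ z = 1 := χ.one_of_mem_closedBall (ball_subset_closedBall hz)
    simp [g, this]

end RungeKutta

/-! ### Analyticity of Taylor coefficients in a parameter -/

section AnalyticCoefficients

variable {E F : Type*} [NormedAddCommGroup E] [NormedSpace ℂ E] [NormedAddCommGroup F]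
  [NormedSpace ℂ F]

theorem taylorCoeff_eq_iteratedDeriv [CompleteSpace F] {v : ℂ → F} (hv : AnalyticAt ℂ v 0) (n : ℕ) :
    taylorCoeff v n = ((n.factorial : ℂ)⁻¹) • iteratedDeriv n v 0 := by
  obtain ⟨p, hp⟩ := hv
  obtain ⟨r, hr⟩ := hp
  have h1 : taylorCoeff v n = p.coeff n := by
    have := (HasFPowerSeriesAt.has_fpower_series_iterate_dslope_fslope n ⟨r, hr⟩).coeff_zero 1
    rw [← FormalMultilinearSeries.coeff, FormalMultilinearSeries.coeff_iterate_fslope,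
      zero_add] at this
    exact this.symm
  have h2 := hr.factorial_smul 1 n
  rw [iteratedDeriv_eq_iteratedFDeriv, ← h2, h1, ← Nat.cast_smul_eq_nsmul ℂ, smul_smul,
    inv_mul_cancel₀ (by exact_mod_cast n.factorial_ne_zero), one_smul]
  rfl

/-- Induction with `u` replaced by its partial derivative in the first variable, which is again
jointly analytic. -/
theorem analyticAt_iteratedDeriv_fst [CompleteSpace F] {u : ℂ × E → F} {y₀ : E}
    (hu : AnalyticAt ℂ u (0, y₀)) (n : ℕ) :
    AnalyticAt ℂ (fun y => iteratedDeriv n (fun h => u (h, y)) 0) y₀ := by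
  have hpair : ∀ y : E, AnalyticAt ℂ (fun y : E => ((0 : ℂ), y)) y := fun y => by fun_prop
  induction n generalizing u with
  | zero =>
    simp only [iteratedDeriv_zero]
    exact hu.comp (hpair y₀)
  | succ n ih =>
    have hu' : AnalyticAt ℂ (fun p => fderiv ℂ u p (1, 0)) (0, y₀) :=
      (ContinuousLinearMap.apply ℂ F ((1 : ℂ), (0 : E))).analyticAt _ |>.comp hu.fderiv
    refine (ih hu').congr ?_
    have h1 := (hpair y₀).continuousAt.eventually hu.eventually_analyticAt
    filter_upwards [h1] with y hy
    rw [iteratedDeriv_succ']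
    refine EventuallyEq.iteratedDeriv_eq n ?_
    have hc : ContinuousAt (fun h : ℂ => (h, y)) 0 := by fun_prop
    filter_upwards [hc.eventually hy.eventually_analyticAt] with h hh
    have hline : HasDerivAt (fun h : ℂ => (h, y)) ((1 : ℂ), (0 : E)) h :=
      (hasDerivAt_id h).prodMk (hasDerivAt_const h y)
    exact (hh.differentiableAt.hasFDerivAt.comp_hasDerivAt h hline).deriv.symm

theorem analyticAt_taylorCoeff_fst [CompleteSpace F] {u : ℂ × E → F} {y₀ : E}
    (hu : AnalyticAt ℂ u (0, y₀)) (n : ℕ) :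
    AnalyticAt ℂ (fun y => taylorCoeff (fun h => u (h, y)) n) y₀ := by
  have hc : ContinuousAt (fun y : E => ((0 : ℂ), y)) y₀ := by fun_prop
  refine ((analyticAt_iteratedDeriv_fst hu n).const_smul (c := ((n.factorial : ℂ)⁻¹))).congr ?_
  filter_upwards [hc.eventually hu.eventually_analyticAt] with y hy
  have hline : AnalyticAt ℂ (fun h : ℂ => (h, y)) 0 := by fun_prop
  exact (taylorCoeff_eq_iteratedDeriv (v := fun h => u (h, y)) 
    (AnalyticAt.comp (x := (0 : ℂ)) (f := fun h : ℂ => (h, y)) hy hline) n).symm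

end AnalyticCoefficients

/-! ### Taylor coefficients of the flow as Lie derivatives -/

section Lie

variable {E : Type*} [NormedAddCommGroup E] [NormedSpace ℂ E] [NormedSpace ℝ E]
  [IsScalarTower ℝ ℂ E] [CompleteSpace E]

/-- The iterated Lie derivatives along `f` of the identity map. -/
noncomputable def lieIterate (f : E → E) : ℕ → E → E
  | 0 => id
  | n + 1 => fun z => fderiv ℂ (lieIterate f n) z (f z)

theorem analyticOnNhd_lieIterate {f : E → E} {U : Set E} (hf : AnalyticOnNhd ℂ f U) (n : ℕ) :
    AnalyticOnNhd ℂ (lieIterate f n) U := by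
  induction n with
  | zero => exact fun z _ => analyticAt_id
  | succ n ih =>
    intro z hz
    exact ((ContinuousLinearMap.id ℂ (E →L[ℂ] E)).analyticAt_bilinear _).comp
      (AnalyticAt.prod (ih z hz).fderiv (hf z hz))

variable {f : E → E} {x : E} {R δ m H : ℝ}

theorem differentiableOn_flowIncrement (hf : AnalyticOnNhd ℂ f (ball x (R + δ)))
    (hb : ∀ z ∈ ball x (R + δ), ‖f z‖ ≤ m)
    (hδ : 0 < δ) (hm : 0 ≤ m) (hH : 8 * m * H ≤ δ) {y : E} (hy : y ∈ ball x R) :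
    DifferentiableOn ℂ (fun h : ℂ => flowIncrement f h y) (ball 0 H) :=
  (curveHolomorphic_flowIncrement (.of_differentiableOn hf.differentiableOn) hb hδ hm hH)
    isOpen_ball (c := fun h => (h, y)) (by fun_prop) fun _ hh => ⟨hh, hy⟩

/-- The differential equation is known for real times; the identity theorem extends it to complex
times near `0`. -/
theorem deriv_flow_eventuallyEq (hf : AnalyticOnNhd ℂ f (ball x (R + δ)))
    (hb : ∀ z ∈ ball x (R + δ), ‖f z‖ ≤ m)
    (hδ : 0 < δ) (hm : 0 ≤ m) (hH0 : 0 < H) (hH : 8 * m * H ≤ δ) {y : E} (hy : y ∈ ball x R) :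
    ∀ᶠ h : ℂ in 𝓝 0, HasDerivAt (fun h : ℂ => y + h • flowIncrement f h y)
      (f (y + h • flowIncrement f h y)) h := by
  set U : ℂ → E := fun h => y + h • flowIncrement f h y
  have hψ := differentiableOn_flowIncrement hf hb hδ hm hH hy
  have hUd : DifferentiableOn ℂ U (ball 0 H) := (differentiableOn_id.smul hψ).const_add y
  have hU : AnalyticAt ℂ U 0 := hUd.analyticAt (ball_mem_nhds _ hH0)
  have hU0 : U 0 = y := by simp [U]
  have hyR : y ∈ ball x (R + δ) := ball_subset_ball (by linarith) hy
  have hfU : AnalyticAt ℂ (fun h => f (U h)) 0 := by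
    refine AnalyticAt.comp ?_ hU
    rw [hU0]
    exact hf y hyR
  have hreal : ∀ t : ℝ, 0 < t → t < H → deriv U t = f (U t) := by
    intro t ht0 ht
    have h1 : HasDerivAt U (deriv U t) (t : ℂ) :=
      (hUd.differentiableAt (isOpen_ball.mem_nhds (by
        simpa [abs_of_pos ht0] using ht))).hasDerivAt
    have h2 : HasDerivAt (fun t : ℝ => y + t • flowIncrement f (t : ℂ) y) (deriv U t) t := by
      have h3 := h1.scomp t (Complex.ofRealCLM.hasDerivAt (x := t))
      simp only [Complex.ofRealCLM_apply, Complex.ofReal_one, one_smul] at h3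
      refine h3.congr_of_eventuallyEq (Eventually.of_forall fun r => ?_)
      simp only [Function.comp_apply, U]
      rw [← algebraMap_smul ℂ r (flowIncrement f (r : ℂ) y), Complex.coe_algebraMap]
    have h4 := hasDerivAt_flowIncrement (.of_differentiableOn hf.differentiableOn) hb hδ hm hH hy
      (t := t) (by rwa [abs_of_pos ht0])
    rw [h2.unique h4]
    simp only [U]
    rw [← algebraMap_smul ℂ t (flowIncrement f (t : ℂ) y), Complex.coe_algebraMap]
  have hfreq : ∃ᶠ h in 𝓝[≠] (0 : ℂ), deriv U h = f (U h) := by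
    have htend : Tendsto (fun t : ℝ => (t : ℂ)) (𝓝[>] 0) (𝓝[≠] 0) := by
      refine tendsto_nhdsWithin_iff.2 ⟨?_, ?_⟩
      · have := Complex.continuous_ofReal.tendsto 0
        rw [Complex.ofReal_zero] at this
        exact this.mono_left nhdsWithin_le_nhds
      · filter_upwards [self_mem_nhdsWithin] with t ht
        simpa using (ne_of_gt ht : t ≠ 0)
    refine htend.frequently (Eventually.frequently ?_)
    filter_upwards [Ioo_mem_nhdsGT hH0] with t ht using hreal t ht.1 ht.2
  have heq := (hU.deriv.frequently_eq_iff_eventually_eq hfU).1 hfreq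
  filter_upwards [heq, ball_mem_nhds (0 : ℂ) hH0] with h hh hhb
  rw [← hh]
  exact (hUd.differentiableAt (isOpen_ball.mem_nhds hhb)).hasDerivAt

/-- Differentiating along the flow applies the Lie derivative, and dividing by `h` shifts the index
by one. The formula shows that the coefficients are analytic in `y`, beyond holomorphy along curves.
-/
theorem taylorCoeff_flowIncrement (hf : AnalyticOnNhd ℂ f (ball x (R + δ)))
    (hb : ∀ z ∈ ball x (R + δ), ‖f z‖ ≤ m)
    (hδ : 0 < δ) (hm : 0 ≤ m) (hH0 : 0 < H) (hH : 8 * m * H ≤ δ) {y : E} (hy : y ∈ ball x R)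
    (n : ℕ) :
    taylorCoeff (fun h => flowIncrement f h y) n
      = (((n + 1).factorial : ℂ)⁻¹) • lieIterate f (n + 1) y := by
  set U : ℂ → E := fun h => y + h • flowIncrement f h y
  have hψ := differentiableOn_flowIncrement hf hb hδ hm hH hy
  have hUd : DifferentiableOn ℂ U (ball 0 H) := (differentiableOn_id.smul hψ).const_add y
  have hU : AnalyticAt ℂ U 0 := hUd.analyticAt (ball_mem_nhds _ hH0)
  have hU0 : U 0 = y := by simp [U]
  have hyR : y ∈ ball x (R + δ) := ball_subset_ball (by linarith) hy
  have hslope : dslope U 0 = fun h => flowIncrement f h y := by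
    funext h
    rcases eq_or_ne h 0 with rfl | hh
    · rw [dslope_same]
      have h1 := (hψ.differentiableAt (ball_mem_nhds _ hH0)).hasDerivAt
      have h2 : HasDerivAt U _ 0 := ((hasDerivAt_id' (0 : ℂ)).smul h1).const_add y
      rw [h2.deriv]
      simp
    · rw [dslope_of_ne _ hh, slope_def_module, hU0]
      simp [U, smul_smul, hh]
  have h1 : taylorCoeff (fun h => flowIncrement f h y) n = taylorCoeff U (n + 1) := by
    unfold taylorCoeff taylorQuotient
    rw [Function.iterate_succ_apply, hslope]
  rw [h1, taylorCoeff_eq_iteratedDeriv hU]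
  congr 1
  have hmem : ∀ᶠ h in 𝓝 (0 : ℂ), U h ∈ ball x (R + δ) :=
    hU.continuousAt.eventually (isOpen_ball.mem_nhds (by rwa [hU0]))
  have hode := deriv_flow_eventuallyEq hf hb hδ hm hH0 hH hy
  have hiter : ∀ k, iteratedDeriv k U =ᶠ[𝓝 0] fun h => lieIterate f k (U h) := by
    intro k
    induction k with
    | zero => exact Eventually.of_forall fun h => by simp [lieIterate]
    | succ k ih =>
      filter_upwards [ih.eventuallyEq_nhds, hode, hmem] with h h1 h2 h3
      rw [iteratedDeriv_succ, h1.deriv_eq]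
      exact (((analyticOnNhd_lieIterate hf k _ h3).differentiableAt.hasFDerivAt).comp_hasDerivAt
        h h2).deriv
  rw [(hiter (n + 1)).eq_of_nhds, hU0]

end Lie

/-! ### Joint analyticity of the increment -/

namespace RungeKutta

variable {E : Type*} [NormedAddCommGroup E] [NormedSpace ℂ E] [NormedSpace ℝ E]
  [IsScalarTower ℝ ℂ E] [CompleteSpace E] {s : ℕ}

theorem analyticAt_stageArg (M : RungeKutta s) (i : Fin s) (q : (ℂ × E) × (Fin s → E)) :
    AnalyticAt ℂ (fun q : (ℂ × E) × (Fin s → E) =>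
      (q.1.1, q.1.2 + q.1.1 • ∑ j, M.a i j • q.2 j)) q := by
  have h1 : (fun q : (ℂ × E) × (Fin s → E) => (q.1.1, q.1.2 + q.1.1 • ∑ j, M.a i j • q.2 j))
      = fun q => (q.1.1, q.1.2 + q.1.1 • ∑ j, (M.a i j : ℂ) • q.2 j) := by
    funext q
    simp only [← Complex.coe_algebraMap, algebraMap_smul]
  rw [h1]
  have h2 : ∀ j, AnalyticAt ℂ (fun q : (ℂ × E) × (Fin s → E) => q.2 j) q := fun j =>
    ((ContinuousLinearMap.proj (R := ℂ) (φ := fun _ : Fin s => E) j).comp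
      (ContinuousLinearMap.snd ℂ (ℂ × E) (Fin s → E))).analyticAt q
  have h3 : AnalyticAt ℂ (fun q : (ℂ × E) × (Fin s → E) => q.1.1) q :=
    ((ContinuousLinearMap.fst ℂ ℂ E).comp
      (ContinuousLinearMap.fst ℂ (ℂ × E) (Fin s → E))).analyticAt q
  have h4 : AnalyticAt ℂ (fun q : (ℂ × E) × (Fin s → E) => q.1.2) q :=
    ((ContinuousLinearMap.snd ℂ ℂ E).comp
      (ContinuousLinearMap.fst ℂ (ℂ × E) (Fin s → E))).analyticAt q
  exact h3.prod (h4.add (h3.smul (Finset.analyticAt_fun_sum _ fun j _ => (h2 j).const_smul)))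

/-- The increment function of a method depends analytically on the step and the initial value. -/
theorem analyticAt_increment (M : RungeKutta s) {P : ℂ × E → E} {y₀ : E}
    (hP : AnalyticAt ℂ P (0, y₀)) :
    AnalyticAt ℂ (fun p : ℂ × E => M.increment p.1 (fun z => P (p.1, z)) p.2) (0, y₀) := by
  obtain ⟨r, hr, hrP⟩ : ∃ r > 0, ∀ p ∈ ball ((0 : ℂ), y₀) r, AnalyticAt ℂ P p ∧
      ‖P p‖ ≤ ‖P (0, y₀)‖ + 1 := by
    have h1 := hP.eventually_analyticAt.and
      (hP.continuousAt.norm.eventually (gt_mem_nhds (lt_add_one ‖P (0, y₀)‖)))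
    obtain ⟨r, hr, h⟩ := Metric.eventually_nhds_iff_ball.1 h1
    exact ⟨r, hr, fun p hp => ⟨(h p hp).1, (h p hp).2.le⟩⟩
  set m : ℝ := ‖P (0, y₀)‖ + 1
  have hm : 0 ≤ m := by positivity
  obtain ⟨H, hH, hHr, hHκ⟩ : ∃ H > 0, H ≤ r ∧ 8 * M.kappa * m * H ≤ r / 2 := by
    have hκ := M.kappa_pos
    refine ⟨min r (r / 2 / (8 * M.kappa * m + 1)), by positivity, min_le_left _ _, ?_⟩
    have h1 : 8 * M.kappa * m * min r (r / 2 / (8 * M.kappa * m + 1))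
        ≤ 8 * M.kappa * m * (r / 2 / (8 * M.kappa * m + 1)) := by
      gcongr; exact min_le_right _ _
    refine h1.trans ?_
    rw [mul_div_assoc', div_le_iff₀ (by positivity)]
    nlinarith
  have hsub : ball (0 : ℂ) H ×ˢ ball y₀ (r / 2 + r / 2) ⊆ ball ((0 : ℂ), y₀) r := by
    rintro ⟨h, z⟩ ⟨h1, h2⟩
    rw [← ball_prod_same]
    exact ⟨ball_subset_ball hHr h1, by rwa [add_halves] at h2⟩
  have hcontr : ∀ p ∈ ball (0 : ℂ) H ×ˢ ball y₀ (r / 2),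
      M.ContractsNear p.1 (fun z => P (p.1, z)) p.2 (r / 2 / 2) m (4 * m / (r / 2)) :=
    fun p hp => M.contractsNear_section (G := fun h z => P (h, z)) (H := H) hm (by positivity)
      (.of_differentiableOn fun q hq => (hrP q (hsub hq)).1.differentiableAt.differentiableWithinAt)
      (fun q hq => (hrP q (hsub hq)).2) hHκ hp
  let k₀ : Fin s → E := fun _ => P (0, y₀)
  let Φ : (ℂ × E) × (Fin s → E) → (Fin s → E) := fun q i =>
    q.2 i - P (q.1.1, q.1.2 + q.1.1 • ∑ j, M.a i j • q.2 j)
  have harg0 : ∀ i, ((((0 : ℂ), y₀), k₀).1.1, (((0 : ℂ), y₀), k₀).1.2 +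
      (((0 : ℂ), y₀), k₀).1.1 • ∑ j, M.a i j • (((0 : ℂ), y₀), k₀).2 j) = ((0 : ℂ), y₀) := by
    intro i; simp
  have hΦ : AnalyticAt ℂ Φ ((0, y₀), k₀) := by
    refine AnalyticAt.pi fun i => ?_
    refine AnalyticAt.sub ?_ ?_
    · exact ((ContinuousLinearMap.proj (R := ℂ) (φ := fun _ : Fin s => E) i).comp
        (ContinuousLinearMap.snd ℂ (ℂ × E) (Fin s → E))).analyticAt _
    · refine AnalyticAt.comp_of_eq hP (M.analyticAt_stageArg i _) (harg0 i)
  have hΦc : ContDiffAt ℂ ω Φ ((0, y₀), k₀) := hΦ.contDiffAt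
  -- At step zero the stages decouple, so the partial derivative in the slopes is the identity and
  -- the implicit function theorem applies.
  have hpartial : fderiv ℂ Φ ((0, y₀), k₀) ∘L .inr ℂ (ℂ × E) (Fin s → E)
      = ContinuousLinearMap.id ℂ (Fin s → E) := by
    have h1 : HasFDerivAt (fun k : Fin s → E => (((0 : ℂ), y₀), k))
        (ContinuousLinearMap.inr ℂ (ℂ × E) (Fin s → E)) k₀ := hasFDerivAt_prodMk_right _ _
    have h2 := hΦ.differentiableAt.hasFDerivAt.comp k₀ h1
    have h3 : HasFDerivAt (Φ ∘ fun k : Fin s → E => (((0 : ℂ), y₀), k))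
        (ContinuousLinearMap.id ℂ (Fin s → E)) k₀ := by
      have : (Φ ∘ fun k : Fin s → E => (((0 : ℂ), y₀), k)) = fun k => k - k₀ := by
        funext k i; simp [Φ, k₀]
      rw [this]
      exact (hasFDerivAt_id k₀).sub_const k₀
    exact h2.unique h3
  have hinv : (fderiv ℂ Φ ((0, y₀), k₀) ∘L .inr ℂ (ℂ × E) (Fin s → E)).IsInvertible := by
    rw [hpartial]
    exact ⟨ContinuousLinearEquiv.refl ℂ _, rfl⟩
  have hω : (ω : WithTop ℕ∞) ≠ 0 := by simp
  set κ := hΦc.implicitFunction hω hinv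
  have hκ0 : κ (0, y₀) = k₀ := hΦc.implicitFunction_apply_self hω hinv
  have hκ : AnalyticAt ℂ κ (0, y₀) := (hΦc.contDiffAt_implicitFunction hω hinv).analyticAt
  have hκsol : ∀ᶠ p in 𝓝 ((0 : ℂ), y₀), Φ (p, κ p) = 0 := by
    have := hΦc.eventually_apply_implicitFunction hω hinv
    have h0 : Φ ((0, y₀), k₀) = 0 := by funext i; simp [Φ, k₀]
    rwa [h0] at this
  have hargs : ∀ i, ∀ᶠ p in 𝓝 ((0 : ℂ), y₀),
      p.2 + p.1 • ∑ j, M.a i j • κ p j ∈ ball p.2 (r / 2 / 2) := by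
    intro i
    have hc : ContinuousAt (fun p : ℂ × E => dist (p.2 + p.1 • ∑ j, M.a i j • κ p j) p.2)
        (0, y₀) := by
      have h1 := hκ.continuousAt
      have h2 : ∀ j, ContinuousAt (fun p => κ p j) ((0 : ℂ), y₀) := fun j =>
        (continuous_apply j).continuousAt.comp h1
      fun_prop
    exact hc.eventually (gt_mem_nhds (by simp; positivity))
  have hdom : ∀ᶠ p in 𝓝 ((0 : ℂ), y₀), p ∈ ball (0 : ℂ) H ×ˢ ball y₀ (r / 2) :=
    (isOpen_ball_prod_ball H y₀ (r / 2)).mem_nhds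
      ⟨mem_ball_self hH, mem_ball_self (by positivity)⟩
  have hres : AnalyticAt ℂ (fun p => ∑ i, (M.b i : ℂ) • κ p i) (0, y₀) := by
    have h2 : ∀ j, AnalyticAt ℂ (fun p => κ p j) ((0 : ℂ), y₀) := fun j =>
      ((ContinuousLinearMap.proj (R := ℂ) (φ := fun _ : Fin s => E) j).analyticAt _).comp hκ
    fun_prop
  refine hres.congr ?_
  filter_upwards [hκsol, eventually_all.2 hargs, hdom] with p h1 h2 h3
  -- The implicit function keeps its stage arguments near the base point, so uniqueness identifies
  -- it with the limit of the fixed point iteration.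
  have hsl : κ p = M.slopes p.1 (fun z => P (p.1, z)) p.2 := by
    refine (hcontr p h3).eq_slopes (funext fun i => ?_) h2
    have := congrFun h1 i
    simp only [Φ, Pi.zero_apply, sub_eq_zero] at this
    exact this.symm
  simp only [increment, ← hsl, ← Complex.coe_algebraMap, algebraMap_smul]

end RungeKutta

/-! ### Uniqueness of expansions -/

section Uniqueness

variable {E : Type*} [NormedAddCommGroup E] [NormedSpace ℂ E] [NormedSpace ℝ E]
  [IsScalarTower ℝ ℂ E]

theorem ofReal_smul_eq (t : ℝ) (v : E) : (t : ℂ) • v = t • v := by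
  rw [← algebraMap_smul ℂ t v, Complex.coe_algebraMap]

theorem ofReal_pow_smul_eq (t : ℝ) (k : ℕ) (v : E) : (t : ℂ) ^ k • v = t ^ k • v := by
  rw [← Complex.ofReal_pow, ofReal_smul_eq]

variable [CompleteSpace E]

theorem taylorCoeff_eq_of_norm_sub_le {v : ℂ → E} {H C C' : ℝ} (hH : 0 < H)
    (hv : DifferentiableOn ℂ v (ball 0 H)) (hC : ∀ z ∈ ball (0 : ℂ) H, ‖v z‖ ≤ C) {n : ℕ}
    {a : ℕ → E}
    (ha : ∀ h ∈ ball (0 : ℂ) H, ‖v h - ∑ k ∈ Finset.range n, h ^ k • a k‖ ≤ C' * ‖h‖ ^ n) :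
    ∀ k < n, taylorCoeff v k = a k := by
  have key : (fun t : ℝ => ∑ k ∈ Finset.range n, t ^ k • (taylorCoeff v k - a k)) =O[𝓝[>] 0]
      fun t : ℝ => t ^ n := by
    refine IsBigO.of_bound (C * (2 / H) ^ n + C') ?_
    filter_upwards [Ioo_mem_nhdsGT hH] with t ht
    have hmem : (t : ℂ) ∈ ball (0 : ℂ) H := by simpa [abs_of_pos ht.1] using ht.2
    have h1 := norm_sub_sum_taylorCoeff_le hH hv hC n hmem
    have h2 := ha t hmem
    have e : ∑ k ∈ Finset.range n, t ^ k • (taylorCoeff v k - a k)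
        = (v t - ∑ k ∈ Finset.range n, (t : ℂ) ^ k • a k)
          - (v t - ∑ k ∈ Finset.range n, (t : ℂ) ^ k • taylorCoeff v k) := by
      simp only [smul_sub, Finset.sum_sub_distrib, ofReal_pow_smul_eq]
      abel
    rw [e]
    refine (norm_sub_le_of_le h2 h1).trans_eq ?_
    rw [norm_pow, Complex.norm_real,
      show 2 * ‖t‖ / H = ‖t‖ * (2 / H) by ring, mul_pow]
    ring
  intro k hk
  exact sub_eq_zero.1 (eq_zero_of_sum_pow_smul_isBigO key k hk)

end Uniqueness

/-! ### The coefficients of the modified field -/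

namespace RungeKutta

variable {E : Type*} [NormedAddCommGroup E] [NormedSpace ℂ E] [NormedSpace ℝ E]
  [IsScalarTower ℝ ℂ E] [CompleteSpace E] {s : ℕ}

/-- The coefficients of the modified field, as Taylor coefficients of the iterates. -/
noncomputable def imdeTaylor (M : RungeKutta s) (f : E → E) (k : ℕ) (y : E) : E :=
  taylorCoeff (fun h => M.imdeIter f (k + 1) h y) k

theorem exists_pos_mul_le (c : ℝ) {d : ℝ} (hd : 0 < d) : ∃ H > 0, c * H ≤ d := by
  refine ⟨d / (|c| + 1), by positivity, ?_⟩
  rw [mul_div_assoc', div_le_iff₀ (by positivity)]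
  nlinarith [le_abs_self c]

/-- The qualitative, local form of `imdeIter_spec`. The distance of `y` to the boundary is split
into `n + 2` pieces: up to `n + 1` for the iteration and one that remains as the radius around `y`.
-/
theorem exists_imdeIter_bounds (M : RungeKutta s) (hM : ∑ i, M.b i = 1) {f : E → E} {x : E}
    {R₀ m : ℝ} (hf : CurveHolomorphic (ball x R₀) f) (hb : ∀ z ∈ ball x R₀, ‖f z‖ ≤ m)
    (hm : 0 ≤ m) {y : E} (hy : y ∈ ball x R₀) (n : ℕ) :
    ∃ δ > 0, ∃ H > 0, ball y (δ + δ) ⊆ ball x R₀ ∧ 8 * m * H ≤ δ ∧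
      (∀ j ≤ n + 1,
        CurveHolomorphic (ball (0 : ℂ) H ×ˢ ball y δ) (fun p => M.imdeIter f j p.1 p.2) ∧
        ∀ p ∈ ball (0 : ℂ) H ×ˢ ball y δ, ‖M.imdeIter f j p.1 p.2‖ ≤ 2 * m) ∧
      ∀ j ≤ n, ∀ p ∈ ball (0 : ℂ) H ×ˢ ball y δ,
        ‖flowIncrement f p.1 p.2 - M.increment p.1 (M.imdeIter f j p.1) p.2‖
          ≤ m * (24 * M.kappa ^ 2 * m / δ) ^ j * ‖p.1‖ ^ j := by
  obtain ⟨δ, hδ, hδ'⟩ := exists_pos_mul_le (n + 2) (sub_pos.2 (mem_ball.1 hy))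
  obtain ⟨H, hH, hH'⟩ := exists_pos_mul_le (48 * M.kappa ^ 2 * m) hδ
  have hsub : ball y ((n + 2) * δ) ⊆ ball x R₀ := ball_subset_ball' (by linarith)
  have spec := fun j => M.imdeIter_spec hM (hf.mono hsub) (fun z hz => hb z (hsub hz)) hm hδ hH' j
  have hnδ : 0 ≤ n * δ := by positivity
  refine ⟨δ, hδ, H, hH, (ball_subset_ball (by linarith)).trans hsub, ?_, fun j hj => ?_,
    fun j hj p hp => ?_⟩
  · have h1 : 1 ≤ M.kappa ^ 2 := one_le_pow₀ M.one_le_kappa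
    have h2 : m * H ≤ M.kappa ^ 2 * (m * H) := le_mul_of_one_le_left (by positivity) h1
    nlinarith [mul_nonneg hm hH.le]
  · have hjn : (j : ℝ) ≤ n + 1 := by exact_mod_cast hj
    have := (spec j).1 δ (by nlinarith)
    refine ⟨this.1, fun p hp => (this.2 p hp).trans ?_⟩
    have : (0 : ℝ) ≤ (1 / 2) ^ j := by positivity
    nlinarith
  · have hjn : (j : ℝ) ≤ n := by exact_mod_cast hj
    refine ((spec j).2 δ (by nlinarith) p hp).trans_eq ?_
    rw [mul_div_right_comm _ ‖p.1‖, mul_pow, mul_assoc m]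

section Coefficients

variable (M : RungeKutta s) (hM : ∑ i, M.b i = 1) {f : E → E} {x : E} {R₀ m : ℝ}

-- Consecutive iterates differ by a residual of order `h^j`, so the coefficients below `j` no longer
-- change.
include hM in
theorem taylorCoeff_imdeIter (hf : CurveHolomorphic (ball x R₀) f)
    (hb : ∀ z ∈ ball x R₀, ‖f z‖ ≤ m)
    (hm : 0 ≤ m) {y : E} (hy : y ∈ ball x R₀) {k j : ℕ} (hkj : k < j) :
    taylorCoeff (fun h => M.imdeIter f j h y) k = M.imdeTaylor f k y := by
  induction j, hkj using Nat.le_induction with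
  | base => rfl
  | succ j hkj ih =>
    rw [← ih]
    obtain ⟨δ, hδ, H, hH, -, -, hG, hres⟩ := M.exists_imdeIter_bounds hM hf hb hm hy j
    have hyδ : y ∈ ball y δ := mem_ball_self hδ
    have h1 := hG j (by omega)
    have h2 := hG (j + 1) le_rfl
    refine taylorCoeff_eq_of_norm_sub_le hH (differentiableOn_section h2.1 hyδ)
      (fun z hz => h2.2 (z, y) ⟨hz, hyδ⟩) (n := j)
      (a := fun k => taylorCoeff (fun h => M.imdeIter f j h y) k)
      (C' := m * (24 * M.kappa ^ 2 * m / δ) ^ j + 2 * m * (2 / H) ^ j) (fun h hh => ?_) k hkj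
    have h3 := hres j le_rfl (h, y) ⟨hh, hyδ⟩
    have h4 := norm_sub_sum_taylorCoeff_le hH (differentiableOn_section h1.1 hyδ)
      (fun z hz => h1.2 (z, y) ⟨hz, hyδ⟩) j hh
    have e : M.imdeIter f (j + 1) h y - ∑ k ∈ Finset.range j,
          h ^ k • taylorCoeff (fun h => M.imdeIter f j h y) k
        = (flowIncrement f h y - M.increment h (M.imdeIter f j h) y)
          + (M.imdeIter f j h y - ∑ k ∈ Finset.range j,
            h ^ k • taylorCoeff (fun h => M.imdeIter f j h y) k) := by
      rw [show M.imdeIter f (j + 1) h y = M.imdeIter f j h y + (flowIncrement f h y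
          - M.increment h (M.imdeIter f j h) y) from rfl]
      abel
    rw [e]
    refine (norm_add_le_of_le h3 h4).trans_eq ?_
    rw [show 2 * ‖h‖ / H = ‖h‖ * (2 / H) by ring, mul_pow]
    ring

include hM in
theorem norm_imdeIter_sub_le (hf : CurveHolomorphic (ball x R₀) f)
    (hb : ∀ z ∈ ball x R₀, ‖f z‖ ≤ m)
    (hm : 0 ≤ m) {y : E} (hy : y ∈ ball x R₀) {j : ℕ} {H C : ℝ} (hH : 0 < H)
    (hd : DifferentiableOn ℂ (fun h => M.imdeIter f j h y) (ball 0 H))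
    (hC : ∀ h ∈ ball (0 : ℂ) H, ‖M.imdeIter f j h y‖ ≤ C) {h : ℂ} (hh : h ∈ ball (0 : ℂ) H) :
    ‖M.imdeIter f j h y - ∑ k ∈ Finset.range j, h ^ k • M.imdeTaylor f k y‖
      ≤ C * (2 * ‖h‖ / H) ^ j := by
  have := norm_sub_sum_taylorCoeff_le hH hd hC j hh
  have e : ∀ k ∈ Finset.range j, h ^ k • taylorCoeff (fun h => M.imdeIter f j h y) k
      = h ^ k • M.imdeTaylor f k y := fun k hk => by
    rw [M.taylorCoeff_imdeIter hM hf hb hm hy (Finset.mem_range.1 hk)]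
  rwa [Finset.sum_congr rfl e] at this

/-- The expansion that characterizes the coefficients recursively. -/
structure HasDefectExpansion (n : ℕ) (f : E → E) (y : E) (δ H m' C : ℝ) : Prop where
  δ_pos : 0 < δ
  H_pos : 0 < H
  nonneg : 0 ≤ m'
  small : 16 * M.kappa * m' * H ≤ δ
  hol : CurveHolomorphic (ball (0 : ℂ) H ×ˢ ball y δ)
    fun p => ∑ k ∈ Finset.range n, p.1 ^ k • M.imdeTaylor f k p.2
  bound : ∀ p ∈ ball (0 : ℂ) H ×ˢ ball y δ,
    ‖∑ k ∈ Finset.range n, p.1 ^ k • M.imdeTaylor f k p.2‖ ≤ m'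
  expansion : ∀ h ∈ ball (0 : ℂ) H,
    ‖flowIncrement f h y - M.increment h
        (fun z => ∑ k ∈ Finset.range n, h ^ k • M.imdeTaylor f k z) y - h ^ n • M.imdeTaylor f n y‖
      ≤ C * ‖h‖ ^ (n + 1)

-- The partial sum `P` differs from the iterate `g_n` by `O(h^n)`, and the comparison lemma gains
-- one more power of `h`. Passing from `g_n` to `P` therefore changes the increment by `g_n - P` up
-- to `O(h^{n+1})`, while `g_{n+1}` agrees with `P` plus the next term to the same order.
include hM in
theorem exists_hasDefectExpansion (hf : CurveHolomorphic (ball x R₀) f)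
    (hb : ∀ z ∈ ball x R₀, ‖f z‖ ≤ m) (hm : 0 ≤ m) {n : ℕ}
    (hF : ∀ k < n, CurveHolomorphic (ball x R₀) (M.imdeTaylor f k)) {y : E} (hy : y ∈ ball x R₀)
    {d : ℝ} (hd : 0 < d) :
    ∃ δ H m' C, M.HasDefectExpansion n f y δ H m' C ∧ ball y δ ⊆ ball x R₀ ∧ H ≤ d := by
  obtain ⟨δ, hδ, H₁, hH₁, hsub₂, -, hG, hres⟩ := M.exists_imdeIter_bounds hM hf hb hm hy n
  have hsub : ball y δ ⊆ ball x R₀ := (ball_subset_ball (by linarith)).trans hsub₂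
  have hyδ : y ∈ ball y δ := mem_ball_self hδ
  set P : ℂ → E → E := fun h z => ∑ k ∈ Finset.range n, h ^ k • M.imdeTaylor f k z
  have hpow : ∀ k, CurveHolomorphic (ball (0 : ℂ) H₁ ×ˢ ball y δ) fun p : ℂ × E => p.1 ^ k :=
    fun k => .of_differentiableOn (by fun_prop)
  have hP : CurveHolomorphic (ball (0 : ℂ) H₁ ×ˢ ball y δ) fun p => P p.1 p.2 :=
    CurveHolomorphic.sum fun k hk => (hpow k).smul ((hF k (Finset.mem_range.1 hk)).comp
      (.of_differentiableOn differentiableOn_snd) fun p hp => hsub hp.2)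
  have hGP : ∀ p ∈ ball (0 : ℂ) H₁ ×ˢ ball y δ, ‖M.imdeIter f n p.1 p.2 - P p.1 p.2‖
      ≤ 2 * m * (2 * ‖p.1‖ / H₁) ^ n := fun p hp =>
    M.norm_imdeIter_sub_le hM hf hb hm (hsub hp.2) hH₁
      (differentiableOn_section (hG n (by omega)).1 hp.2)
      (fun h hh => (hG n (by omega)).2 (h, p.2) ⟨hh, hp.2⟩) hp.1
  set m' : ℝ := 2 * m + 2 * m * 2 ^ n
  have hm' : 0 ≤ m' := by positivity
  have hPm : ∀ p ∈ ball (0 : ℂ) H₁ ×ˢ ball y δ, ‖P p.1 p.2‖ ≤ m' := by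
    intro p hp
    have h1 := (hG n (by omega)).2 p hp
    have h2 := hGP p hp
    have h3 : 2 * m * (2 * ‖p.1‖ / H₁) ^ n ≤ 2 * m * 2 ^ n := by
      gcongr
      rw [div_le_iff₀ hH₁]
      have := (mem_ball_zero_iff.1 hp.1).le
      linarith
    have h4 := norm_le_norm_add_norm_sub' (P p.1 p.2) (M.imdeIter f n p.1 p.2)
    rw [norm_sub_rev] at h4
    linarith
  obtain ⟨H₂, hH₂, hH₂'⟩ := exists_pos_mul_le (16 * M.kappa * m') hδ
  have hκ := M.kappa_pos
  set H : ℝ := min d (min H₁ H₂)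
  have hH : 0 < H := by positivity
  have hHH₁ : H ≤ H₁ := (min_le_right _ _).trans (min_le_left _ _)
  have hHH₂ : H ≤ H₂ := (min_le_right _ _).trans (min_le_right _ _)
  have hsmall : 16 * M.kappa * m' * H ≤ δ := le_trans (by gcongr) hH₂'
  have hUsub : ball (0 : ℂ) H ×ˢ ball y δ ⊆ ball (0 : ℂ) H₁ ×ˢ ball y δ :=
    prod_mono (ball_subset_ball hHH₁) subset_rfl
  refine ⟨δ, H, m', 2 * m * (2 / H₁) ^ (n + 1)
    + 12 * M.kappa ^ 2 * m' * (2 * m * (2 / H₁) ^ n) / δ,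
    ⟨hδ, hH, hm', hsmall, hP.mono hUsub, fun p hp => hPm p (hUsub hp), fun h hh => ?_⟩, hsub,
    min_le_left _ _⟩
  have hh₁ : h ∈ ball (0 : ℂ) H₁ := ball_subset_ball hHH₁ hh
  have hle : 2 * m ≤ m' := le_add_of_nonneg_right (by positivity)
  have hkey := M.norm_increment_sub_sub_le hM (g := M.imdeIter f n h) (g' := P h) (y := y) (m := m')
    (ε := 2 * m * (2 * ‖h‖ / H₁) ^ n) (h := h) hδ (curveHolomorphic_section (hG n (by omega)).1 hh₁)
    (curveHolomorphic_section hP hh₁)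
    (fun z hz => ((hG n (by omega)).2 (h, z) ⟨hh₁, hz⟩).trans hle)
    (fun z hz => hPm (h, z) ⟨hh₁, hz⟩) (fun z hz => hGP (h, z) ⟨hh₁, hz⟩) (le_trans (by
      have := (mem_ball_zero_iff.1 hh).le
      gcongr) hsmall)
  have htail := M.norm_imdeIter_sub_le hM hf hb hm hy hH₁
    (differentiableOn_section (hG (n + 1) le_rfl).1 hyδ)
    (fun h hh => (hG (n + 1) le_rfl).2 (h, y) ⟨hh, hyδ⟩) hh₁
  rw [Finset.sum_range_succ] at htail
  have e : flowIncrement f h y - M.increment h (P h) y - h ^ n • M.imdeTaylor f n y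
      = (M.imdeIter f (n + 1) h y - (P h y + h ^ n • M.imdeTaylor f n y))
        + (M.increment h (M.imdeIter f n h) y - M.increment h (P h) y
          - (M.imdeIter f n h y - P h y)) := by
    rw [show M.imdeIter f (n + 1) h y = M.imdeIter f n h y + (flowIncrement f h y
          - M.increment h (M.imdeIter f n h) y) from rfl]
    abel
  change ‖flowIncrement f h y - M.increment h (P h) y - h ^ n • M.imdeTaylor f n y‖ ≤ _
  rw [e]
  refine (norm_add_le_of_le htail hkey).trans_eq ?_
  rw [show 2 * ‖h‖ / H₁ = ‖h‖ * (2 / H₁) by ring, mul_pow, mul_pow, pow_succ ‖h‖]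
  ring

variable {M}

theorem HasDefectExpansion.contractsNear {n : ℕ} {y : E} {δ H m' C : ℝ}
    (D : M.HasDefectExpansion n f y δ H m' C) {h : ℂ} (hh : h ∈ ball (0 : ℂ) H) :
    M.ContractsNear h (fun z => ∑ k ∈ Finset.range n, h ^ k • M.imdeTaylor f k z) y (δ / 2) m'
      (4 * m' / δ) := by
  refine (curveHolomorphic_section (G := fun h z => ∑ k ∈ Finset.range n, h ^ k •
    M.imdeTaylor f k z) D.hol hh).contractsNear M D.δ_pos
    (fun z hz => D.bound (h, z) ⟨hh, hz⟩) (le_trans ?_ D.small)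
  have h1 := M.kappa_pos
  have h2 := D.nonneg
  have h3 := (mem_ball_zero_iff.1 hh).le
  gcongr
  norm_num

-- Strong induction. The defect expansion shows that the `n`-th coefficient is that of the flow
-- increment minus that of the increment for the previous partial sum. The former is a Lie
-- derivative, and the latter is analytic since the partial sum is jointly analytic by induction.
include hM in
theorem analyticOnNhd_imdeTaylor (hf : AnalyticOnNhd ℂ f (ball x R₀))
    (hb : ∀ z ∈ ball x R₀, ‖f z‖ ≤ m) (hm : 0 ≤ m) (n : ℕ) :
    AnalyticOnNhd ℂ (M.imdeTaylor f n) (ball x R₀) := by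
  have hfc : CurveHolomorphic (ball x R₀) f := .of_differentiableOn hf.differentiableOn
  induction n using Nat.strong_induction_on with
  | _ n ih =>
  intro y₀ hy₀
  have hF : ∀ k < n, CurveHolomorphic (ball x R₀) (M.imdeTaylor f k) := fun k hk =>
    .of_differentiableOn (ih k hk).differentiableOn
  have hpow : ∀ y ∈ ball x R₀, AnalyticAt ℂ
      (fun p : ℂ × E => ∑ k ∈ Finset.range n, p.1 ^ k • M.imdeTaylor f k p.2) (0, y) := by
    intro y hy
    have h3 : AnalyticAt ℂ (fun q : ℂ × E => q.1) (0, y) :=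
      (ContinuousLinearMap.fst ℂ ℂ E).analyticAt _
    have h4 : AnalyticAt ℂ (fun q : ℂ × E => q.2) (0, y) :=
      (ContinuousLinearMap.snd ℂ ℂ E).analyticAt _
    exact Finset.analyticAt_fun_sum _ fun k hk => (h3.pow k).smul
      (AnalyticAt.comp_of_eq (ih k (Finset.mem_range.1 hk) y hy) h4 rfl)
  have hinc := M.analyticAt_increment (hpow y₀ hy₀)
  have hres := (((analyticOnNhd_lieIterate hf (n + 1)) y₀ hy₀).const_smul
    (c := (((n + 1).factorial : ℂ)⁻¹))).sub (analyticAt_taylorCoeff_fst hinc n)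
  refine hres.congr ?_
  filter_upwards [isOpen_ball.mem_nhds hy₀] with y hy
  set Φ : ℂ → E := fun h => M.increment h
    (fun z => ∑ k ∈ Finset.range n, h ^ k • M.imdeTaylor f k z) y
  have hρ : 0 < (R₀ - dist y x) / 2 := by have := mem_ball.1 hy; linarith
  have hadd : (R₀ - dist y x) / 2 + (R₀ - dist y x) / 2 = R₀ - dist y x := add_halves _
  set ρ : ℝ := (R₀ - dist y x) / 2
  have hsubρ : ball y (ρ + ρ) ⊆ ball x R₀ := ball_subset_ball' (by linarith)
  obtain ⟨H₀, hH₀, hH₀'⟩ := exists_pos_mul_le (8 * m) hρ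
  have hfρ : AnalyticOnNhd ℂ f (ball y (ρ + ρ)) := hf.mono hsubρ
  have hbρ : ∀ z ∈ ball y (ρ + ρ), ‖f z‖ ≤ m := fun z hz => hb z (hsubρ hz)
  have hyρ : y ∈ ball y ρ := mem_ball_self hρ
  obtain ⟨δ, H, m', C, D, -, hHd⟩ := M.exists_hasDefectExpansion hM hfc hb hm hF hy hH₀
  have hψd := (differentiableOn_flowIncrement hfρ hbρ hρ hm hH₀' hyρ).mono (ball_subset_ball hHd)
  have hψb : ∀ h ∈ ball (0 : ℂ) H, ‖flowIncrement f h y‖ ≤ m := fun h hh =>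
    norm_flowIncrement_le (p := (h, y)) (.of_differentiableOn hfρ.differentiableOn) hbρ hρ hm hH₀'
      ⟨ball_subset_ball hHd hh, hyρ⟩
  have hΦd : DifferentiableOn ℂ Φ (ball 0 H) := by
    refine differentiableOn_section (R := δ / 2) (x := y)
      (G := fun h y => M.increment h (fun z => ∑ k ∈ Finset.range n, h ^ k • M.imdeTaylor f k z) y)
      (M.curveHolomorphic_increment (δ := δ / 2)
      (G := fun h z => ∑ k ∈ Finset.range n, h ^ k • M.imdeTaylor f k z)
      (m := m') D.nonneg (half_pos D.δ_pos) ?_ ?_ ?_) (mem_ball_self (half_pos D.δ_pos))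
    · rw [add_halves]; exact D.hol
    · rw [add_halves]; exact D.bound
    · linarith [D.small]
  have hΦb : ∀ h ∈ ball (0 : ℂ) H, ‖Φ h‖ ≤ M.kappa * m' := fun h hh =>
    (D.contractsNear hh).norm_increment_le
  -- The expansion of the method up to order `n` is that of the flow, corrected in degree `n` only.
  have hcoeff := taylorCoeff_eq_of_norm_sub_le D.H_pos hΦd hΦb (n := n + 1)
    (a := fun k => taylorCoeff (fun h => flowIncrement f h y) k
      - if k = n then M.imdeTaylor f n y else 0) (C' := C + m * (2 / H) ^ (n + 1)) ?_ n
    (Nat.lt_succ_self n)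
  · change ((n + 1).factorial : ℂ)⁻¹ • lieIterate f (n + 1) y - taylorCoeff Φ n = _
    rw [hcoeff, ← taylorCoeff_flowIncrement hfρ hbρ hρ hm hH₀ hH₀' hyρ n]
    simp
  · intro h hh
    have h1 := D.expansion h hh
    have h2 := norm_sub_sum_taylorCoeff_le D.H_pos hψd hψb (n + 1) hh
    have e : Φ h - ∑ k ∈ Finset.range (n + 1), h ^ k •
          (taylorCoeff (fun h => flowIncrement f h y) k - if k = n then M.imdeTaylor f n y else 0)
        = (flowIncrement f h y - ∑ k ∈ Finset.range (n + 1), h ^ k •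
            taylorCoeff (fun h => flowIncrement f h y) k)
          - (flowIncrement f h y - Φ h - h ^ n • M.imdeTaylor f n y) := by
      simp only [smul_sub, Finset.sum_sub_distrib, smul_ite, smul_zero]
      rw [Finset.sum_ite_eq' (Finset.range (n + 1)) n, if_pos (by simp)]
      abel
    rw [e]
    refine (norm_sub_le_of_le h2 h1).trans_eq ?_
    rw [show 2 * ‖h‖ / H = ‖h‖ * (2 / H) by ring, mul_pow]
    ring

end Coefficients

end RungeKutta

/-! ### Real steps and the inverse modified equation -/

namespace RungeKutta

variable {E : Type*} [NormedAddCommGroup E] [NormedSpace ℂ E] [NormedSpace ℝ E]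
  [IsScalarTower ℝ ℂ E] [CompleteSpace E] {s : ℕ} {M : RungeKutta s}

/-- The complex-step construction agrees with the actual real step, and only the field near `y`
matters. The second point allows a field known only on the ball to be replaced by its Taylor form.
-/
theorem ContractsNear.ofReal_congr {h : ℝ} {g g' : E → E} {y : E} {δ m L : ℝ}
    (H : M.ContractsNear (h : ℂ) g y δ m L) (hg : ∀ z ∈ ball y δ, g' z = g z) :
    M.ContractsNear h g' y δ m L ∧ M.increment h g' y = M.increment (h : ℂ) g y := by
  have hh : ‖(h : ℂ)‖ = ‖h‖ := Complex.norm_real h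
  have H' : M.ContractsNear h g' y δ m L :=
    ⟨H.nonneg, fun z hz => by rw [hg z hz]; exact H.bound z hz,
      fun z hz w hw => by rw [hg z hz, hg w hw]; exact H.lip z hz w hw, H.lip_nonneg,
      hh ▸ H.contr, hh ▸ H.small⟩
  refine ⟨H', ?_⟩
  have harg : ∀ i, y + h • ∑ j, M.a i j • M.slopes (h : ℂ) g y j ∈ ball y δ := fun i => by
    rw [← ofReal_smul_eq]
    exact H.stage_arg_mem H.norm_slopes_le i
  have : M.slopes (h : ℂ) g y = M.slopes h g' y := by
    refine H'.eq_slopes (funext fun i => ?_) harg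
    rw [stageMap, hg _ (harg i), ← ofReal_smul_eq]
    exact congrFun H.stageMap_slopes i
  rw [increment, increment, this]

theorem ContractsNear.step_eq_ofReal {h : ℝ} {g g' : E → E} {y : E} {δ m L : ℝ}
    (H : M.ContractsNear (h : ℂ) g y δ m L) (hg : ∀ z ∈ ball y δ, g' z = g z) :
    M.step h g' y = y + h • M.increment (h : ℂ) g y := by
  obtain ⟨H', e⟩ := H.ofReal_congr hg
  rw [H'.step_eq, e]

variable {f : E → E} {x : E} {R₀ m : ℝ}

theorem HasDefectExpansion.step_eq {n : ℕ} {y : E} {δ H m' C : ℝ}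
    (D : M.HasDefectExpansion n f y δ H m' C) {h : ℝ} (hh : |h| < H) {g : E → E}
    (hg : ∀ z ∈ ball y δ, g z = ∑ k ∈ Finset.range n, h ^ k • M.imdeTaylor f k z) :
    M.step h g y = y + h • M.increment (h : ℂ)
      (fun z => ∑ k ∈ Finset.range n, (h : ℂ) ^ k • M.imdeTaylor f k z) y := by
  refine (D.contractsNear (h := (h : ℂ)) (by simpa using hh)).step_eq_ofReal fun z hz => ?_
  rw [hg z (ball_subset_ball (by linarith [D.δ_pos]) hz)]
  exact Finset.sum_congr rfl fun k _ => (ofReal_pow_smul_eq h k _).symm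

/-- The defect of the `n`-th partial sum, for real steps. -/
theorem exists_defect_bound (hM : ∑ i, M.b i = 1) (hf : AnalyticOnNhd ℂ f (ball x R₀))
    (hb : ∀ z ∈ ball x R₀, ‖f z‖ ≤ m) (hm : 0 ≤ m) (n : ℕ) {y : E} (hy : y ∈ ball x R₀) :
    ∃ H > 0, ∃ C, ∀ g : ℝ → E → E, (∀ h, ∀ z ∈ ball x R₀, g h z
        = ∑ k ∈ Finset.range n, h ^ k • M.imdeTaylor f k z) → ∀ h : ℝ, 0 < h → h < H →
      ‖flow f h y - M.step h (g h) y - h ^ (n + 1) • M.imdeTaylor f n y‖ ≤ C * h ^ (n + 2) := by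
  have hfc : CurveHolomorphic (ball x R₀) f := .of_differentiableOn hf.differentiableOn
  have hρ : 0 < (R₀ - dist y x) / 2 := by have := mem_ball.1 hy; linarith
  have hadd : (R₀ - dist y x) / 2 + (R₀ - dist y x) / 2 = R₀ - dist y x := add_halves _
  set ρ : ℝ := (R₀ - dist y x) / 2
  have hsubρ : ball y (ρ + ρ) ⊆ ball x R₀ := ball_subset_ball' (by linarith)
  obtain ⟨H₀, hH₀, hH₀'⟩ := exists_pos_mul_le (8 * m) hρ
  obtain ⟨δ, H, m', C, D, hsub, hHd⟩ := M.exists_hasDefectExpansion hM hfc hb hm (n := n)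
    (fun k _ => .of_differentiableOn (analyticOnNhd_imdeTaylor hM hf hb hm k).differentiableOn)
    hy hH₀
  refine ⟨H, D.H_pos, C, fun g hg h hh0 hh => ?_⟩
  have habs : |h| < H := by rwa [abs_of_pos hh0]
  have hstep := D.step_eq habs fun z hz => hg h z (hsub hz)
  have hflow := flow_eq_flowIncrement (hfc.mono hsubρ) (fun z hz => hb z (hsubρ hz)) hρ hm hH₀'
    (mem_ball_self hρ) hh0.le (hh.trans_le hHd)
  have hexp := D.expansion (h : ℂ) (by simpa using habs)
  rw [hstep, hflow, add_sub_add_left_eq_sub, ← smul_sub, pow_succ', mul_smul, ← smul_sub, norm_smul,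
    ← ofReal_pow_smul_eq h n, Real.norm_eq_abs, abs_of_pos hh0]
  rw [Complex.norm_real, Real.norm_eq_abs, abs_of_pos hh0] at hexp
  calc h * _ ≤ h * (C * h ^ (n + 1)) := mul_le_mul_of_nonneg_left hexp hh0.le
    _ = C * h ^ (n + 2) := by ring

/-- Once the lower coefficients agree on the whole ball, the defect bound says that the defining
quotient differs from the Taylor coefficient by `O(h)`. -/
theorem imdeCoeff_eq_imdeTaylor (hM : ∑ i, M.b i = 1) (hf : AnalyticOnNhd ℂ f (ball x R₀))
    (hb : ∀ z ∈ ball x R₀, ‖f z‖ ≤ m) (hm : 0 ≤ m) (n : ℕ) :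
    ∀ y ∈ ball x R₀, M.imdeCoeff f n y = M.imdeTaylor f n y := by
  induction n using Nat.strong_induction_on with
  | _ n ih =>
  intro y hy
  obtain ⟨H, hH, C, hdef⟩ := exists_defect_bound hM hf hb hm n hy
  have hd := hdef (M.imdePartial f n) fun h z hz => by
    rw [imdePartial_eq_sum]
    exact Finset.sum_congr rfl fun k hk => by rw [ih k (Finset.mem_range.1 hk) z hz]
  refine Tendsto.limUnder_eq (tendsto_iff_norm_sub_tendsto_zero.2 ?_)
  have h0 : Tendsto (fun h : ℝ => C * h) (𝓝[>] 0) (𝓝 0) := by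
    have : Tendsto (fun h : ℝ => C * h) (𝓝 0) (𝓝 (C * 0)) := Continuous.tendsto (by fun_prop) 0
    rw [mul_zero] at this
    exact this.mono_left nhdsWithin_le_nhds
  refine squeeze_zero' (Eventually.of_forall fun _ => norm_nonneg _) ?_ h0
  filter_upwards [Ioo_mem_nhdsGT hH] with h hh
  have hpow : 0 < h ^ (n + 1) := pow_pos hh.1 _
  have e : (h ^ (n + 1))⁻¹ • (flow f h y - M.step h (M.imdePartial f n h) y) - M.imdeTaylor f n y
      = (h ^ (n + 1))⁻¹ • (flow f h y - M.step h (M.imdePartial f n h) y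
        - h ^ (n + 1) • M.imdeTaylor f n y) := by
    rw [smul_sub _ (_ - _), smul_smul, inv_mul_cancel₀ hpow.ne', one_smul]
  rw [e, norm_smul, norm_inv, Real.norm_eq_abs, abs_of_pos hpow, inv_mul_le_iff₀ hpow]
  refine (hd h hh.1 hh.2).trans_eq ?_
  ring

/-- The defect bound is used with one more coefficient than the truncation contains; its leading
term is itself of order `h^(K+2)`. -/
theorem HasOrder.isIMDE {N p : ℕ} (hp : 1 ≤ p) (hM : M.HasOrder p)
    {f : (Fin N → ℂ) → (Fin N → ℂ)} {x : Fin N → ℂ} (hf : AnalyticOnNhd ℂ f (ball x R₀))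
    (hb : ∀ z ∈ ball x R₀, ‖f z‖ ≤ m) (hm : 0 ≤ m) :
    M.IsIMDE f (ball x R₀) (M.imdeCoeff f) := by
  have hM1 := hM.sum_b_eq_one hp
  have hcoeff := imdeCoeff_eq_imdeTaylor hM1 hf hb hm
  refine ⟨fun k => (analyticOnNhd_imdeTaylor hM1 hf hb hm k).congr isOpen_ball
    fun y hy => (hcoeff k y hy).symm, fun K y hy => ?_⟩
  obtain ⟨H, hH, C, hdef⟩ := exists_defect_bound hM1 hf hb hm (K + 1) hy
  have hd := hdef (fun h z => ∑ k ∈ Finset.range (K + 1), h ^ k • M.imdeCoeff f k z)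
    fun h z hz => Finset.sum_congr rfl fun k _ => by rw [hcoeff k z hz]
  have h1 : (fun h : ℝ => M.step h (fun z => ∑ k ∈ Finset.range (K + 1), h ^ k • M.imdeCoeff f k z) y
      - flow f h y + h ^ (K + 2) • M.imdeTaylor f (K + 1) y) =O[𝓝[>] 0]
      fun h : ℝ => h ^ (K + 2) := by
    refine IsBigO.trans (IsBigO.of_bound C ?_) (pow_isBigO_pow (Nat.le_succ (K + 2)))
    filter_upwards [Ioo_mem_nhdsGT hH] with h hh
    have := hd h hh.1 hh.2
    rw [← norm_neg] at this
    rw [norm_pow, Real.norm_eq_abs, abs_of_pos hh.1]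
    refine le_trans (le_of_eq ?_) this
    congr 1
    abel
  have h2 : (fun h : ℝ => h ^ (K + 2) • M.imdeTaylor f (K + 1) y) =O[𝓝[>] 0]
      fun h : ℝ => h ^ (K + 2) := by
    refine IsBigO.of_bound ‖M.imdeTaylor f (K + 1) y‖ (Eventually.of_forall fun h => ?_)
    rw [norm_smul, mul_comm]
  simpa using h1.sub h2

end RungeKutta

/-! ### Quantitative estimates: local error, global error, recovery -/

theorem half_pow_floor_le {a : ℝ} : (1 / 2 : ℝ) ^ ⌊a⌋₊ ≤ 2 * Real.exp (-(Real.log 2 * a)) := by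
  have h2 : 0 < Real.log 2 := Real.log_pos one_lt_two
  have e : (1 / 2 : ℝ) ^ ⌊a⌋₊ = Real.exp (-(Real.log 2 * ⌊a⌋₊)) := by
    rw [Real.exp_neg, mul_comm, Real.exp_nat_mul, Real.exp_log two_pos, one_div, inv_pow]
  have e2 : 2 * Real.exp (-(Real.log 2 * a)) = Real.exp (Real.log 2 + -(Real.log 2 * a)) := by
    rw [Real.exp_add, Real.exp_log two_pos]
  rw [e, e2, Real.exp_le_exp]
  nlinarith [Nat.lt_floor_add_one a]

namespace RungeKutta

variable {s : ℕ} {M : RungeKutta s}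

/-- The local error of a method of order `p`, with an explicit constant. -/
theorem HasOrder.norm_flowIncrement_sub_increment_le {p : ℕ} (hM : M.HasOrder p) {N : ℕ}
    {f : (Fin N → ℂ) → (Fin N → ℂ)} {y : Fin N → ℂ} {δ m H : ℝ} (hδ : 0 < δ)
    (hf : AnalyticOnNhd ℂ f (ball y (δ + δ))) (hb : ∀ z ∈ ball y (δ + δ), ‖f z‖ ≤ m) (hH : 0 < H)
    (hHδ : 8 * M.kappa * m * H ≤ δ) {h : ℂ} (hh : h ∈ ball (0 : ℂ) H) :
    ‖flowIncrement f h y - M.increment h f y‖ ≤ (1 + M.kappa) * m * (2 * ‖h‖ / H) ^ p := by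
  have hy : y ∈ ball y δ := mem_ball_self hδ
  have hm : 0 ≤ m := (norm_nonneg _).trans (hb y (mem_ball_self (by linarith)))
  have hfc : CurveHolomorphic (ball y (δ + δ)) f := .of_differentiableOn hf.differentiableOn
  have hH8 : 8 * m * H ≤ δ := by
    have : m * H ≤ M.kappa * (m * H) := le_mul_of_one_le_left (by positivity) M.one_le_kappa
    linarith
  have hG : CurveHolomorphic (ball (0 : ℂ) H ×ˢ ball y (δ + δ)) fun p : ℂ × (Fin N → ℂ) => f p.2 :=
    hfc.comp (.of_differentiableOn differentiableOn_snd) fun q hq => hq.2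
  have hcontr : ∀ h ∈ ball (0 : ℂ) H, M.ContractsNear h f y (δ / 2) m (4 * m / δ) := fun h hh =>
    M.contractsNear_section (G := fun _ => f) hm hδ hG (fun q hq => hb _ hq.2) hHδ
      (p := (h, y)) ⟨hh, hy⟩
  set v : ℂ → (Fin N → ℂ) := fun h => flowIncrement f h y - M.increment h f y with hv
  have hvd : DifferentiableOn ℂ v (ball 0 H) :=
    (differentiableOn_section (curveHolomorphic_flowIncrement hfc hb hδ hm hH8) hy).sub
      (differentiableOn_section (G := fun h y => M.increment h f y)
        (M.curveHolomorphic_increment (G := fun _ => f) hm hδ hG (fun q hq => hb _ hq.2) hHδ) hy)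
  have hvb : ∀ z ∈ ball (0 : ℂ) H, ‖v z‖ ≤ (1 + M.kappa) * m := fun z hz => by
    have h1 := norm_flowIncrement_le hfc hb hδ hm hH8 (p := (z, y)) ⟨hz, hy⟩
    have h2 := (hcontr z hz).norm_increment_le
    have h3 := norm_sub_le (flowIncrement f z y) (M.increment z f y)
    simp only [hv] at h1 ⊢
    linarith
  have hsum := fun {h : ℂ} (hh : h ∈ ball (0 : ℂ) H) =>
    norm_sub_sum_taylorCoeff_le hH hvd hvb p hh
  -- The constant here depends on `f` and `y`, but it serves only to make the first `p` Taylor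
  -- coefficients vanish; the uniform constant then comes from the bound on `v`.
  have hO : (fun t : ℝ => v t) =O[𝓝[>] 0] fun t : ℝ => t ^ p := by
    obtain ⟨C, hC⟩ := (hM.isBigO_of_analyticOnNhd (by linarith) hf hb).bound
    refine IsBigO.of_bound C ?_
    filter_upwards [hC, Ioo_mem_nhdsGT hH] with t ht ht0
    have htH : (t : ℂ) ∈ ball (0 : ℂ) H := by simpa [abs_of_pos ht0.1] using ht0.2
    rw [(hcontr t htH).step_eq_ofReal fun _ _ => rfl,
      flow_eq_flowIncrement hfc hb hδ hm hH8 hy ht0.1.le ht0.2, add_sub_add_left_eq_sub,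
      ← smul_sub, norm_smul, pow_succ', norm_mul, mul_left_comm, norm_sub_rev] at ht
    exact le_of_mul_le_mul_left ht (norm_pos_iff.2 ht0.1.ne')
  have hcoeff : ∀ k < p, taylorCoeff v k = 0 := by
    refine eq_zero_of_sum_pow_smul_isBigO ?_
    have h1 : (fun t : ℝ => v t - ∑ k ∈ Finset.range p, (t : ℂ) ^ k • taylorCoeff v k)
        =O[𝓝[>] 0] fun t : ℝ => t ^ p := by
      refine IsBigO.of_bound ((1 + M.kappa) * m * (2 / H) ^ p) ?_
      filter_upwards [Ioo_mem_nhdsGT hH] with t ht0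
      have htH : (t : ℂ) ∈ ball (0 : ℂ) H := by simpa [abs_of_pos ht0.1] using ht0.2
      refine (hsum htH).trans_eq ?_
      rw [norm_pow, Complex.norm_real, mul_assoc _ _ (‖t‖ ^ p), ← mul_pow]
      ring
    refine (hO.sub h1).congr_left fun t => ?_
    rw [sub_sub_cancel]
    exact Finset.sum_congr rfl fun k _ => ofReal_pow_smul_eq t k _
  have := hsum hh
  rwa [Finset.sum_eq_zero fun k hk => by rw [hcoeff k (Finset.mem_range.1 hk), smul_zero],
    sub_zero] at this

variable {E : Type*} [NormedAddCommGroup E] [NormedSpace ℂ E] [NormedSpace ℝ E]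
  [IsScalarTower ℝ ℂ E] [CompleteSpace E]

/-- The sequence of approximations produced by the increment function. -/
noncomputable def approximation (M : RungeKutta s) (h : ℝ) (g : E → E) (y : E) (j : ℕ) : E :=
  (fun z => z + h • M.increment (h : ℂ) g z)^[j] y

theorem approximation_succ (M : RungeKutta s) (h : ℝ) (g : E → E) (y : E) (j : ℕ) :
    M.approximation h g y (j + 1) = M.approximation h g y j
      + h • M.increment (h : ℂ) g (M.approximation h g y j) :=
  Function.iterate_succ_apply' ..

section Approximation

variable {S : ℕ} {g : E → E} {y : E} {δ m T : ℝ}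

/-- Each of the `S` steps moves by at most `T / S * (κ m)`, so the whole trajectory stays in half
the ball and the other half provides the margin for every step. -/
theorem approximation_spec (hS : 1 ≤ S) (hδ : 0 < δ) (hg : CurveHolomorphic (ball y δ) g)
    (hm : ∀ z ∈ ball y δ, ‖g z‖ ≤ m) (hT0 : 0 ≤ T) (hT : 16 * M.kappa * m * T ≤ δ) {j : ℕ}
    (hj : j ≤ S) :
    M.approximation (T / S) g y j ∈ ball y (δ / 2) ∧
      M.ContractsNear ((T / S : ℝ) : ℂ) g (M.approximation (T / S) g y j) (δ / 2 / 2) m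
        (4 * m / (δ / 2)) := by
  have hS' : (1 : ℝ) ≤ S := by exact_mod_cast hS
  have hm0 : 0 ≤ m := (norm_nonneg _).trans (hm y (mem_ball_self hδ))
  have hκm : 0 ≤ M.kappa * m := mul_nonneg M.kappa_pos.le hm0
  have hh0 : 0 ≤ T / S := by positivity
  have hnorm : ‖((T / S : ℝ) : ℂ)‖ = T / S := by
    rw [Complex.norm_real, Real.norm_eq_abs, abs_of_nonneg hh0]
  have hhT : T / S ≤ T := div_le_self hT0 hS'
  have hcontr : ∀ z ∈ ball y (δ / 2),
      M.ContractsNear ((T / S : ℝ) : ℂ) g z (δ / 2 / 2) m (4 * m / (δ / 2)) := by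
    intro z hz
    have hsub : ball z (δ / 2) ⊆ ball y δ := ball_subset_ball' (by
      have := mem_ball.1 hz; linarith)
    refine (hg.mono hsub).contractsNear M (by linarith) (fun w hw => hm w (hsub hw)) ?_
    rw [hnorm]
    have : M.kappa * m * (T / S) ≤ M.kappa * m * T := by gcongr
    linarith
  suffices hdist : ∀ j ≤ S, ‖M.approximation (T / S) g y j - y‖ ≤ j * (T / S * (M.kappa * m)) ∧
      M.approximation (T / S) g y j ∈ ball y (δ / 2) from
    ⟨(hdist j hj).2, hcontr _ (hdist j hj).2⟩
  have hmem : ∀ j ≤ S, ∀ w, ‖w - y‖ ≤ j * (T / S * (M.kappa * m)) → w ∈ ball y (δ / 2) := by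
    intro j hj w hw
    rw [mem_ball, dist_eq_norm]
    have hjS : (j : ℝ) ≤ S := by exact_mod_cast hj
    have h1 : (j : ℝ) * (T / S * (M.kappa * m)) ≤ S * (T / S * (M.kappa * m)) := by gcongr
    have h2 : (S : ℝ) * (T / S * (M.kappa * m)) = M.kappa * m * T := by field_simp
    linarith
  intro j
  induction j with
  | zero => exact fun _ => ⟨by simp [approximation], by simpa [approximation] using half_pos hδ⟩
  | succ j ih =>
    intro hj
    obtain ⟨h1, h2⟩ := ih (by omega)
    suffices h3 : _ from ⟨h3, hmem (j + 1) hj _ h3⟩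
    rw [approximation_succ, add_sub_right_comm]
    refine (norm_add_le_of_le h1 (r₂ := T / S * (M.kappa * m)) ?_).trans_eq (by push_cast; ring)
    rw [norm_smul, Real.norm_eq_abs, abs_of_nonneg hh0]
    exact mul_le_mul_of_nonneg_left (hcontr _ h2).norm_increment_le hh0

theorem isTrajectory_approximation (hS : 1 ≤ S) (hδ : 0 < δ) (hg : CurveHolomorphic (ball y δ) g)
    (hm : ∀ z ∈ ball y δ, ‖g z‖ ≤ m) (hT0 : 0 ≤ T) (hT : 16 * M.kappa * m * T ≤ δ) :
    M.IsTrajectory S ((T : ℂ) / S) g m (M.approximation (T / S) g y)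
      fun j => M.slopes ((T / S : ℝ) : ℂ) g (M.approximation (T / S) g y j) := by
  have hc := fun {j : ℕ} (hj : j ≤ S) => (approximation_spec hS hδ hg hm hT0 hT hj).2
  rw [show (T : ℂ) / S = ((T / S : ℝ) : ℂ) by push_cast; rfl]
  refine ⟨fun j hj i => (congrFun (hc hj.le).stageMap_slopes i).symm, fun j _ => ?_,
    fun j hj => (hc hj.le).norm_slopes_le⟩
  rw [approximation_succ, ofReal_smul_eq, increment]

theorem iterate_step_eq_approximation (hS : 1 ≤ S) (hδ : 0 < δ)
    (hg : CurveHolomorphic (ball y δ) g) (hm : ∀ z ∈ ball y δ, ‖g z‖ ≤ m) (hT0 : 0 ≤ T)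
    (hT : 16 * M.kappa * m * T ≤ δ) {j : ℕ} (hj : j ≤ S) :
    (M.step (T / S) g)^[j] y = M.approximation (T / S) g y j := by
  induction j with
  | zero => rfl
  | succ j ih =>
    rw [Function.iterate_succ_apply', ih (by omega), approximation_succ]
    exact (approximation_spec hS hδ hg hm hT0 hT (by omega)).2.step_eq_ofReal fun _ _ => rfl

theorem solverDefined_of_curveHolomorphic (hS : 1 ≤ S) (hδ : 0 < δ)
    (hg : CurveHolomorphic (ball y δ) g)
    (hm : ∀ z ∈ ball y δ, ‖g z‖ ≤ m) (hT0 : 0 ≤ T) (hT : 16 * M.kappa * m * T ≤ δ) :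
    M.SolverDefined S g T y := by
  intro j hj
  rw [iterate_step_eq_approximation hS hδ hg hm hT0 hT hj.le]
  exact ((approximation_spec hS hδ hg hm hT0 hT hj.le).2.ofReal_congr
    fun _ _ => rfl).1.existsUnique_isStepValue

end Approximation

/-- Consecutive values of the flow are related by the increment of the flow. -/
theorem flow_curve_succ {f : E → E} {y : E} {δ m H h t : ℝ} (hδ : 0 < δ)
    (hf : CurveHolomorphic (ball y (δ + δ)) f) (hb : ∀ z ∈ ball y (δ + δ), ‖f z‖ ≤ m)
    (hH : 8 * m * H ≤ δ) (h0 : 0 ≤ h) (ht : 0 ≤ t) (hth : t + h < H)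
    (hmem : y + t • flowIncrement f (t : ℂ) y ∈ ball y (δ / 2)) :
    y + (t + h) • flowIncrement f ((t + h : ℝ) : ℂ) y
      = y + t • flowIncrement f (t : ℂ) y
        + h • flowIncrement f (h : ℂ) (y + t • flowIncrement f (t : ℂ) y) := by
  have hm : 0 ≤ m := (norm_nonneg _).trans (hb y (mem_ball_self (by linarith)))
  set z := y + t • flowIncrement f (t : ℂ) y with hz
  have hsub : ball z δ ⊆ ball y (δ + δ) := ball_subset_ball' (by
    have := mem_ball.1 hmem; linarith)
  rw [← flow_eq_flowIncrement hf hb hδ hm hH (ball_subset_ball (by linarith) hmem) h0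
    (by linarith)]
  have hsub' : ball z (δ / 2) ⊆ ball y (δ + δ) :=
    (ball_subset_ball (by linarith)).trans hsub
  refine (flow_eq (γ := fun r : ℝ => y + (t + r) • flowIncrement f ((t + r : ℝ) : ℂ) y) hm
    (by nlinarith) h0 (fun w hw => hb w (hsub' hw))
    ((hf.mono hsub).lipschitz_half hδ fun w hw => hb w (hsub hw)) (by simp [hz]) ?_).symm
  intro r hr
  have := hasDerivAt_flowIncrement hf hb hδ hm hH (mem_ball_self hδ) (t := t + r) (by
    rw [abs_of_nonneg (by linarith [hr.1])]; linarith [hr.2])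
  exact (this.comp_const_add t r).hasDerivWithinAt

/-- The global error is bounded by the residual. -/
theorem norm_sub_flow_le {f : E → E} {y : E} {δ m h ε : ℝ} {S : ℕ} {I : E → E} {Y : ℕ → E}
    (hδ : 0 < δ)
    (hf : CurveHolomorphic (ball y (δ + δ)) f) (hb : ∀ z ∈ ball y (δ + δ), ‖f z‖ ≤ m)
    (h0 : 0 ≤ h) (hS : 1 ≤ S) (hT : 8 * m * (S * h) < δ)
    (hY0 : Y 0 = y) (hY : ∀ j < S, Y (j + 1) = Y j + h • I (Y j))
    (hmem : ∀ j ≤ S, Y j ∈ ball y (δ / 2))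
    (hI : ∀ j < S, ‖flowIncrement f (h : ℂ) (Y j) - I (Y j)‖ ≤ ε) :
    ‖Y S - flow f (S * h) y‖ ≤ 2 ^ S * (h * ε) := by
  have hm : 0 ≤ m := (norm_nonneg _).trans (hb y (mem_ball_self (by linarith)))
  have hε : 0 ≤ ε := (norm_nonneg _).trans (hI 0 hS)
  have hS' : (1 : ℝ) ≤ S := by exact_mod_cast hS
  have hyδ : y ∈ ball y δ := mem_ball_self hδ
  -- For `m = 0` any `H` is allowed; otherwise the strict inequality `hT` leaves room for `H`.
  obtain ⟨H, hHT, hH⟩ : ∃ H, S * h < H ∧ 8 * m * H ≤ δ := by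
    rcases hm.eq_or_lt with rfl | hm
    · exact ⟨S * h + 1, by linarith, by simpa using hδ.le⟩
    · exact ⟨δ / (8 * m), by rw [lt_div_iff₀ (by positivity)]; linarith, by
        rw [mul_div_cancel₀ _ (by positivity)]⟩
  have hhH : h < H := lt_of_le_of_lt (le_mul_of_one_le_left h0 hS') hHT
  have hH0 : 0 < H := h0.trans_lt hhH
  have hhmem : (h : ℂ) ∈ ball (0 : ℂ) H := by simpa [abs_of_nonneg h0] using hhH
  set ψ : E → E := flowIncrement f (h : ℂ) with hψ
  have hlip := (curveHolomorphic_section (G := flowIncrement f)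
    (curveHolomorphic_flowIncrement hf hb hδ hm hH) hhmem).lipschitz_half hδ
    fun z hz => norm_flowIncrement_le hf hb hδ hm hH (p := ((h : ℂ), z)) ⟨hhmem, hz⟩
  let z : ℕ → E := fun j => y + ((j : ℝ) * h) • flowIncrement f ((j * h : ℝ) : ℂ) y
  have hzmem : ∀ j ≤ S, z j ∈ ball y (δ / 2) := by
    intro j hj
    have hjS : (j : ℝ) ≤ S := by exact_mod_cast hj
    have hjh : (j : ℝ) * h ≤ S * h := by gcongr
    have hjh0 : 0 ≤ (j : ℝ) * h := by positivity
    have h1 := norm_flowIncrement_le hf hb hδ hm hH (p := (((j * h : ℝ) : ℂ), y))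
      ⟨by rw [mem_ball_zero_iff, Complex.norm_real, Real.norm_eq_abs, abs_of_nonneg hjh0]
          exact hjh.trans_lt hHT, hyδ⟩
    rw [mem_ball, dist_self_add_left, norm_smul, Real.norm_eq_abs, abs_of_nonneg hjh0]
    have h2 : (j : ℝ) * h * ‖flowIncrement f ((j * h : ℝ) : ℂ) y‖ ≤ S * h * m := by gcongr
    nlinarith
  have hzsucc : ∀ j < S, z (j + 1) = z j + h • ψ (z j) := by
    intro j hj
    have hjS : (j : ℝ) + 1 ≤ S := by exact_mod_cast hj
    have := flow_curve_succ hδ hf hb hH h0 (t := j * h) (by positivity) (by nlinarith)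
      (hzmem j hj.le)
    simp only [z]
    rw [← this]
    push_cast
    rw [add_one_mul, add_one_mul]
  -- One exact step at most doubles a distance, since `ψ` has Lipschitz constant at most `1 / h`;
  -- each step adds a new error `h * ε`.
  have herr : ∀ j ≤ S, ‖Y j - z j‖ ≤ (2 ^ j - 1) * (h * ε) := by
    intro j
    induction j with
    | zero => intro _; simp [z, hY0]
    | succ j ih =>
      intro hj
      have h1 := ih (by omega)
      have h2 := hlip _ (hmem j (by omega)) _ (hzmem j (by omega))
      have h3 := hI j (by omega)
      have e : Y (j + 1) - z (j + 1)
          = (Y j - z j) + (h • (ψ (Y j) - ψ (z j)) - h • (ψ (Y j) - I (Y j))) := by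
        rw [hY j (by omega), hzsucc j (by omega)]
        simp only [smul_sub]
        abel
      have h4 : ‖h • (ψ (Y j) - ψ (z j))‖ ≤ ‖Y j - z j‖ := by
        rw [norm_smul, Real.norm_eq_abs, abs_of_nonneg h0]
        have h5 : h * (4 * m / δ) ≤ 1 := by
          rw [mul_div_assoc', div_le_one hδ]
          nlinarith [mul_nonneg hm h0]
        calc _ ≤ h * (4 * m / δ * ‖Y j - z j‖) := mul_le_mul_of_nonneg_left h2 h0
          _ = h * (4 * m / δ) * ‖Y j - z j‖ := by ring
          _ ≤ 1 * ‖Y j - z j‖ := by gcongr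
          _ = _ := one_mul _
      have h6 : ‖h • (ψ (Y j) - I (Y j))‖ ≤ h * ε := by
        rw [norm_smul, Real.norm_eq_abs, abs_of_nonneg h0]
        exact mul_le_mul_of_nonneg_left h3 h0
      rw [e]
      refine (norm_add_le_of_le h1 ((norm_sub_le _ _).trans (add_le_add (h4.trans h1) h6))).trans_eq
        ?_
      ring
  rw [flow_eq_flowIncrement hf hb hδ hm hH hyδ (by positivity) hHT]
  refine (herr S le_rfl).trans ?_
  have : 0 ≤ h * ε := by positivity
  linarith

section Recovery

variable {S : ℕ} {x y : E} {f g g' : E → E} {m T L ε : ℝ}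

/-- If the solver reproduces the flow of `f` for the field `g`, up to `T * L`, and approximately for
the field `g'`, then `g` is close to `g'`, relative to their distance nearby. -/
theorem norm_sub_le_of_norm_odeSolve_sub_flow_le (hM : ∑ i, M.b i = 1) (hS : 1 ≤ S) {δ η : ℝ}
    (hm0 : 0 < m) (hT : 0 < T) (hδT : 48 * M.kappa ^ 2 * m * T = δ)
    (hf : CurveHolomorphic (ball y (δ + δ)) f) (hfm : ∀ z ∈ ball y (δ + δ), ‖f z‖ ≤ m)
    (hg : CurveHolomorphic (ball y δ) g) (hgm : ∀ z ∈ ball y δ, ‖g z‖ ≤ m)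
    (hg' : CurveHolomorphic (ball y δ) g') (hgm' : ∀ z ∈ ball y δ, ‖g' z‖ ≤ 2 * m)
    (hε : ∀ z ∈ ball y δ,
      ‖flowIncrement f ((T / S : ℝ) : ℂ) z - M.increment ((T / S : ℝ) : ℂ) g' z‖ ≤ ε)
    (hη : ∀ z ∈ ball y δ, ‖g z - g' z‖ ≤ η)
    (hL : ‖M.odeSolve S g T y - flow f T y‖ ≤ T * L) :
    ‖g y - g' y‖ ≤ L + 2 ^ S * ε + 1 / 2 * η := by
  have hκ := M.one_le_kappa
  have hS' : (1 : ℝ) ≤ S := by exact_mod_cast hS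
  have hκ2 : 1 ≤ M.kappa ^ 2 := one_le_pow₀ hκ
  have hκκ : M.kappa ≤ M.kappa ^ 2 := le_self_pow₀ hκ two_ne_zero
  have hmT : 0 < m * T := by positivity
  have hδ : 0 < δ := by rw [← hδT]; have := M.kappa_pos; positivity
  have hTδ : 16 * M.kappa * (2 * m) * T ≤ δ := by nlinarith
  have hε0 : 0 ≤ ε := (norm_nonneg _).trans (hε y (mem_ball_self hδ))
  have hgm2 : ∀ z ∈ ball y δ, ‖g z‖ ≤ 2 * m := fun z hz => (hgm z hz).trans (by linarith)
  have hnT : ‖(T : ℂ)‖ = T := by rw [Complex.norm_real, Real.norm_eq_abs, abs_of_pos hT]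
  have h1 := IsTrajectory.norm_sub_sub_le hM hS hδ hg hg' hgm2 hη (T := (T : ℂ))
    (by rwa [hnT]) (isTrajectory_approximation hS hδ hg hgm2 hT.le hTδ)
    (isTrajectory_approximation hS hδ hg' hgm' hT.le hTδ) rfl rfl
  rw [hnT, ofReal_smul_eq] at h1
  have hST : (S : ℝ) * (T / S) = T := mul_div_cancel₀ _ (by positivity)
  have h2 := norm_sub_flow_le hδ hf hfm (h := T / S) (ε := ε) (S := S)
    (I := M.increment ((T / S : ℝ) : ℂ) g') (Y := M.approximation (T / S) g' y) (by positivity) hS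
    (by rw [hST]; nlinarith) rfl (fun j _ => M.approximation_succ ..)
    (fun j hj => (approximation_spec hS hδ hg' hgm' hT.le hTδ hj).1)
    (fun j hj => hε _ (ball_subset_ball (by linarith)
      (approximation_spec hS hδ hg' hgm' hT.le hTδ hj.le).1))
  rw [hST] at h2
  rw [odeSolve, iterate_step_eq_approximation hS hδ hg hgm2 hT.le hTδ le_rfl] at hL
  have h3 : 2 ^ S * (T / S * ε) ≤ T * (2 ^ S * ε) := by
    have : T / S ≤ T := div_le_self hT.le hS'
    calc (2 : ℝ) ^ S * (T / S * ε) ≤ 2 ^ S * (T * ε) := by gcongr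
      _ = _ := by ring
  -- The choice `δ = 48 κ² m T` is made for this factor `1 / 2`.
  have h4 : 12 * M.kappa ^ 2 * (2 * m) * T * η / δ = 1 / 2 * η := by
    have := M.kappa_pos
    rw [← hδT]
    field_simp
    ring
  rw [h4] at h1
  have h5 : T * ‖g y - g' y‖ ≤ T * (L + 2 ^ S * ε + 1 / 2 * η) := by
    calc T * ‖g y - g' y‖ = ‖T • (g y - g' y)‖ := by
          rw [norm_smul, Real.norm_eq_abs, abs_of_pos hT]
      _ = ‖(M.approximation (T / S) g y S - flow f T y)
            - (M.approximation (T / S) g' y S - flow f T y)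
            - (M.approximation (T / S) g y S - M.approximation (T / S) g' y S
              - T • (g y - g' y))‖ := by congr 1; abel
      _ ≤ T * L + T * (2 ^ S * ε) + T * (1 / 2 * η) :=
          (norm_sub_le _ _).trans (add_le_add ((norm_sub_le _ _).trans
            (add_le_add hL (h2.trans h3))) h1)
      _ = _ := by ring
  exact le_of_mul_le_mul_left h5 hT

/-- The iterated estimate: the distance of the two fields at the centre is controlled by the loss and
the residual, up to an exponentially small term. -/
theorem norm_sub_le_add_exp (hM : ∑ i, M.b i = 1) (hS : 1 ≤ S) {r₁ r₂ : ℝ} (hr₁ : 0 < r₁)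
    (hm0 : 0 < m) (hT : 0 < T) (hT₂ : 48 * M.kappa ^ 2 * m * T ≤ r₂)
    (hf : CurveHolomorphic (ball x (r₁ + r₂)) f) (hfm : ∀ z ∈ ball x (r₁ + r₂), ‖f z‖ ≤ m)
    (hg : CurveHolomorphic (ball x r₁) g) (hgm : ∀ z ∈ ball x r₁, ‖g z‖ ≤ m)
    (hg' : CurveHolomorphic (ball x r₁) g') (hgm' : ∀ z ∈ ball x r₁, ‖g' z‖ ≤ 2 * m)
    (hε : ∀ z ∈ ball x r₁,
      ‖flowIncrement f ((T / S : ℝ) : ℂ) z - M.increment ((T / S : ℝ) : ℂ) g' z‖ ≤ ε)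
    (hL : ∀ z ∈ ball x r₁, ‖M.odeSolve S g T z - flow f T z‖ ≤ T * L) :
    ‖g x - g' x‖ ≤ 2 * L + 2 ^ (S + 1) * ε
      + 6 * m * Real.exp (-(Real.log 2 * (r₁ / (96 * M.kappa ^ 2 * m)) / T)) := by
  have hκ := M.kappa_pos
  have hx : x ∈ ball x r₁ := mem_ball_self hr₁
  have hε0 : 0 ≤ ε := (norm_nonneg _).trans (hε x hx)
  have hL0 : 0 ≤ L := by
    have := (norm_nonneg _).trans (hL x hx)
    exact nonneg_of_mul_nonneg_right this hT
  set δ := 48 * M.kappa ^ 2 * m * T with hδT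
  have hδ : 0 < δ := by positivity
  have key : ∀ n : ℕ, ∀ z ∈ ball x (r₁ - n * δ),
      ‖g z - g' z‖ ≤ 2 * (L + 2 ^ S * ε) + (1 / 2) ^ n * (3 * m) := by
    intro n
    induction n with
    | zero =>
      intro z hz
      rw [Nat.cast_zero, zero_mul, sub_zero] at hz
      have h1 := _root_.norm_sub_le (g z) (g' z)
      have h2 := hgm z hz
      have h3 := hgm' z hz
      have : 0 ≤ L + 2 ^ S * ε := by positivity
      rw [pow_zero]
      linarith
    | succ n ih =>
      intro z hz
      have hz' := mem_ball.1 hz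
      push_cast at hz'
      have hnδ : 0 ≤ n * δ := by positivity
      have hsub : ball z δ ⊆ ball x (r₁ - n * δ) := ball_subset_ball' (by linarith)
      have hsub₁ : ball z δ ⊆ ball x r₁ := ball_subset_ball' (by linarith)
      have hsub₂ : ball z (δ + δ) ⊆ ball x (r₁ + r₂) := ball_subset_ball' (by linarith)
      refine (norm_sub_le_of_norm_odeSolve_sub_flow_le hM hS hm0 hT hδT.symm (hf.mono hsub₂)
        (fun w hw => hfm w (hsub₂ hw)) (hg.mono hsub₁) (fun w hw => hgm w (hsub₁ hw))
        (hg'.mono hsub₁) (fun w hw => hgm' w (hsub₁ hw)) (fun w hw => hε w (hsub₁ hw))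
        (fun w hw => ih w (hsub hw)) (hL z (hsub₁ (mem_ball_self hδ)))).trans_eq ?_
      ring
  -- Stopping after at most half of `r₁ / δ` repetitions leaves a ball of positive radius around
  -- `x`.
  have hfloor := Nat.floor_le (a := r₁ / (2 * δ)) (by positivity)
  rw [le_div_iff₀ (by positivity)] at hfloor
  refine (key ⌊r₁ / (2 * δ)⌋₊ x (mem_ball_self (by linarith))).trans ?_
  have h1 := half_pow_floor_le (a := r₁ / (2 * δ))
  have e : Real.log 2 * (r₁ / (2 * δ)) = Real.log 2 * (r₁ / (96 * M.kappa ^ 2 * m)) / T := by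
    rw [hδT]; field_simp; norm_num
  rw [e] at h1
  have h2 := mul_le_mul_of_nonneg_right h1 (by positivity : 0 ≤ 3 * m)
  rw [pow_succ]
  linarith

/-- The distance of the learned field to the truncated modified field. -/
theorem norm_sub_sum_imdeTaylor_le (hM : ∑ i, M.b i = 1) (hS : 1 ≤ S) {r₁ r₂ : ℝ} (hr₁ : 0 < r₁)
    (hr₂ : 0 < r₂) (hm0 : 0 < m) (hT : 0 < T) {K : ℕ}
    (hK : 192 * M.kappa ^ 2 * m * T * (K + 1) ≤ r₂)
    (hf : CurveHolomorphic (ball x (r₁ + r₂)) f) (hfm : ∀ z ∈ ball x (r₁ + r₂), ‖f z‖ ≤ m)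
    (hg : CurveHolomorphic (ball x r₁) g) (hgm : ∀ z ∈ ball x r₁, ‖g z‖ ≤ m)
    (hL : ∀ z ∈ ball x r₁, ‖M.odeSolve S g T z - flow f T z‖ ≤ T * L) :
    ‖g x - ∑ k ∈ Finset.range K, (T / S) ^ k • M.imdeTaylor f k x‖ ≤ 2 * L
      + (2 ^ (S + 1) + 2) * m * (1 / 2) ^ K
      + 6 * m * Real.exp (-(Real.log 2 * (r₁ / (96 * M.kappa ^ 2 * m)) / T)) := by
  have hκ := M.kappa_pos
  have hS' : (1 : ℝ) ≤ S := by exact_mod_cast hS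
  have hh0 : 0 < T / S := by positivity
  have hhT : T / S ≤ T := div_le_self hT.le hS'
  have hnorm : ‖((T / S : ℝ) : ℂ)‖ = T / S := by
    rw [Complex.norm_real, Real.norm_eq_abs, abs_of_pos hh0]
  have hK0 : (0 : ℝ) ≤ K := Nat.cast_nonneg K
  -- The margin `r₂` is shared by `K` iterations and one residual estimate; `H` is the largest step
  -- compatible with this `δ`. The constant 192 in `hK` then gives `4 * T ≤ H`, so that the ratio in
  -- the Taylor tail is at most `1 / 2`.
  set δ := r₂ / (K + 1) with hδK
  set H := r₂ / (48 * M.kappa ^ 2 * m * (K + 1)) with hHK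
  have hδ : 0 < δ := by positivity
  have hH : 0 < H := by positivity
  have hHδ : 48 * M.kappa ^ 2 * m * H = δ := by rw [hHK, hδK]; field_simp
  have hTH : 4 * T ≤ H := by
    rw [hHK, le_div_iff₀ (by positivity)]
    linarith
  have hhH : ((T / S : ℝ) : ℂ) ∈ ball (0 : ℂ) H := by
    rw [mem_ball_zero_iff, hnorm]; linarith
  have hx₁ : x ∈ ball x r₁ := mem_ball_self hr₁
  have hx₂ : x ∈ ball x (r₁ + r₂) := mem_ball_self (by linarith)
  have hKδ : (K + 1) * δ = r₂ := by rw [hδK]; field_simp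
  obtain ⟨h1, h2⟩ := M.imdeIter_spec hM hf hfm hm0.le hδ hHδ.le K
  obtain ⟨hhol, hbd⟩ := h1 r₁ (by linarith)
  have hbd' : ∀ p ∈ ball (0 : ℂ) H ×ˢ ball x r₁, ‖M.imdeIter f K p.1 p.2‖ ≤ 2 * m :=
    fun p hp => (hbd p hp).trans (by
      have : (0 : ℝ) ≤ (1 / 2) ^ K := by positivity
      nlinarith)
  have hres : ∀ z ∈ ball x r₁, ‖flowIncrement f ((T / S : ℝ) : ℂ) z
      - M.increment ((T / S : ℝ) : ℂ) (M.imdeIter f K ((T / S : ℝ) : ℂ)) z‖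
        ≤ m * (1 / 2) ^ K := by
    intro z hz
    refine (h2 r₁ (by linarith) (((T / S : ℝ) : ℂ), z) ⟨hhH, hz⟩).trans ?_
    simp only [hnorm]
    refine mul_le_mul_of_nonneg_left (pow_le_pow_left₀ (by positivity) ?_ K) hm0.le
    rw [div_le_iff₀ hδ, ← hHδ]
    have : 24 * M.kappa ^ 2 * m * (T / S) ≤ 24 * M.kappa ^ 2 * m * H := by gcongr; linarith
    linarith
  have hT₂ : 48 * M.kappa ^ 2 * m * T ≤ r₂ := by
    have h3 : 0 < M.kappa ^ 2 * m * T := by positivity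
    have h4 : 0 ≤ M.kappa ^ 2 * m * T * K := by positivity
    linarith
  have hmain := norm_sub_le_add_exp hM hS hr₁ hm0 hT hT₂ hf hfm hg hgm
    (curveHolomorphic_section hhol hhH) (fun z hz => hbd' (_, z) ⟨hhH, hz⟩) hres hL
  have htail := M.norm_imdeIter_sub_le hM hf hfm hm0.le hx₂ hH (differentiableOn_section hhol hx₁)
    (fun h hh => hbd' (h, x) ⟨hh, hx₁⟩) hhH
  have htail' : 2 * m * (2 * ‖((T / S : ℝ) : ℂ)‖ / H) ^ K ≤ 2 * m * (1 / 2) ^ K := by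
    refine mul_le_mul_of_nonneg_left (pow_le_pow_left₀ (by positivity) ?_ K) (by positivity)
    rw [div_le_iff₀ hH, hnorm]
    linarith
  have e : ∑ k ∈ Finset.range K, (T / S) ^ k • M.imdeTaylor f k x
      = ∑ k ∈ Finset.range K, ((T / S : ℝ) : ℂ) ^ k • M.imdeTaylor f k x :=
    Finset.sum_congr rfl fun k _ => (ofReal_pow_smul_eq _ k _).symm
  rw [e, ← sub_add_sub_cancel _ (M.imdeIter f K ((T / S : ℝ) : ℂ) x)]
  refine (norm_add_le_of_le hmain (htail.trans htail')).trans_eq ?_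
  ring

end Recovery

/-- The distance of the learned field to the target field. -/
theorem HasOrder.norm_sub_le {p S N : ℕ} (hp : 1 ≤ p) (hM : M.HasOrder p) (hS : 1 ≤ S)
    {x : Fin N → ℂ} {f g : (Fin N → ℂ) → (Fin N → ℂ)} {m T L r₁ r₂ : ℝ} (hr₁ : 0 < r₁)
    (hr₂ : 0 < r₂) (hm0 : 0 < m) (hT : 0 < T) (hT₂ : 48 * M.kappa ^ 2 * m * T ≤ r₂)
    (hf : AnalyticOnNhd ℂ f (ball x (r₁ + r₂))) (hfm : ∀ z ∈ ball x (r₁ + r₂), ‖f z‖ ≤ m)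
    (hg : CurveHolomorphic (ball x r₁) g) (hgm : ∀ z ∈ ball x r₁, ‖g z‖ ≤ m)
    (hL : ∀ z ∈ ball x r₁, ‖M.odeSolve S g T z - flow f T z‖ ≤ T * L) :
    ‖g x - f x‖ ≤ 2 * L + (2 ^ (S + 1) * ((1 + M.kappa) * m * (32 * M.kappa * m / r₂) ^ p)
      + 6 * m * (p.factorial * (S / (Real.log 2 * (r₁ / (96 * M.kappa ^ 2 * m)))) ^ p))
        * (T / S) ^ p := by
  have hκ := M.one_le_kappa
  have hκ0 := M.kappa_pos
  have hκ2 : M.kappa ≤ M.kappa ^ 2 := le_self_pow₀ hκ two_ne_zero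
  have hS' : (1 : ℝ) ≤ S := by exact_mod_cast hS
  have hh0 : 0 < T / S := by positivity
  have hhT : T / S ≤ T := div_le_self hT.le hS'
  have hnorm : ‖((T / S : ℝ) : ℂ)‖ = T / S := by
    rw [Complex.norm_real, Real.norm_eq_abs, abs_of_pos hh0]
  have hfc : CurveHolomorphic (ball x (r₁ + r₂)) f := .of_differentiableOn hf.differentiableOn
  have hsub : ball x r₁ ⊆ ball x (r₁ + r₂) := ball_subset_ball (by linarith)
  set H := r₂ / (16 * M.kappa * m) with hH
  have hH0 : 0 < H := by positivity
  have hhH : ((T / S : ℝ) : ℂ) ∈ ball (0 : ℂ) H := by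
    rw [mem_ball_zero_iff, hnorm, hH, lt_div_iff₀ (by positivity)]
    have h1 : T / S * (16 * M.kappa * m) ≤ T * (16 * M.kappa ^ 2 * m) := by gcongr
    have h2 : 0 < M.kappa ^ 2 * m * T := by positivity
    linarith
  have hres : ∀ z ∈ ball x r₁,
      ‖flowIncrement f ((T / S : ℝ) : ℂ) z - M.increment ((T / S : ℝ) : ℂ) f z‖
        ≤ (1 + M.kappa) * m * (32 * M.kappa * m / r₂) ^ p * (T / S) ^ p := by
    intro z hz
    have hsubz : ball z (r₂ / 2 + r₂ / 2) ⊆ ball x (r₁ + r₂) := ball_subset_ball' (by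
      have := mem_ball.1 hz; linarith)
    refine (hM.norm_flowIncrement_sub_increment_le (half_pos hr₂)
      (hf.mono hsubz) (fun w hw => hfm w (hsubz hw)) hH0 (le_of_eq ?_) hhH).trans_eq ?_
    · rw [hH]; field_simp; norm_num
    · rw [hnorm, mul_assoc _ (_ ^ p), ← mul_pow, hH]
      congr 2
      field_simp
      norm_num
  refine (norm_sub_le_add_exp (hM.sum_b_eq_one hp) hS hr₁ hm0 hT hT₂ hfc hfm hg hgm
    (hfc.mono hsub) (fun z hz => (hfm z (hsub hz)).trans (by linarith)) hres hL).trans ?_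
  have hlog : 0 < Real.log 2 := Real.log_pos one_lt_two
  set a := Real.log 2 * (r₁ / (96 * M.kappa ^ 2 * m)) with ha
  have ha0 : 0 < a := by positivity
  -- The exponential term is absorbed into the order term using `u ^ p / p! ≤ exp u`.
  have hexp : Real.exp (-(a / T)) ≤ p.factorial * (S / a) ^ p * (T / S) ^ p := by
    have h1 := Real.pow_div_factorial_le_exp (a / T) (by positivity) p
    have h2 : (0 : ℝ) < p.factorial := by exact_mod_cast p.factorial_pos
    have e : p.factorial * (S / a) ^ p * (T / S) ^ p = ((a / T) ^ p / p.factorial)⁻¹ := by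
      rw [mul_assoc, ← mul_pow, show S / a * (T / S) = (a / T)⁻¹ by field_simp, inv_pow, inv_div,
        ← div_eq_mul_inv]
    rw [Real.exp_neg, e]
    exact inv_anti₀ (by positivity) h1
  have := mul_le_mul_of_nonneg_left hexp (by positivity : 0 ≤ 6 * m)
  linarith

end RungeKutta

/-! ### The main theorem -/

theorem theorem4 {s : ℕ} (M : RungeKutta s) (p : ℕ) (hp : 1 ≤ p) (hM : M.HasOrder p)
    (S : ℕ) (hS : 1 ≤ S) (m r₁ r₂ : ℝ) (hr₁ : 0 < r₁) (hr₂ : 0 < r₂) :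
    ∃ (T₀ q γ c₁ c₂ C : ℝ) (K : ℝ → ℕ),
      0 < T₀ ∧ 0 < q ∧ 0 < γ ∧ 0 < c₁ ∧ 0 < c₂ ∧ 0 < C ∧
      ∀ (N : ℕ) (x : Fin N → ℝ) (f fnet : (Fin N → ℂ) → (Fin N → ℂ)),
        RealAnalyticOn f (Metric.ball (toComplex x) (r₁ + r₂)) →
        RealAnalyticOn fnet (Metric.ball (toComplex x) (r₁ + r₂)) →
        (∀ y ∈ Metric.ball (toComplex x) (r₁ + r₂), ‖f y‖ ≤ m) →
        (∀ y ∈ Metric.ball (toComplex x) (r₁ + r₂), ‖fnet y‖ ≤ m) →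
        -- the IMDE coefficients exist and have their defining property
        M.IsIMDE f (Metric.ball (toComplex x) (r₁ + r₂)) (M.imdeCoeff f) ∧
        ∀ T : ℝ, 0 < T → T < T₀ →
          -- the solver, the exact flow and the supremum in the loss are well defined
          (∀ y ∈ Metric.ball (toComplex x) r₁,
            M.SolverDefined S fnet T y ∧ ∃! w, IsFlowValue f T y w) ∧
          BddAbove (solverError M S f fnet T '' Metric.ball (toComplex x) r₁) ∧
          -- the two error estimates
          ‖fnet (toComplex x) - M.imdeTrunc f (K T) (T / S) (toComplex x)‖
            ≤ c₁ * Real.exp (-γ / T ^ (1 / q))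
              + C * loss M S f fnet T (Metric.ball (toComplex x) r₁) ∧
          ‖fnet (toComplex x) - f (toComplex x)‖
            ≤ c₂ * (T / S) ^ p
              + C * loss M S f fnet T (Metric.ball (toComplex x) r₁) := by
  have hκ := M.one_le_kappa
  have hκ0 := M.kappa_pos
  have hκκ : M.kappa ≤ M.kappa ^ 2 := le_self_pow₀ hκ two_ne_zero
  have hlog : 0 < Real.log 2 := Real.log_pos one_lt_two
  have hS' : (0 : ℝ) < S := by exact_mod_cast hS
  -- The bound `m` may be zero or negative; the constants divide by a positive one.
  obtain ⟨m', hm', hm0⟩ : ∃ m' : ℝ, m ≤ m' ∧ 0 < m' :=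
    ⟨max m 1, le_max_left .., lt_max_of_lt_right one_pos⟩
  set η := r₂ / (192 * M.kappa ^ 2 * m') with hη
  set a := r₁ / (96 * M.kappa ^ 2 * m') with ha
  have hη0 : 0 < η := by positivity
  have ha0 : 0 < a := by positivity
  -- The rate is the smaller of those from the truncation (`η`) and from the recovery (`a`). The
  -- cutoff `T₀ = η / 2` guarantees `⌊η / T⌋₊ ≥ 2`, so the natural subtraction in `K(T)` is exact. A
  -- truncation at index `⌊η / T⌋₊ - 2` has `⌊η / T⌋₊ - 1` terms, one fewer than the floor, as
  -- `norm_sub_sum_imdeTaylor_le` requires. This loss of one term and the rounding produce the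
  -- factor 4.
  refine ⟨η / 2, 1, Real.log 2 * min η a, (2 ^ (S + 1) + 2) * m' * 4 + 6 * m',
    2 ^ (S + 1) * ((1 + M.kappa) * m' * (32 * M.kappa * m' / r₂) ^ p)
      + 6 * m' * (p.factorial * (S / (Real.log 2 * a)) ^ p), 2, fun T => ⌊η / T⌋₊ - 2,
    by positivity, one_pos, mul_pos hlog (lt_min hη0 ha0), by positivity, by positivity, two_pos,
    fun N x f fnet hf hg hfm hgm => ?_⟩
  replace hfm := fun y hy => (hfm y hy).trans hm'
  replace hgm := fun y hy => (hgm y hy).trans hm'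
  refine ⟨hM.isIMDE hp hf.1 hfm hm0.le, fun T hT hTη => ?_⟩
  generalize toComplex x = x at *
  have hM1 := hM.sum_b_eq_one hp
  have hfc : CurveHolomorphic (ball x (r₁ + r₂)) f := .of_differentiableOn hf.1.differentiableOn
  have hgc : CurveHolomorphic (ball x (r₁ + r₂)) fnet := .of_differentiableOn hg.1.differentiableOn
  have hsub : ball x r₁ ⊆ ball x (r₁ + r₂) := ball_subset_ball (by linarith)
  have hsuby : ∀ y ∈ ball x r₁, ball y r₂ ⊆ ball x (r₁ + r₂) := fun y hy =>
    ball_subset_ball' (by have := mem_ball.1 hy; linarith)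
  have hηr : 192 * M.kappa ^ 2 * m' * η = r₂ := by rw [hη]; field_simp
  have hpos : 0 < M.kappa ^ 2 * m' * T := by positivity
  have hT₂ : 96 * M.kappa ^ 2 * m' * (2 * T) ≤ r₂ := by
    rw [← hηr]
    have : 96 * M.kappa ^ 2 * m' * (2 * T) ≤ 96 * M.kappa ^ 2 * m' * η := by gcongr; linarith
    have : 0 < M.kappa ^ 2 * m' * η := by positivity
    linarith
  have hκT : M.kappa * m' * T ≤ M.kappa ^ 2 * m' * T := by gcongr
  have hmT : m' * T ≤ M.kappa * (m' * T) := le_mul_of_one_le_left (by positivity) hκ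
  have h16 : 16 * M.kappa * m' * T ≤ r₂ := by linarith
  have h8 : 8 * m' * (2 * T) ≤ r₂ := by linarith
  have hflow : ∀ y ∈ ball x r₁, ∀ w, IsFlowValue f T y w ↔ w = y + T • flowIncrement f (T : ℂ) y :=
    fun y hy w => isFlowValue_iff_flowIncrement hfc hfm hr₂ hm0.le h8 hy hT.le (by linarith) w
  -- Boundedness keeps `sSup` from taking its default value, so that `loss` really dominates the
  -- pointwise errors.
  have hbdd : BddAbove (solverError M S f fnet T '' ball x r₁) := by
    refine ⟨r₂ / 2 + T * m', ?_⟩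
    rintro _ ⟨y, hy, rfl⟩
    have h1 := (RungeKutta.approximation_spec (M := M) hS hr₂ (hgc.mono (hsuby y hy))
      (fun z hz => hgm z (hsuby y hy hz)) hT.le h16 le_rfl).1
    have h2 := norm_flowIncrement_le hfc hfm hr₂ hm0.le h8 (p := ((T : ℂ), y))
      ⟨by rw [mem_ball_zero_iff, Complex.norm_real, Real.norm_eq_abs, abs_of_pos hT]; linarith, hy⟩
    rw [solverError, RungeKutta.odeSolve,
      RungeKutta.iterate_step_eq_approximation hS hr₂ (hgc.mono (hsuby y hy))
        (fun z hz => hgm z (hsuby y hy hz)) hT.le h16 le_rfl,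
      flow_eq_flowIncrement hfc hfm hr₂ hm0.le h8 hy hT.le (by linarith), ← sub_sub]
    refine (norm_sub_le _ _).trans (add_le_add (mem_ball_iff_norm.1 h1).le ?_)
    rw [norm_smul, Real.norm_eq_abs, abs_of_pos hT]
    exact mul_le_mul_of_nonneg_left h2 hT.le
  have hL : ∀ z ∈ ball x r₁, ‖M.odeSolve S fnet T z - flow f T z‖
      ≤ T * loss M S f fnet T (ball x r₁) := fun z hz => by
    rw [loss, mul_div_cancel₀ _ hT.ne']
    exact le_csSup hbdd ⟨z, hz, rfl⟩
  refine ⟨fun y hy => ⟨RungeKutta.solverDefined_of_curveHolomorphic hS hr₂ (hgc.mono (hsuby y hy))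
      (fun z hz => hgm z (hsuby y hy hz)) hT.le h16, ?_⟩, hbdd, ?_, ?_⟩
  · simp only [hflow y hy]
    exact existsUnique_eq
  · have hη2 : 2 ≤ η / T := by rw [le_div_iff₀ hT]; linarith
    have hfl2 : 2 ≤ ⌊η / T⌋₊ := Nat.le_floor (by exact_mod_cast hη2)
    obtain ⟨K, hK⟩ : ∃ K, ⌊η / T⌋₊ = K + 1 := ⟨⌊η / T⌋₊ - 1, by omega⟩
    have hKη : (K : ℝ) + 1 ≤ η / T := by
      have := Nat.floor_le (a := η / T) (by positivity)
      rw [hK] at this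
      exact_mod_cast this
    have hmain := RungeKutta.norm_sub_sum_imdeTaylor_le hM1 hS hr₁ hr₂ hm0 hT (K := K) (by
      rw [le_div_iff₀ hT] at hKη
      calc _ = 192 * M.kappa ^ 2 * m' * ((K + 1) * T) := by ring
        _ ≤ 192 * M.kappa ^ 2 * m' * η := by gcongr
        _ = r₂ := hηr) hfc hfm (hgc.mono hsub) (fun z hz => hgm z (hsub hz)) hL
    have htrunc : M.imdeTrunc f (⌊η / T⌋₊ - 2) (T / S) x
        = ∑ k ∈ Finset.range K, (T / S) ^ k • M.imdeTaylor f k x := by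
      rw [RungeKutta.imdeTrunc, show ⌊η / T⌋₊ - 2 + 1 = K by omega]
      exact Finset.sum_congr rfl fun k _ => by
        rw [RungeKutta.imdeCoeff_eq_imdeTaylor hM1 hf.1 hfm hm0.le k x
          (mem_ball_self (by linarith))]
    have hexp : ∀ b, min η a ≤ b →
        Real.exp (-(Real.log 2 * b / T)) ≤ Real.exp (-(Real.log 2 * min η a) / T) := fun b hb => by
      rw [neg_div]
      gcongr
    have hhalf : (1 / 2 : ℝ) ^ K ≤ 4 * Real.exp (-(Real.log 2 * min η a) / T) := by
      have h1 := half_pow_floor_le (a := η / T)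
      rw [hK, pow_succ, ← mul_div_assoc (Real.log 2)] at h1
      have h2 := hexp η (min_le_left ..)
      linarith
    rw [htrunc, div_one, Real.rpow_one]
    have h1 := mul_le_mul_of_nonneg_left hhalf (by positivity : 0 ≤ (2 ^ (S + 1) + 2) * m')
    have h2 := mul_le_mul_of_nonneg_left (hexp a (min_le_right ..)) (by positivity : 0 ≤ 6 * m')
    linarith
  · have := hM.norm_sub_le hp hS hr₁ hr₂ hm0 hT (by linarith) hf.1 hfm (hgc.mono hsub)
      (fun z hz => hgm z (hsub hz)) hL
    linarith
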